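/- Conventions. A smooth manifold is modelled on a Hausdorff locally convex real topological vector space, and smooth means $C^\infty$ in the sense of Michal and Bastiani. Let $G$ be a Lie group acting smoothly from the left on a smooth manifold $M$. Let $G^\bullet\times M$ be the simplicial manifold with $G^p\times M$ in degree $p$, faces $$\partial_0(g_1,\dots,g_p,x)=(g_2,\dots,g_p,x),\qquad \partial_i(g_1,\dots,g_p,x)=(g_1,\dots,g_ig_{i+1},\dots,g_p,x)\ (0<i<p),\qquad \partial_p(g_1,\dots,g_p,x)=(g_1,\dots,g_{p-1},g_px),$$ and degeneracies that insert the unit element. Let $\pi:G^\bullet\times M\to G^\bullet\times pt$ be the projection. Let $\underline{\mathbb T}$ be the simplicial sheaf on $G^\bullet\times M$ of smooth functions with values in $\mathbb T=\{u\in\mathbb C:|u|=1\}$, let $\pi^{-1}\underline{\mathbb T}$ be the inverse image of the corresponding simplicial sheaf on $G^\bullet\times pt$, and let $\underline A^q_{rel}=\underline A^q/F^1\underline A^q$ be the simplicial sheaf of real-valued smooth relative $q$-forms with respect to $\pi$, where $F^1\underline A^q$ consists of the $q$-forms that vanish on all $q$-tuples of tangent vectors along the fibres of $\pi$; let $\underline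 A^q_{rel,cl}$ be the subsheaf of forms that are closed under the relative exterior derivative. For $N\ge 0$ let $\bar{\mathcal F}(N)$ be the complex of simplicial sheaves $$\underline{\mathbb T}\xrightarrow{\ \frac1{2\pi i}d\log\ }\underline A^1_{rel}\xrightarrow{\ d\ }\cdots\xrightarrow{\ d\ }\underline A^N_{rel}\to 0\to\cdots$$ with $\underline{\mathbb T}$ in degree $0$. Hypercohomology $H^m(G^\bullet\times M,-)$ means the right derived functors of the functor of global sections on complexes of simplicial sheaves. Let $A^{N+1}(M)^G_{cl}$ be the group of closed $G$-invariant smooth real-valued $(N+1)$-forms on $M$. The exterior derivative $\underline A^N_{rel}\to\underline A^{N+1}_{rel,cl}$ gives a morphism of complexes $d:\bar{\mathcal F}(N)\to\underline A^{N+1}_{rel,cl}[-N]$. Composing the map induced by it in degree $N$ with the canonical map $H^N(G^\bullet\times M,\underline A^{N+1}_{rel,cl}[-N])\to A^{N+1}(M)^G_{cl}$, which evaluates global sections on $G^0\times M=M$, defines a homomorphism $$d:H^N(G^\bullet\times M,\bar{\mathcal F}(N))\to A^{N+1}(M)^G_{cl}.$$ Proposition. Let $N\ge 1$. (a) For $0\le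 m<N$ the inclusion $\pi^{-1}\underline{\mathbb T}\to\bar{\mathcal F}(N)$ induces an isomorphism $$H^m(G^\bullet\times M,\pi^{-1}\underline{\mathbb T})\cong H^m(G^\bullet\times M,\bar{\mathcal F}(N)).$$ (b) There is an exact sequence $$0\to H^N(G^\bullet\times M,\pi^{-1}\underline{\mathbb T})\to H^N(G^\bullet\times M,\bar{\mathcal F}(N))\xrightarrow{\ d\ }A^{N+1}(M)^G_{cl}\xrightarrow{\ \delta\ }H^{N+1}(G^\bullet\times M,\pi^{-1}\underline{\mathbb T}),$$ in which the first map is induced by the inclusion. More precisely, there is a morphism $b$ in the derived category of simplicial sheaves that makes $$\pi^{-1}\underline{\mathbb T}\to\bar{\mathcal F}(N)\xrightarrow{\ d\ }\underline A^{N+1}_{rel,cl}[-N]\xrightarrow{\ b\ }\pi^{-1}\underline{\mathbb T}[1]$$ a distinguished triangle, and $\delta$ is the homomorphism such that, for each class $c\in H^N(G^\bullet\times M,\underline A^{N+1}_{rel,cl}[-N])$, it takes the image of $c$ in $A^{N+1}(M)^G_{cl}$ to $b_*(c)$. -/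

import Mathlib

set_option linter.unusedSectionVars false

open Set Filter Topology CategoryTheory Opposite TopologicalSpace

universe u v w

namespace EqDeligne

section Calculus

/-- `f` has directional derivative `f'` at `x` in direction `v`: the difference quotients
`(f (x + t v) - f x) / t` converge to `f'` as `t → 0`, `t ≠ 0`. -/
def HasDirDeriv {E F : Type*} [AddCommGroup E] [Module ℝ E] [AddCommGroup F] [Module ℝ F]
    [TopologicalSpace F] (f : E → F) (x v : E) (f' : F) : Prop :=
  Tendsto (fun t : ℝ => t⁻¹ • (f (x + t • v) - f x)) (𝓝[≠] 0) (𝓝 f')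

open Classical in
/-- The directional derivative `df(x; v)`, and `0` where it does not exist. -/
noncomputable def dirDeriv {E F : Type*} [AddCommGroup E] [Module ℝ E] [AddCommGroup F]
    [Module ℝ F] [TopologicalSpace F] (f : E → F) (x v : E) : F :=
  if h : ∃ f', HasDirDeriv f x v f' then h.choose else 0

/-- Maps of class `C^k` on an open set `U` between locally convex spaces, in the sense of Michal and
Bastiani: `f` is continuous, all directional derivatives exist on `U`, and `(x, v) ↦ df(x; v)` is of
class `C^(k-1)` on `U × E`. For Banach spaces and `k = ∞` these are the usual smooth maps. -/
def CkOn {F : Type v} [AddCommGroup F] [Module ℝ F] [TopologicalSpace F] :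
    (k : ℕ) → {E : Type u} → [AddCommGroup E] → [Module ℝ E] → [TopologicalSpace E] →
      (E → F) → Set E → Prop
  | 0, _, _, _, _, f, U => ContinuousOn f U
  | k + 1, E, _, _, _, f, U => ContinuousOn f U ∧
      (∀ x ∈ U, ∀ v : E, ∃ f', HasDirDeriv f x v f') ∧
      CkOn k (fun p : E × E => dirDeriv f p.1 p.2) (U ×ˢ univ)

/-- Smooth maps on an open subset of a locally convex space. -/
def SmoothOn {E : Type u} {F : Type v} [AddCommGroup E] [Module ℝ E] [TopologicalSpace E]
    [AddCommGroup F] [Module ℝ F] [TopologicalSpace F] (f : E → F) (U : Set E) : Prop :=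
  ∀ k, CkOn k f U

variable {E : Type u} [AddCommGroup E] [Module ℝ E] [TopologicalSpace E]
  {F : Type v} [AddCommGroup F] [Module ℝ F] [TopologicalSpace F]
  {H : Type w} [AddCommGroup H] [Module ℝ H] [TopologicalSpace H]

theorem HasDirDeriv.eq [T2Space F] {f : E → F} {x v : E} {a : F} (h : HasDirDeriv f x v a) :
    dirDeriv f x v = a := by
  have h' : ∃ f', HasDirDeriv f x v f' := ⟨a, h⟩
  unfold dirDeriv
  rw [dif_pos h']
  exact tendsto_nhds_unique h'.choose_spec h

theorem hasDirDeriv_of_exists {f : E → F} {x v : E} (h : ∃ f', HasDirDeriv f x v f') :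
    HasDirDeriv f x v (dirDeriv f x v) := by
  unfold dirDeriv
  rw [dif_pos h]
  exact h.choose_spec

theorem tendsto_line [ContinuousAdd E] [ContinuousSMul ℝ E] (x v : E) :
    Tendsto (fun t : ℝ => x + t • v) (𝓝[≠] 0) (𝓝 x) := by
  have : Continuous (fun t : ℝ => x + t • v) := by fun_prop
  have h := (this.tendsto 0).mono_left (nhdsWithin_le_nhds (s := {0}ᶜ))
  simpa using h

theorem HasDirDeriv.congr [ContinuousAdd E] [ContinuousSMul ℝ E] {f g : E → F} {x v : E} {a : F}
    (h : HasDirDeriv f x v a) (hfg : f =ᶠ[𝓝 x] g) : HasDirDeriv g x v a := by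
  refine Tendsto.congr' ?_ h
  filter_upwards [(tendsto_line x v).eventually hfg] with t ht
  rw [ht, hfg.eq_of_nhds]

open Classical in
theorem dirDeriv_eq_of_eq {D : Type*} [AddCommGroup D] [Module ℝ D] {f : E → F} {g : D → F}
    {x v : E} {y w : D} (h : (fun a => HasDirDeriv f x v a) = fun a => HasDirDeriv g y w a) :
    dirDeriv f x v = dirDeriv g y w := by
  have key : ∀ p q : F → Prop, p = q →
      (if h : ∃ a, p a then h.choose else 0) = (if h : ∃ a, q a then h.choose else 0) := by
    rintro p _ rfl; rfl
  exact key _ _ h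

theorem dirDeriv_congr [ContinuousAdd E] [ContinuousSMul ℝ E] {f g : E → F} {x : E}
    (hfg : f =ᶠ[𝓝 x] g) (v : E) : dirDeriv f x v = dirDeriv g x v := by
  have : (fun a => HasDirDeriv f x v a) = fun a => HasDirDeriv g x v a := by
    ext a
    exact ⟨fun h => h.congr hfg, fun h => h.congr hfg.symm⟩
  exact dirDeriv_eq_of_eq this

theorem CkOn.continuousOn {k : ℕ} {f : E → F} {U : Set E} (h : CkOn k f U) :
    ContinuousOn f U := by
  cases k with
  | zero => exact h
  | succ k => exact h.1

theorem CkOn.mono {k : ℕ} : ∀ {E : Type u} [AddCommGroup E] [Module ℝ E] [TopologicalSpace E]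
    {f : E → F} {U V : Set E}, CkOn k f U → V ⊆ U → CkOn k f V := by
  induction k with
  | zero => intro E _ _ _ f U V h hV; exact ContinuousOn.mono h hV
  | succ k ih =>
    intro E _ _ _ f U V h hV
    exact ⟨h.1.mono hV, fun x hx => h.2.1 x (hV hx), ih h.2.2 (prod_mono hV subset_rfl)⟩

theorem CkOn.of_succ {k : ℕ} : ∀ {E : Type u} [AddCommGroup E] [Module ℝ E] [TopologicalSpace E]
    {f : E → F} {U : Set E}, CkOn (k + 1) f U → CkOn k f U := by
  induction k with
  | zero => intro E _ _ _ f U h; exact h.1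
  | succ k ih => intro E _ _ _ f U h; exact ⟨h.1, h.2.1, ih h.2.2⟩

theorem CkOn.congr {k : ℕ} : ∀ {E : Type u} [AddCommGroup E] [Module ℝ E] [TopologicalSpace E]
    [ContinuousAdd E] [ContinuousSMul ℝ E]
    {f g : E → F} {U : Set E}, IsOpen U → CkOn k f U → EqOn f g U → CkOn k g U := by
  induction k with
  | zero => intro E _ _ _ _ _ f g U _ h hfg; exact ContinuousOn.congr h hfg.symm
  | succ k ih =>
    intro E _ _ _ _ _ f g U hU h hfg
    have key : ∀ x ∈ U, f =ᶠ[𝓝 x] g := fun x hx => by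
      filter_upwards [hU.mem_nhds hx] with y hy using hfg hy
    refine ⟨h.1.congr hfg.symm, fun x hx v => ?_, ih (hU.prod isOpen_univ) h.2.2 ?_⟩
    · obtain ⟨a, ha⟩ := h.2.1 x hx v
      exact ⟨a, ha.congr (key x hx)⟩
    · intro p hp
      exact dirDeriv_congr (key p.1 hp.1) p.2

theorem CkOn.of_local {k : ℕ} : ∀ {E : Type u} [AddCommGroup E] [Module ℝ E] [TopologicalSpace E]
    {f : E → F} {U : Set E}, (∀ x ∈ U, ∃ V, IsOpen V ∧ x ∈ V ∧ CkOn k f V) → CkOn k f U := by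
  induction k with
  | zero =>
    intro E _ _ _ f U h x hx
    obtain ⟨V, hV, hxV, hf⟩ := h x hx
    exact (ContinuousOn.continuousAt hf (hV.mem_nhds hxV)).continuousWithinAt
  | succ k ih =>
    intro E _ _ _ f U h
    refine ⟨fun x hx => ?_, fun x hx v => ?_, ih fun p hp => ?_⟩
    · obtain ⟨V, hV, hxV, hf⟩ := h x hx
      exact (hf.1.continuousAt (hV.mem_nhds hxV)).continuousWithinAt
    · obtain ⟨V, hV, hxV, hf⟩ := h x hx
      exact hf.2.1 x hxV v
    · obtain ⟨V, hV, hxV, hf⟩ := h p.1 hp.1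
      exact ⟨V ×ˢ univ, hV.prod isOpen_univ, ⟨hxV, trivial⟩, hf.2.2⟩

/-- The mean value inequality. -/
theorem mean_value [IsTopologicalAddGroup F] [ContinuousSMul ℝ F] [LocallyConvexSpace ℝ F]
    {c c' : ℝ → F} {K : Set F} (hK : Convex ℝ K) (hKc : IsClosed K)
    (hc : ∀ s ∈ Icc (0:ℝ) 1, HasDirDeriv c s 1 (c' s)) (hc' : ∀ s ∈ Icc (0:ℝ) 1, c' s ∈ K) :
    c 1 - c 0 ∈ K := by
  by_contra hx
  obtain ⟨f, a, hfa, hfx⟩ := geometric_hahn_banach_closed_point hK hKc hx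
  have hd : ∀ s ∈ Icc (0:ℝ) 1, HasDerivAt (fun s => f (c s)) (f (c' s)) s := by
    intro s hs
    rw [hasDerivAt_iff_tendsto_slope_zero]
    have := (f.continuous.tendsto _).comp (hc s hs)
    refine this.congr fun t => ?_
    simp
  obtain ⟨s, hs, hs'⟩ := exists_hasDerivAt_eq_slope (fun s => f (c s)) (fun s => f (c' s))
    (zero_lt_one) (fun s hs => (hd s hs).continuousAt.continuousWithinAt)
    (fun s hs => hd s (Ioo_subset_Icc_self hs))
  have h1 := hfa _ (hc' s (Ioo_subset_Icc_self hs))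
  have h2 : f (c' s) = f (c 1 - c 0) := by simpa using hs'
  linarith

theorem exists_closed_convex_nhds [IsTopologicalAddGroup F] [ContinuousSMul ℝ F]
    [LocallyConvexSpace ℝ F] {a : F} {W : Set F} (hW : W ∈ 𝓝 a) :
    ∃ K ∈ 𝓝 a, IsClosed K ∧ Convex ℝ K ∧ K ⊆ W := by
  obtain ⟨C, ⟨hC, hCc⟩, hCW⟩ := (closed_nhds_basis a).mem_iff.1 hW
  obtain ⟨K, ⟨hK, hKc⟩, hKC⟩ := (LocallyConvexSpace.convex_basis (𝕜 := ℝ) a).mem_iff.1 hC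
  exact ⟨closure K, mem_of_superset hK subset_closure, isClosed_closure, hKc.closure,
    (closure_minimal hKC hCc).trans hCW⟩

theorem HasDirDeriv.line [ContinuousAdd E] [ContinuousSMul ℝ E] [ContinuousSMul ℝ F]
    {f : E → F} {x v : E} {s t : ℝ} {a : F} (ht : t ≠ 0)
    (h : HasDirDeriv f (x + (s * t) • v) v a) :
    HasDirDeriv (fun r : ℝ => t⁻¹ • f (x + (r * t) • v)) s 1 a := by
  have h1 : Tendsto (fun r : ℝ => r * t) (𝓝[≠] 0) (𝓝[≠] 0) := by
    refine tendsto_nhdsWithin_iff.2 ⟨?_, ?_⟩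
    · have : Continuous fun r : ℝ => r * t := by fun_prop
      simpa using (this.tendsto 0).mono_left (nhdsWithin_le_nhds (s := {0}ᶜ))
    · filter_upwards [self_mem_nhdsWithin] with r hr
      exact mul_ne_zero hr ht
  refine (Tendsto.comp h h1).congr fun r => ?_
  simp only [Function.comp, smul_eq_mul, mul_one, ← smul_sub, smul_smul]
  rw [mul_inv_rev, mul_comm t⁻¹, add_assoc, ← add_smul, ← add_mul]

theorem CkOn.strict [IsTopologicalAddGroup E] [ContinuousSMul ℝ E]
    [IsTopologicalAddGroup F] [ContinuousSMul ℝ F] [LocallyConvexSpace ℝ F]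
    {f : E → F} {U : Set E} (hU : IsOpen U) (hf : CkOn 1 f U) {x : E} (hx : x ∈ U) (v : E) :
    Tendsto (fun p : ℝ × E × E => p.1⁻¹ • (f (p.2.1 + p.1 • p.2.2) - f p.2.1))
      ((𝓝[≠] 0) ×ˢ 𝓝 (x, v)) (𝓝 (dirDeriv f x v)) := by
  intro W hW
  obtain ⟨K, hK, hKc, hKconv, hKW⟩ := exists_closed_convex_nhds hW
  have hcont : ContinuousAt (fun p : E × E => dirDeriv f p.1 p.2) (x, v) :=
    ContinuousOn.continuousAt hf.2.2 ((hU.prod isOpen_univ).mem_nhds ⟨hx, trivial⟩)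
  have hN : ∀ᶠ p : E × E in 𝓝 (x, v), p.1 ∈ U ∧ dirDeriv f p.1 p.2 ∈ K :=
    ((continuous_fst.tendsto (x, v)).eventually (hU.mem_nhds hx)).and (hcont hK)
  have hg : Continuous fun q : ℝ × ℝ × E × E => (q.2.2.1 + (q.1 * q.2.1) • q.2.2.2, q.2.2.2) := by
    fun_prop
  have hev : ∀ᶠ p : ℝ × E × E in 𝓝 ((0:ℝ), x, v), ∀ s ∈ Icc (0:ℝ) 1,
      (p.2.1 + (s * p.1) • p.2.2) ∈ U ∧ dirDeriv f (p.2.1 + (s * p.1) • p.2.2) p.2.2 ∈ K := by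
    refine isCompact_Icc.eventually_forall_of_forall_eventually fun s hs => ?_
    have := (hg.comp (continuous_swap (X := ℝ × E × E) (Y := ℝ))).tendsto ((0, x, v), s)
    simp only [Function.comp, Prod.swap, mul_zero, zero_smul, add_zero] at this
    exact this.eventually hN
  have hle : (𝓝[≠] (0:ℝ)) ×ˢ 𝓝 (x, v) ≤ 𝓝 ((0:ℝ), x, v) := by
    rw [nhds_prod_eq (x := (0:ℝ)) (y := (x, v))]
    exact Filter.prod_mono nhdsWithin_le_nhds le_rfl
  have hne : ∀ᶠ p : ℝ × E × E in (𝓝[≠] (0:ℝ)) ×ˢ 𝓝 (x, v), p.1 ≠ 0 :=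
    (tendsto_fst (f := 𝓝[≠] (0:ℝ)) (g := 𝓝 (x, v))).eventually
      eventually_mem_nhdsWithin
  rw [mem_map]
  filter_upwards [hle hev, hne] with p hp hp0
  apply hKW
  have := mean_value (c := fun r : ℝ => p.1⁻¹ • f (p.2.1 + (r * p.1) • p.2.2)) hKconv hKc
    (fun s hs => HasDirDeriv.line hp0 (hasDirDeriv_of_exists (hf.2.1 _ (hp s hs).1 _)))
    (fun s hs => (hp s hs).2)
  simpa [smul_sub] using this

end Calculus

section Calculus

section
variable {E : Type u} [AddCommGroup E] [Module ℝ E] [TopologicalSpace E]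
  {F : Type v} [AddCommGroup F] [Module ℝ F] [TopologicalSpace F]

theorem HasDirDeriv.smul [ContinuousConstSMul ℝ F] {f : E → F} {x v : E} {a : F}
    (h : HasDirDeriv f x v a) (c : ℝ) : HasDirDeriv f x (c • v) (c • a) := by
  by_cases hc : c = 0
  · subst hc
    simp only [HasDirDeriv, zero_smul, smul_zero, add_zero, sub_self]
    exact tendsto_const_nhds
  · have h1 : Tendsto (fun r : ℝ => r * c) (𝓝[≠] 0) (𝓝[≠] 0) := by
      refine tendsto_nhdsWithin_iff.2 ⟨?_, ?_⟩
      · have : Continuous fun r : ℝ => r * c := by fun_prop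
        simpa using (this.tendsto 0).mono_left (nhdsWithin_le_nhds (s := {0}ᶜ))
      · filter_upwards [self_mem_nhdsWithin] with r hr
        exact mul_ne_zero hr hc
    refine (Tendsto.const_smul (Tendsto.comp h h1) c).congr fun r => ?_
    simp only [Function.comp, smul_smul]
    rw [mul_inv_rev, ← mul_assoc, mul_inv_cancel₀ hc, one_mul]

variable [IsTopologicalAddGroup E] [ContinuousSMul ℝ E]
  [IsTopologicalAddGroup F] [ContinuousSMul ℝ F] [LocallyConvexSpace ℝ F] [T2Space F]

theorem CkOn.isLinearMap {f : E → F} {U : Set E} (hU : IsOpen U) (hf : CkOn 1 f U) {x : E}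
    (hx : x ∈ U) : IsLinearMap ℝ (dirDeriv f x) := by
  refine ⟨fun v w => ?_, fun c v => ((hasDirDeriv_of_exists (hf.2.1 x hx v)).smul c).eq⟩
  apply HasDirDeriv.eq
  have h0 := hasDirDeriv_of_exists (hf.2.1 x hx v)
  have h1 : Tendsto (fun t : ℝ => (t, x + t • v, w)) (𝓝[≠] 0) ((𝓝[≠] 0) ×ˢ 𝓝 (x, w)) :=
    tendsto_id.prodMk ((tendsto_line x v).prodMk_nhds tendsto_const_nhds)
  have h2 := ((hf.strict hU hx w).comp h1).add h0
  rw [add_comm (dirDeriv f x v)]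
  refine h2.congr fun t => ?_
  simp only [Function.comp, ← smul_add]
  congr 1
  rw [smul_add, ← add_assoc]
  abel

theorem hasDirDeriv_comp {D : Type w} [AddCommGroup D] [Module ℝ D]
    [TopologicalSpace D] [ContinuousAdd D] [ContinuousSMul ℝ D]
    {g : D → E} {f : E → F} {V : Set E} (hV : IsOpen V) (hf : CkOn 1 f V)
    {x v : D} {a : E} (hg : HasDirDeriv g x v a) (hx : g x ∈ V) :
    HasDirDeriv (fun y => f (g y)) x v (dirDeriv f (g x) a) := by
  have h1 : Tendsto (fun t : ℝ => (t, g x, t⁻¹ • (g (x + t • v) - g x))) (𝓝[≠] 0)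
      ((𝓝[≠] 0) ×ˢ 𝓝 (g x, a)) :=
    tendsto_id.prodMk (tendsto_const_nhds.prodMk_nhds hg)
  refine ((hf.strict hV hx a).comp h1).congr' ?_
  filter_upwards [self_mem_nhdsWithin] with t (ht : t ≠ 0)
  simp only [Function.comp]
  rw [smul_smul, mul_inv_cancel₀ ht, one_smul, add_sub_cancel]
end

section
variable {E : Type u} [AddCommGroup E] [Module ℝ E] [TopologicalSpace E]
  {F : Type v} [AddCommGroup F] [Module ℝ F] [TopologicalSpace F]
  {H : Type w} [AddCommGroup H] [Module ℝ H] [TopologicalSpace H]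

theorem HasDirDeriv.prodMk {f : E → F} {g : E → H} {x v : E} {a : F} {b : H}
    (hf : HasDirDeriv f x v a) (hg : HasDirDeriv g x v b) :
    HasDirDeriv (fun y => (f y, g y)) x v (a, b) :=
  Tendsto.prodMk_nhds hf hg

theorem HasDirDeriv.clm {D : Type*} [AddCommGroup D] [Module ℝ D] {g : D → E} {x v : D} {a : E}
    (L : E →L[ℝ] F) (h : HasDirDeriv g x v a) : HasDirDeriv (fun y => L (g y)) x v (L a) :=
  ((L.continuous.tendsto _).comp h).congr fun t => by simp

theorem hasDirDeriv_id [T2Space E] (x v : E) : HasDirDeriv (fun y : E => y) x v v := by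
  refine tendsto_const_nhds.congr' ?_
  filter_upwards [self_mem_nhdsWithin] with t (ht : t ≠ 0)
  rw [add_sub_cancel_left, smul_smul, inv_mul_cancel₀ ht, one_smul]

theorem hasDirDeriv_const (c : F) (x v : E) : HasDirDeriv (fun _ : E => c) x v 0 := by
  simp only [HasDirDeriv, sub_self, smul_zero]
  exact tendsto_const_nhds

theorem CkOn.const [T2Space F] (k : ℕ) : ∀ {E : Type u} [AddCommGroup E] [Module ℝ E]
    [TopologicalSpace E] (c : F) (U : Set E), CkOn k (fun _ : E => c) U := by
  induction k with
  | zero => intro E _ _ _ c U; exact continuousOn_const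
  | succ k ih =>
    intro E _ _ _ c U
    refine ⟨continuousOn_const, fun x _ v => ⟨0, hasDirDeriv_const c x v⟩, ?_⟩
    have : (fun p : E × E => dirDeriv (fun _ => c) p.1 p.2) = fun _ => 0 :=
      funext fun p => (hasDirDeriv_const c p.1 p.2).eq
    rw [this]
    exact ih 0 _

theorem CkOn.clm [T2Space F] (k : ℕ) : ∀ {E : Type u} [AddCommGroup E] [Module ℝ E]
    [TopologicalSpace E] [T2Space E] (L : E →L[ℝ] F) (U : Set E), CkOn k (fun x => L x) U := by
  induction k with
  | zero => intro E _ _ _ _ L U; exact L.continuous.continuousOn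
  | succ k ih =>
    intro E _ _ _ _ L U
    refine ⟨L.continuous.continuousOn, fun x _ v => ⟨_, (hasDirDeriv_id x v).clm L⟩, ?_⟩
    have : (fun p : E × E => dirDeriv (fun x => L x) p.1 p.2) =
        fun p => (L.comp (ContinuousLinearMap.snd ℝ E E)) p :=
      funext fun p => ((hasDirDeriv_id p.1 p.2).clm L).eq
    rw [this]
    exact ih _ _

theorem CkOn.prodMk [T2Space F] [T2Space H] (k : ℕ) : ∀ {E : Type u} [AddCommGroup E] [Module ℝ E]
    [TopologicalSpace E] [ContinuousAdd E] [ContinuousSMul ℝ E] {f : E → F} {g : E → H} {U : Set E},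
    IsOpen U → CkOn k f U → CkOn k g U → CkOn k (fun x => (f x, g x)) U := by
  induction k with
  | zero => intro E _ _ _ _ _ f g U _ hf hg; exact ContinuousOn.prodMk hf hg
  | succ k ih =>
    intro E _ _ _ _ _ f g U hU hf hg
    have key : ∀ x ∈ U, ∀ v, HasDirDeriv (fun x => (f x, g x)) x v
        (dirDeriv f x v, dirDeriv g x v) := fun x hx v =>
      (hasDirDeriv_of_exists (hf.2.1 x hx v)).prodMk (hasDirDeriv_of_exists (hg.2.1 x hx v))
    refine ⟨hf.1.prodMk hg.1, fun x hx v => ⟨_, key x hx v⟩, ?_⟩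
    refine (ih (hU.prod isOpen_univ) hf.2.2 hg.2.2).congr (hU.prod isOpen_univ) ?_
    intro p hp
    exact (key p.1 hp.1 p.2).eq.symm

theorem CkOn.pi {ι : Type*} [T2Space F] (k : ℕ) : ∀ {E : Type u} [AddCommGroup E] [Module ℝ E]
    [TopologicalSpace E] [ContinuousAdd E] [ContinuousSMul ℝ E] {f : ι → E → F} {U : Set E},
    IsOpen U → (∀ i, CkOn k (f i) U) → CkOn k (fun x i => f i x) U := by
  induction k with
  | zero => intro E _ _ _ _ _ f U _ hf; exact continuousOn_pi.2 hf
  | succ k ih =>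
    intro E _ _ _ _ _ f U hU hf
    have key : ∀ x ∈ U, ∀ v, HasDirDeriv (fun x i => f i x) x v (fun i => dirDeriv (f i) x v) :=
      fun x hx v => tendsto_pi_nhds.2 fun i => hasDirDeriv_of_exists ((hf i).2.1 x hx v)
    refine ⟨continuousOn_pi.2 fun i => (hf i).1, fun x hx v => ⟨_, key x hx v⟩, ?_⟩
    refine (ih (hU.prod isOpen_univ) fun i => (hf i).2.2).congr (hU.prod isOpen_univ) ?_
    intro p hp
    exact (key p.1 hp.1 p.2).eq.symm

theorem CkOn.comp_clm (k : ℕ) : ∀ {D : Type w} [AddCommGroup D] [Module ℝ D]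
    [TopologicalSpace D] {E : Type u} [AddCommGroup E] [Module ℝ E] [TopologicalSpace E]
    (L : D →L[ℝ] E) {f : E → F} {U : Set D} {V : Set E}, CkOn k f V → MapsTo L U V →
    CkOn k (fun x => f (L x)) U := by
  induction k with
  | zero =>
    intro D _ _ _ E _ _ _ L f U V hf hUV
    exact ContinuousOn.comp hf L.continuous.continuousOn hUV
  | succ k ih =>
    intro D _ _ _ E _ _ _ L f U V hf hUV
    have key : ∀ x v, (fun a => HasDirDeriv (fun x => f (L x)) x v a) =
        fun a => HasDirDeriv f (L x) (L v) a := by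
      intro x v; ext a; simp [HasDirDeriv]
    refine ⟨hf.1.comp L.continuous.continuousOn hUV, fun x hx v => ?_, ?_⟩
    · obtain ⟨a, ha⟩ := hf.2.1 (L x) (hUV hx) (L v)
      exact ⟨a, (congrFun (key x v) a).mpr ha⟩
    · have : (fun p : D × D => dirDeriv (fun x => f (L x)) p.1 p.2) =
          fun p => (fun q : E × E => dirDeriv f q.1 q.2) ((L.prodMap L) p) := by
        funext p
        exact dirDeriv_eq_of_eq (key p.1 p.2)
      rw [this]
      exact ih (L.prodMap L) hf.2.2 fun p hp => ⟨hUV hp.1, trivial⟩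

theorem CkOn.comp [IsTopologicalAddGroup H] [ContinuousSMul ℝ H] [LocallyConvexSpace ℝ H]
    [T2Space H] (k : ℕ) : ∀ {E : Type u} [AddCommGroup E] [Module ℝ E] [TopologicalSpace E]
    [ContinuousAdd E] [ContinuousSMul ℝ E] [T2Space E]
    {F : Type v} [AddCommGroup F] [Module ℝ F] [TopologicalSpace F] [IsTopologicalAddGroup F]
    [ContinuousSMul ℝ F] [LocallyConvexSpace ℝ F] [T2Space F]
    {f : F → H} {g : E → F} {U : Set E} {V : Set F}, IsOpen U → IsOpen V → CkOn k f V →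
    CkOn k g U → MapsTo g U V → CkOn k (fun x => f (g x)) U := by
  induction k with
  | zero =>
    intro E _ _ _ _ _ _ F _ _ _ _ _ _ _ f g U V _ _ hf hg hUV
    exact ContinuousOn.comp hf hg hUV
  | succ k ih =>
    intro E _ _ _ _ _ _ F _ _ _ _ _ _ _ f g U V hU hV hf hg hUV
    have hf1 : CkOn 1 f V := by
      clear ih hg
      induction k with
      | zero => exact hf
      | succ k ih => exact ih hf.of_succ
    have key : ∀ x ∈ U, ∀ v, HasDirDeriv (fun x => f (g x)) x v
        (dirDeriv f (g x) (dirDeriv g x v)) := fun x hx v =>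
      hasDirDeriv_comp hV hf1 (hasDirDeriv_of_exists (hg.2.1 x hx v)) (hUV hx)
    refine ⟨hf.1.comp hg.1 hUV, fun x hx v => ⟨_, key x hx v⟩, ?_⟩
    have hU' : IsOpen (U ×ˢ (univ : Set E)) := hU.prod isOpen_univ
    have h1 : CkOn k (fun p : E × E => g p.1) (U ×ˢ univ) :=
      CkOn.comp_clm k (ContinuousLinearMap.fst ℝ E E) hg.of_succ fun p hp => hp.1
    have h2 := ih (f := fun q : F × F => dirDeriv f q.1 q.2) hU' (hV.prod isOpen_univ) hf.2.2
      (CkOn.prodMk k hU' h1 hg.2.2) fun p hp => ⟨hUV hp.1, trivial⟩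
    refine h2.congr hU' fun p hp => ?_
    exact (key p.1 hp.1 p.2).eq.symm

end

theorem ckOn_of_contDiffOn (k : ℕ) : ∀ {E : Type u} [NormedAddCommGroup E] [NormedSpace ℝ E]
    {F : Type v} [NormedAddCommGroup F] [NormedSpace ℝ F] {f : E → F} {U : Set E}, IsOpen U →
    ContDiffOn ℝ k f U → CkOn k f U := by
  induction k with
  | zero => intro E _ _ F _ _ f U _ hf; exact hf.continuousOn
  | succ k ih =>
    intro E _ _ F _ _ f U hU hf
    have key : ∀ x ∈ U, ∀ v, HasDirDeriv f x v (fderiv ℝ f x v) := by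
      intro x hx v
      have h1 : HasFDerivAt f (fderiv ℝ f x) x :=
        ((hf.contDiffAt (hU.mem_nhds hx)).differentiableAt (by simp)).hasFDerivAt
      exact hasDerivAt_iff_tendsto_slope_zero.1 (h1.hasLineDerivAt v) |>.congr fun t => by simp
    refine ⟨hf.continuousOn, fun x hx v => ⟨_, key x hx v⟩, ?_⟩
    have h2 : ContDiffOn ℝ k (fun p : E × E => fderiv ℝ f p.1 p.2) (U ×ˢ univ) := by
      have h3 : ContDiffOn ℝ k (fderiv ℝ f) U := hf.fderiv_of_isOpen hU (by simp)
      exact (h3.comp contDiffOn_fst fun p hp => hp.1).clm_apply contDiffOn_snd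
    refine (ih (hU.prod isOpen_univ) h2).congr (hU.prod isOpen_univ) ?_
    intro p hp
    exact (key p.1 hp.1 p.2).eq.symm

end Calculus

section Calculus2

theorem CkOn.of_le {E : Type u} [AddCommGroup E] [Module ℝ E] [TopologicalSpace E]
    {F : Type v} [AddCommGroup F] [Module ℝ F] [TopologicalSpace F] {f : E → F} {U : Set E}
    {k l : ℕ} (hkl : l ≤ k) (h : CkOn k f U) : CkOn l f U := by
  induction hkl with
  | refl => exact h
  | step _ ih => exact ih h.of_succ

section
variable {E : Type u} [AddCommGroup E] [Module ℝ E] [TopologicalSpace E]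
  {F : Type v} [AddCommGroup F] [Module ℝ F] [TopologicalSpace F]

theorem HasDirDeriv.add [ContinuousAdd F] {f g : E → F} {x v : E} {a b : F}
    (hf : HasDirDeriv f x v a) (hg : HasDirDeriv g x v b) :
    HasDirDeriv (fun y => f y + g y) x v (a + b) :=
  (Tendsto.add hf hg).congr fun t => by rw [← smul_add, add_sub_add_comm]

theorem HasDirDeriv.const_smul [ContinuousConstSMul ℝ F] {f : E → F} {x v : E} {a : F} (c : ℝ)
    (hf : HasDirDeriv f x v a) : HasDirDeriv (fun y => c • f y) x v (c • a) :=
  (Tendsto.const_smul hf c).congr fun t => by rw [← smul_sub, smul_comm]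

theorem HasDirDeriv.sub [IsTopologicalAddGroup F] [ContinuousConstSMul ℝ F]
    {f g : E → F} {x v : E} {a b : F}
    (hf : HasDirDeriv f x v a) (hg : HasDirDeriv g x v b) :
    HasDirDeriv (fun y => f y - g y) x v (a - b) := by
  simpa [sub_eq_add_neg] using hf.add (hg.const_smul (-1))

theorem HasDirDeriv.sum [ContinuousAdd F] {ι : Type*} (s : Finset ι) {f : ι → E → F} {x v : E}
    {a : ι → F} (hf : ∀ i ∈ s, HasDirDeriv (f i) x v (a i)) :
    HasDirDeriv (fun y => ∑ i ∈ s, f i y) x v (∑ i ∈ s, a i) := by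
  refine (tendsto_finsetSum s hf).congr fun t => ?_
  rw [← Finset.smul_sum, Finset.sum_sub_distrib]

variable [IsTopologicalAddGroup E] [ContinuousSMul ℝ E] [T2Space E]
  [IsTopologicalAddGroup F] [ContinuousSMul ℝ F] [LocallyConvexSpace ℝ F] [T2Space F]

theorem CkOn.dirDeriv_const {k : ℕ} {f : E → F} {U : Set E} (hU : IsOpen U)
    (hf : CkOn (k + 1) f U) (w : E) [LocallyConvexSpace ℝ E] :
    CkOn k (fun y => dirDeriv f y w) U := by
  have h1 : CkOn k (fun y : E => y) U := CkOn.clm k (ContinuousLinearMap.id ℝ E) U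
  have h2 : CkOn k (fun y : E => (y, w)) U := CkOn.prodMk k hU h1 (CkOn.const k w U)
  exact CkOn.comp k (F := E × E) (g := fun y : E => (y, w)) hU (hU.prod isOpen_univ) hf.2.2 h2
    fun _ hy => ⟨hy, trivial⟩

theorem second_diff [LocallyConvexSpace ℝ E] {f : E → F} {U : Set E} (hU : IsOpen U)
    (hf : CkOn 2 f U) {x : E} (hx : x ∈ U) (v w : E) :
    Tendsto (fun p : ℝ × ℝ => p.2⁻¹ • p.1⁻¹ •
        (f (x + p.2 • w + p.1 • v) - f (x + p.2 • w) - (f (x + p.1 • v) - f x)))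
      ((𝓝[≠] 0) ×ˢ (𝓝[≠] 0)) (𝓝 (dirDeriv (fun y => dirDeriv f y w) x v)) := by
  have hg : CkOn 1 (fun y => dirDeriv f y w) U := hf.dirDeriv_const hU w
  intro W hW
  obtain ⟨K, hK, hKc, hKconv, hKW⟩ := exists_closed_convex_nhds hW
  obtain ⟨A, hA, B, hB, hAB⟩ := mem_prod_iff.1 (hg.strict hU hx v hK)
  have hB' : ∀ᶠ y in 𝓝 x, (y, v) ∈ B :=
    (Continuous.tendsto (by fun_prop : Continuous fun y : E => (y, v)) x).eventually hB
  have hN : ∀ᶠ p : ℝ × ℝ in 𝓝 ((0:ℝ), (0:ℝ)), ∀ r ∈ Icc (0:ℝ) 1,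
      ((x + (r * p.2) • w, v) ∈ B ∧ x + (r * p.2) • w ∈ U) ∧
        x + p.1 • v + (r * p.2) • w ∈ U := by
    refine isCompact_Icc.eventually_forall_of_forall_eventually fun r _ => ?_
    have h1 : Continuous fun q : (ℝ × ℝ) × ℝ => x + (q.2 * q.1.2) • w := by fun_prop
    have h2 : Continuous fun q : (ℝ × ℝ) × ℝ => x + q.1.1 • v + (q.2 * q.1.2) • w := by fun_prop
    have h1' := h1.tendsto ((0, 0), r)
    have h2' := h2.tendsto ((0, 0), r)
    simp only [mul_zero, zero_smul, add_zero] at h1' h2'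
    exact (h1'.eventually (hB'.and (hU.mem_nhds hx))).and (h2'.eventually (hU.mem_nhds hx))
  have hle : (𝓝[≠] (0:ℝ)) ×ˢ (𝓝[≠] (0:ℝ)) ≤ 𝓝 ((0:ℝ), (0:ℝ)) := by
    rw [nhds_prod_eq (x := (0:ℝ)) (y := (0:ℝ))]
    exact Filter.prod_mono nhdsWithin_le_nhds nhdsWithin_le_nhds
  have h1 : ∀ᶠ p : ℝ × ℝ in (𝓝[≠] (0:ℝ)) ×ˢ (𝓝[≠] (0:ℝ)), p.1 ∈ A := tendsto_fst.eventually hA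
  have h2 : ∀ᶠ p : ℝ × ℝ in (𝓝[≠] (0:ℝ)) ×ˢ (𝓝[≠] (0:ℝ)), p.2 ≠ 0 :=
    (tendsto_snd (f := 𝓝[≠] (0:ℝ)) (g := 𝓝[≠] (0:ℝ))).eventually eventually_mem_nhdsWithin
  rw [mem_map]
  filter_upwards [hle hN, h1, h2] with p hp hp1 hp2
  apply hKW
  have := mean_value (c := fun r : ℝ => p.1⁻¹ • (p.2⁻¹ • f (x + p.1 • v + (r * p.2) • w) -
      p.2⁻¹ • f (x + (r * p.2) • w))) hKconv hKc
    (fun r hr => ((HasDirDeriv.line hp2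
        (hasDirDeriv_of_exists (hf.2.1 _ (hp r hr).2 w))).sub
      (HasDirDeriv.line hp2
        (hasDirDeriv_of_exists (hf.2.1 _ (hp r hr).1.2 w)))).const_smul _)
    (fun r hr => by
      have := hAB (show (p.1, (x + (r * p.2) • w, v)) ∈ A ×ˢ B from ⟨hp1, (hp r hr).1.1⟩)
      simp only [mem_preimage] at this
      rwa [add_right_comm] at this)
  convert this using 1
  simp only [one_mul, zero_mul, zero_smul, add_zero, ← smul_sub]
  rw [smul_comm, add_right_comm]

theorem dirDeriv_symm [LocallyConvexSpace ℝ E] {f : E → F} {U : Set E} (hU : IsOpen U)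
    (hf : CkOn 2 f U) {x : E} (hx : x ∈ U) (v w : E) :
    dirDeriv (fun y => dirDeriv f y w) x v = dirDeriv (fun y => dirDeriv f y v) x w := by
  refine tendsto_nhds_unique (second_diff hU hf hx v w)
    (((second_diff hU hf hx w v).comp tendsto_prod_swap).congr fun p => ?_)
  simp only [Function.comp, Prod.swap]
  rw [smul_comm, add_right_comm]
  congr 2
  abel

end

end Calculus2

section LocalForms

open Classical in
/-- The differential `df(x)` as a linear map; `df(x; ·)` is linear for `f` of class `C¹`. -/
noncomputable def derivLM {E F : Type*} [AddCommGroup E] [Module ℝ E] [AddCommGroup F] [Module ℝ F]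
    [TopologicalSpace F] (f : E → F) (x : E) : E →ₗ[ℝ] F :=
  if h : IsLinearMap ℝ (dirDeriv f x) then h.mk' _ else 0

open Classical in
/-- The derivative at `y` of a form `W` on an open subset of `E`, a linear map from `E` to the
alternating forms on `E`, with `formDeriv W y u v = d(W(·)(v))(y; u)`. -/
noncomputable def formDeriv {E : Type*} [AddCommGroup E] [Module ℝ E] {q : ℕ}
    (W : E → E [⋀^Fin q]→ₗ[ℝ] ℝ) (y : E) : E →ₗ[ℝ] E [⋀^Fin q]→ₗ[ℝ] ℝ :=
  if h : ∃ L : E →ₗ[ℝ] E [⋀^Fin q]→ₗ[ℝ] ℝ, ∀ u v, L u v = dirDeriv (fun z => W z v) y u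
  then h.choose else 0

/-- The exterior derivative on open subsets of `E`:
`(dW)_y(v₀, …, v_q) = ∑ i, (-1)^i d(W(·)(v₀, …, v̂ᵢ, …, v_q))(y; vᵢ)`. -/
noncomputable def extD {E : Type*} [AddCommGroup E] [Module ℝ E] {q : ℕ}
    (W : E → E [⋀^Fin q]→ₗ[ℝ] ℝ) (y : E) : E [⋀^Fin (q + 1)]→ₗ[ℝ] ℝ :=
  AlternatingMap.alternatizeUncurryFin (formDeriv W y)

variable {E : Type u} [AddCommGroup E] [Module ℝ E] [TopologicalSpace E]
  [IsTopologicalAddGroup E] [ContinuousSMul ℝ E] [LocallyConvexSpace ℝ E] [T2Space E]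
  {F : Type v} [AddCommGroup F] [Module ℝ F] [TopologicalSpace F]
  [IsTopologicalAddGroup F] [ContinuousSMul ℝ F] [LocallyConvexSpace ℝ F] [T2Space F]
  {q : ℕ}

theorem derivLM_apply {f : E → F} {U : Set E} (hU : IsOpen U) (hf : CkOn 1 f U) {x : E}
    (hx : x ∈ U) (v : E) : derivLM f x v = dirDeriv f x v := by
  unfold derivLM
  rw [dif_pos (hf.isLinearMap hU hx)]
  rfl

open Classical in
theorem derivLM_congr {f g : E → F} {x : E} (h : f =ᶠ[𝓝 x] g) : derivLM f x = derivLM g x := by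
  have : dirDeriv f x = dirDeriv g x := funext fun v => dirDeriv_congr h v
  have key : ∀ p p' : E → F, p = p' → (if h : IsLinearMap ℝ p then h.mk' _ else 0) =
      (if h : IsLinearMap ℝ p' then h.mk' _ else 0) := by
    rintro p _ rfl; rfl
  exact key _ _ this

theorem formDeriv_eq {W : E → E [⋀^Fin q]→ₗ[ℝ] ℝ} {y : E} {L : E →ₗ[ℝ] E [⋀^Fin q]→ₗ[ℝ] ℝ}
    (hL : ∀ u v, L u v = dirDeriv (fun z => W z v) y u) : formDeriv W y = L := by
  have h : ∃ L : E →ₗ[ℝ] E [⋀^Fin q]→ₗ[ℝ] ℝ, ∀ u v, L u v = dirDeriv (fun z => W z v) y u := ⟨L, hL⟩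
  unfold formDeriv
  rw [dif_pos h]
  ext u v
  rw [h.choose_spec, hL]

open Classical in
theorem formDeriv_congr {W W' : E → E [⋀^Fin q]→ₗ[ℝ] ℝ} {y : E} (h : W =ᶠ[𝓝 y] W') :
    formDeriv W y = formDeriv W' y := by
  have : (fun u v => dirDeriv (fun z => W z v) y u) = fun u v => dirDeriv (fun z => W' z v) y u :=
    funext fun u => funext fun v => dirDeriv_congr (h.mono fun z hz => by simp only [hz]) u
  have key : ∀ D D' : E → (Fin q → E) → ℝ, D = D' →
      (if h : ∃ L : E →ₗ[ℝ] E [⋀^Fin q]→ₗ[ℝ] ℝ, ∀ u v, L u v = D u v then h.choose else 0) =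
      (if h : ∃ L : E →ₗ[ℝ] E [⋀^Fin q]→ₗ[ℝ] ℝ, ∀ u v, L u v = D' u v then h.choose else 0) := by
    rintro D _ rfl; rfl
  exact key _ _ this

theorem extD_congr {W W' : E → E [⋀^Fin q]→ₗ[ℝ] ℝ} {y : E} (h : W =ᶠ[𝓝 y] W') :
    extD W y = extD W' y := by
  unfold extD; rw [formDeriv_congr h]

theorem formDeriv_apply {W : E → E [⋀^Fin q]→ₗ[ℝ] ℝ} {U : Set E} (hU : IsOpen U)
    (hW : ∀ v, CkOn 1 (fun z => W z v) U) {y : E} (hy : y ∈ U) (u : E) (v : Fin q → E) :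
    formDeriv W y u v = dirDeriv (fun z => W z v) y u := by
  have hd : ∀ v u, HasDirDeriv (fun z => W z v) y u (dirDeriv (fun z => W z v) y u) :=
    fun v u => hasDirDeriv_of_exists ((hW v).2.1 y hy u)
  let A : E → E [⋀^Fin q]→ₗ[ℝ] ℝ := fun u =>
    { toFun := fun v => dirDeriv (fun z => W z v) y u
      map_update_add' := by
        intro inst m i a b
        refine HasDirDeriv.eq ?_
        have := (hd (Function.update m i a) u).add (hd (Function.update m i b) u)
        simp only [← AlternatingMap.map_update_add] at this
        convert this
      map_update_smul' := by
        intro inst m i c a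
        refine HasDirDeriv.eq ?_
        have := (hd (Function.update m i a) u).const_smul c
        simp only [← AlternatingMap.map_update_smul] at this
        convert this
      map_eq_zero_of_eq' := by
        intro m i j h hij
        refine HasDirDeriv.eq ?_
        have : (fun z => W z m) = fun _ => 0 := funext fun z => (W z).map_eq_zero_of_eq m h hij
        rw [this]
        exact hasDirDeriv_const 0 y u }
  have hA : ∀ u v, A u v = dirDeriv (fun z => W z v) y u := fun _ _ => rfl
  let L : E →ₗ[ℝ] E [⋀^Fin q]→ₗ[ℝ] ℝ :=
    { toFun := A
      map_add' := fun u u' => by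
        ext v; simp only [AlternatingMap.add_apply, hA]
        exact ((hW v).isLinearMap hU hy).map_add u u'
      map_smul' := fun c u => by
        ext v; simp only [AlternatingMap.smul_apply, hA, RingHom.id_apply]
        exact ((hW v).isLinearMap hU hy).map_smul c u }
  rw [formDeriv_eq (L := L) hA]
  rfl

theorem extD_apply {W : E → E [⋀^Fin q]→ₗ[ℝ] ℝ} {U : Set E} (hU : IsOpen U)
    (hW : ∀ v, CkOn 1 (fun z => W z v) U) {y : E} (hy : y ∈ U) (v : Fin (q + 1) → E) :
    extD W y v = ∑ i : Fin (q + 1), (-1) ^ (i : ℕ) •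
      dirDeriv (fun z => W z (i.removeNth v)) y (v i) := by
  unfold extD
  rw [AlternatingMap.alternatizeUncurryFin_apply]
  refine Finset.sum_congr rfl fun i _ => ?_
  rw [formDeriv_apply hU hW hy]

theorem extD_add {W W' : E → E [⋀^Fin q]→ₗ[ℝ] ℝ} {U : Set E} (hU : IsOpen U)
    (hW : ∀ v, CkOn 1 (fun z => W z v) U) (hW' : ∀ v, CkOn 1 (fun z => W' z v) U)
    {y : E} (hy : y ∈ U) : extD (fun z => W z + W' z) y = extD W y + extD W' y := by
  unfold extD
  rw [← AlternatingMap.alternatizeUncurryFin_add]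
  congr 1
  refine formDeriv_eq fun u v => ?_
  rw [LinearMap.add_apply, AlternatingMap.add_apply, formDeriv_apply hU hW hy,
    formDeriv_apply hU hW' hy]
  exact ((hasDirDeriv_of_exists ((hW v).2.1 y hy u)).add
    (hasDirDeriv_of_exists ((hW' v).2.1 y hy u))).eq.symm

theorem CkOn.form_apply {k : ℕ} {W : E → E [⋀^Fin q]→ₗ[ℝ] ℝ} {U : Set E} (hU : IsOpen U)
    (hW : CkOn k (fun p : E × (Fin q → E) => W p.1 p.2) (U ×ˢ univ)) (v : Fin q → E) :
    CkOn k (fun z => W z v) U := by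
  have h1 : CkOn k (fun y : E => y) U := CkOn.clm k (ContinuousLinearMap.id ℝ E) U
  have h2 : CkOn k (fun y : E => (y, v)) U := CkOn.prodMk k hU h1 (CkOn.const k v U)
  exact CkOn.comp k (F := E × (Fin q → E)) (g := fun y : E => (y, v)) hU (hU.prod isOpen_univ) hW h2
    fun _ hy => ⟨hy, trivial⟩

theorem extD_extD {W : E → E [⋀^Fin q]→ₗ[ℝ] ℝ} {U : Set E} (hU : IsOpen U)
    (hW : ∀ v, CkOn 2 (fun z => W z v) U) {y : E} (hy : y ∈ U) :
    extD (extD W) y = 0 := by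
  have hW1 : ∀ v, CkOn 1 (fun z => W z v) U := fun v => (hW v).of_succ
  have hW2 : ∀ v a, CkOn 1 (fun z => dirDeriv (fun z => W z v) z a) U :=
    fun v a => (hW v).dirDeriv_const hU a
  have hV : ∀ a v, CkOn 1 (fun z => formDeriv W z a v) U := fun a v =>
    (hW2 v a).congr hU fun z hz => (formDeriv_apply hU hW1 hz a v).symm
  have hVd : ∀ a v u, dirDeriv (fun z => formDeriv W z a v) y u =
      dirDeriv (fun z => dirDeriv (fun z => W z v) z a) y u := fun a v u =>
    dirDeriv_congr (by
      filter_upwards [hU.mem_nhds hy] with z hz using formDeriv_apply hU hW1 hz a v) u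
  let K : E → E →ₗ[ℝ] E [⋀^Fin q]→ₗ[ℝ] ℝ := fun a => formDeriv (fun z => formDeriv W z a) y
  have hK : ∀ a u v, K a u v = dirDeriv (fun z => formDeriv W z a v) y u := fun a u v =>
    formDeriv_apply hU (hV a) hy u v
  have hKs : ∀ a u, K a u = K u a := by
    intro a u; ext v
    rw [hK, hK, hVd, hVd]
    exact dirDeriv_symm hU (hW v) hy u a
  let H : E →ₗ[ℝ] E →ₗ[ℝ] E [⋀^Fin q]→ₗ[ℝ] ℝ :=
    { toFun := K
      map_add' := fun a b => by
        ext u v; simp only [LinearMap.add_apply]; rw [hKs, map_add, hKs u a, hKs u b]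
      map_smul' := fun c a => by
        ext u v
        simp only [LinearMap.smul_apply, RingHom.id_apply]
        rw [hKs, map_smul, hKs u a] }
  have hHs : ∀ a u, H a u = H u a := hKs
  have hfd : formDeriv (extD W) y = AlternatingMap.alternatizeUncurryFinLM ∘ₗ H := by
    refine formDeriv_eq fun u v => ?_
    rw [LinearMap.comp_apply, AlternatingMap.alternatizeUncurryFinLM_apply,
      AlternatingMap.alternatizeUncurryFin_apply]
    have h1 : (fun z => extD W z v) = fun z => ∑ i : Fin (q + 1), (-1 : ℝ) ^ (i : ℕ) •
        formDeriv W z (v i) (i.removeNth v) := by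
      funext z
      unfold extD
      rw [AlternatingMap.alternatizeUncurryFin_apply]
      refine Finset.sum_congr rfl fun i _ => ?_
      rcases Nat.even_or_odd (i : ℕ) with h | h <;> simp [h.neg_one_pow]
    rw [h1]
    have h2 := HasDirDeriv.sum Finset.univ (f := fun (i : Fin (q + 1)) z => (-1 : ℝ) ^ (i : ℕ) •
        formDeriv W z (v i) (i.removeNth v)) (x := y) (v := u) (fun i _ =>
      (hasDirDeriv_of_exists ((hV (v i) (i.removeNth v)).2.1 y hy u)).const_smul _)
    rw [h2.eq]
    refine Finset.sum_congr rfl fun i _ => ?_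
    rw [← hK (v i) u, hHs]
    change _ • K (v i) u _ = _
    rcases Nat.even_or_odd (i : ℕ) with h | h <;> simp [h.neg_one_pow]
  unfold extD at hfd ⊢
  rw [hfd]
  exact AlternatingMap.alternatizeUncurryFin_alternatizeUncurryFinLM_comp_of_symmetric hHs

end LocalForms

section LocalForms2
variable {E : Type u} [AddCommGroup E] [Module ℝ E] [TopologicalSpace E]
  [IsTopologicalAddGroup E] [ContinuousSMul ℝ E] [LocallyConvexSpace ℝ E] [T2Space E]
  {F : Type v} [AddCommGroup F] [Module ℝ F] [TopologicalSpace F]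
  [IsTopologicalAddGroup F] [ContinuousSMul ℝ F] [LocallyConvexSpace ℝ F] [T2Space F]
  {q : ℕ}

/-- Pullback of alternating forms along a linear map. -/
def compLM {E F : Type*} [AddCommGroup E] [Module ℝ E] [AddCommGroup F] [Module ℝ F] (n : ℕ)
    (g : E →ₗ[ℝ] F) : (F [⋀^Fin n]→ₗ[ℝ] ℝ) →ₗ[ℝ] E [⋀^Fin n]→ₗ[ℝ] ℝ where
  toFun f := f.compLinearMap g
  map_add' _ _ := rfl
  map_smul' _ _ := rfl

/-- derivative of a jointly `C¹` form in all its arguments -/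
theorem dirDeriv_form {W : F → F [⋀^Fin q]→ₗ[ℝ] ℝ} {O : Set F} (hO : IsOpen O)
    (hW : CkOn 1 (fun p : F × (Fin q → F) => W p.1 p.2) (O ×ˢ univ)) {y : F} (hy : y ∈ O)
    (a b : Fin q → F) (u : F) :
    dirDeriv (fun p : F × (Fin q → F) => W p.1 p.2) (y, a) (u, b) =
      dirDeriv (fun z => W z a) y u + ∑ i, W y (Function.update a i (b i)) := by
  have hlin := hW.isLinearMap (hO.prod isOpen_univ) (x := (y, a)) ⟨hy, trivial⟩
  have h0 : (u, b) = (u, 0) + ∑ i, ((0 : F), (Pi.single i (b i) : Fin q → F)) := by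
    refine Prod.ext ?_ ?_
    · simp [Prod.fst_sum]
    · simp [Prod.snd_sum, Finset.univ_sum_single]
  let L := hlin.mk' _
  have hL : ∀ z, dirDeriv (fun p : F × (Fin q → F) => W p.1 p.2) (y, a) z = L z := fun _ => rfl
  rw [hL, h0, map_add, map_sum, ← hL]
  congr 1
  · have h1 : HasDirDeriv (fun z => W z a) y u
        (dirDeriv (fun p : F × (Fin q → F) => W p.1 p.2) (y, a) (u, 0)) := by
      have := hasDirDeriv_of_exists (hW.2.1 (y, a) ⟨hy, trivial⟩ (u, 0))
      simpa [HasDirDeriv] using this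
    exact h1.eq.symm
  · refine Finset.sum_congr rfl fun i _ => ?_
    rw [← hL]
    refine HasDirDeriv.eq ?_
    refine tendsto_const_nhds.congr' ?_
    filter_upwards [self_mem_nhdsWithin] with t (ht : t ≠ 0)
    have h2 : a + t • (Pi.single i (b i) : Fin q → F) =
        Function.update a i (a i + t • b i) := by
      funext j
      by_cases hj : j = i
      · subst hj; simp
      · simp [hj]
    simp only [Prod.smul_mk, smul_zero, Prod.mk_add_mk, add_zero, h2]
    rw [AlternatingMap.map_update_add, AlternatingMap.map_update_smul, Function.update_eq_self,
      add_sub_cancel_left, smul_smul, inv_mul_cancel₀ ht, one_smul]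

/-- naturality of the exterior derivative -/
theorem extD_pullback {W : F → F [⋀^Fin q]→ₗ[ℝ] ℝ} {O : Set F} (hO : IsOpen O)
    (hW : CkOn 1 (fun p : F × (Fin q → F) => W p.1 p.2) (O ×ˢ univ))
    {φ : E → F} {U : Set E} (hU : IsOpen U) (hφ : CkOn 2 φ U) (hUO : MapsTo φ U O)
    {y : E} (hy : y ∈ U) :
    extD (fun z => (W (φ z)).compLinearMap (derivLM φ z)) y =
      (extD W (φ y)).compLinearMap (derivLM φ y) := by
  have hφ1 : CkOn 1 φ U := hφ.of_succ
  have hWv : ∀ v, CkOn 1 (fun z => W z v) O := fun v => hW.form_apply hO v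
  have hD : ∀ a, CkOn 1 (fun z => dirDeriv φ z a) U := fun a => hφ.dirDeriv_const hU a
  have hDe : ∀ z ∈ U, ∀ a, derivLM φ z a = dirDeriv φ z a := fun z hz a =>
    derivLM_apply hU hφ1 hz a
  let h : E →ₗ[ℝ] E →ₗ[ℝ] F := LinearMap.mk₂ ℝ
    (fun u a => dirDeriv (fun z => dirDeriv φ z a) y u)
    (fun u u' a => ((hD a).isLinearMap hU hy).map_add u u')
    (fun c u a => ((hD a).isLinearMap hU hy).map_smul c u)
    (fun u a a' => by
      simp only [dirDeriv_symm hU hφ hy u]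
      exact ((hD u).isLinearMap hU hy).map_add a a')
    (fun c u a => by
      simp only [dirDeriv_symm hU hφ hy u]
      exact ((hD u).isLinearMap hU hy).map_smul c a)
  have hsymm : ∀ u a, h u a = h a u := fun u a => dirDeriv_symm hU hφ hy u a
  have hval : ∀ u v, dirDeriv (fun z => (W (φ z)).compLinearMap (derivLM φ z) v) y u =
      formDeriv W (φ y) (derivLM φ y u) (fun i => derivLM φ y (v i)) +
        ∑ i, W (φ y) (Function.update (fun i => derivLM φ y (v i)) i (h u (v i))) := by
    intro u v
    have e1 : (fun z => (W (φ z)).compLinearMap (derivLM φ z) v) =ᶠ[𝓝 y]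
        fun z => W (φ z) (fun i => dirDeriv φ z (v i)) := by
      filter_upwards [hU.mem_nhds hy] with z hz
      rw [AlternatingMap.compLinearMap_apply]
      congr 1
      funext i
      exact hDe z hz (v i)
    rw [dirDeriv_congr e1]
    have e2 : HasDirDeriv (fun z => (φ z, fun i => dirDeriv φ z (v i))) y u
        (dirDeriv φ y u, fun i => h u (v i)) :=
      (hasDirDeriv_of_exists (hφ1.2.1 y hy u)).prodMk
        (tendsto_pi_nhds.2 fun i => hasDirDeriv_of_exists ((hD (v i)).2.1 y hy u))
    have e3 := hasDirDeriv_comp (f := fun p : F × (Fin q → F) => W p.1 p.2)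
      (g := fun z => (φ z, fun i => dirDeriv φ z (v i)))
      (hO.prod isOpen_univ) hW e2 ⟨hUO hy, trivial⟩
    rw [e3.eq, dirDeriv_form hO hW (hUO hy), formDeriv_apply hO hWv (hUO hy)]
    simp only [hDe y hy]
  let P : E →ₗ[ℝ] E [⋀^Fin q]→ₗ[ℝ] ℝ :=
    (compLM q (derivLM φ y)) ∘ₗ (formDeriv W (φ y)) ∘ₗ (derivLM φ y)
  have hS : ∃ S : E →ₗ[ℝ] E [⋀^Fin q]→ₗ[ℝ] ℝ, AlternatingMap.alternatizeUncurryFin S = 0 ∧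
      ∀ u v, S u v =
        ∑ i, W (φ y) (Function.update (fun i => derivLM φ y (v i)) i (h u (v i))) := by
    cases q with
    | zero => exact ⟨0, by ext v; simp [AlternatingMap.alternatizeUncurryFin_apply], by simp⟩
    | succ n =>
      let B : E →ₗ[ℝ] E →ₗ[ℝ] E [⋀^Fin n]→ₗ[ℝ] ℝ := LinearMap.compr₂ h
        ((compLM n (derivLM φ y)) ∘ₗ (W (φ y)).curryLeft)
      refine ⟨AlternatingMap.alternatizeUncurryFinLM ∘ₗ B,
        AlternatingMap.alternatizeUncurryFin_alternatizeUncurryFinLM_comp_of_symmetric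
          (fun u a => by simp [B, hsymm u a]), fun u v => ?_⟩
      rw [LinearMap.comp_apply, AlternatingMap.alternatizeUncurryFinLM_apply,
        AlternatingMap.alternatizeUncurryFin_apply]
      refine Finset.sum_congr rfl fun i _ => ?_
      have : Function.update (fun i => derivLM φ y (v i)) i (h u (v i)) =
          i.insertNth (h u (v i)) (fun j => derivLM φ y (i.removeNth v j)) := by
        funext j
        refine Fin.succAboveCases i ?_ (fun j => ?_) j <;> simp [Fin.removeNth]
      rw [this, AlternatingMap.map_insertNth]
      rfl
  obtain ⟨S, hS0, hS⟩ := hS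
  have hfd : formDeriv (fun z => (W (φ z)).compLinearMap (derivLM φ z)) y = P + S := by
    refine formDeriv_eq fun u v => ?_
    rw [hval, LinearMap.add_apply, AlternatingMap.add_apply, hS]
    rfl
  unfold extD
  rw [hfd, AlternatingMap.alternatizeUncurryFin_add, hS0, add_zero]
  ext v
  simp only [AlternatingMap.alternatizeUncurryFin_apply, AlternatingMap.compLinearMap_apply]
  rfl

end LocalForms2

/-- The objects of the site of a simplicial space `X`: pairs of a level `[n]` and an open subset of
`X_n`. A morphism `([n], V) → ([m], U)` is a map `θ : [m] → [n]` whose structure map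
`X_n → X_m` sends `V` into `U`, and coverings are the open coverings within one level. A sheaf on
this site is a simplicial sheaf on `X`: a sheaf on each `X_n` with compatible maps
`F_m → (X_θ)_* F_n`, that is, with coface and codegeneracy maps satisfying the simplicial
identities. -/
structure SOpen (X : SimplicialObject TopCat.{u}) : Type u where
  level : SimplexCategory
  carrier : Opens (X.obj (op level))

namespace SOpen
variable {X : SimplicialObject TopCat.{u}}

instance : Category.{0} (SOpen X) where
  Hom A B := {θ : B.level ⟶ A.level // ∀ z ∈ A.carrier, X.map θ.op z ∈ B.carrier}
  id A := ⟨𝟙 _, fun z hz => by simpa using hz⟩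
  comp f g := ⟨g.1 ≫ f.1, fun z hz => by
    simpa using g.2 _ (f.2 z hz)⟩

theorem id_val (A : SOpen X) : (𝟙 A : A ⟶ A).1 = 𝟙 _ := rfl
theorem comp_val {A B C : SOpen X} (f : A ⟶ B) (g : B ⟶ C) : (f ≫ g).1 = g.1 ≫ f.1 := rfl

/-- inclusion of a smaller open subset of the same level -/
def incl {n : SimplexCategory} {V U : Opens (X.obj (op n))} (h : V ≤ U) :
    (⟨n, V⟩ : SOpen X) ⟶ ⟨n, U⟩ :=
  ⟨𝟙 n, fun z hz => by simpa using h hz⟩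

/-- presieve of a family of open subsets -/
inductive coverPresieve (A : SOpen X) (𝒱 : Set (Opens (X.obj (op A.level))))
    (h : ∀ V ∈ 𝒱, V ≤ A.carrier) : Presieve A
  | mk (V : Opens (X.obj (op A.level))) (hV : V ∈ 𝒱) : coverPresieve A 𝒱 h (incl (h V hV))

variable (X) in
/-- The open coverings within each level. -/
def coverage : Coverage (SOpen X) where
  coverings A := {R | ∃ (𝒱 : Set (Opens (X.obj (op A.level)))) (h : ∀ V ∈ 𝒱, V ≤ A.carrier),
    (∀ z ∈ A.carrier, ∃ V ∈ 𝒱, z ∈ V) ∧ R = coverPresieve A 𝒱 h}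
  pullback := by
    rintro A B f _ ⟨𝒱, h, hc, rfl⟩
    let g : X.obj (op B.level) ⟶ X.obj (op A.level) := X.map f.1.op
    let pb : Opens (X.obj (op A.level)) → Opens (X.obj (op B.level)) :=
      fun V => (Opens.map g).obj V ⊓ B.carrier
    refine ⟨coverPresieve B (pb '' 𝒱) (by rintro _ ⟨V, _, rfl⟩; exact inf_le_right),
      ⟨_, _, fun z hz => ?_, rfl⟩, ?_⟩
    · obtain ⟨V, hV, hzV⟩ := hc _ (f.2 z hz)
      exact ⟨_, ⟨V, hV, rfl⟩, hzV, hz⟩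
    · rintro _ _ ⟨_, V, hV, rfl⟩
      exact ⟨⟨A.level, V⟩, ⟨f.1, fun z hz => hz.1⟩, incl (h V hV), ⟨V, hV⟩,
        Subtype.ext (by simp [comp_val, incl])⟩

variable (X) in
/-- The Grothendieck topology of the site of a simplicial space. -/
abbrev topology : GrothendieckTopology (SOpen X) := (coverage X).toGrothendieck

end SOpen

/-- The abelian category of simplicial sheaves of abelian groups on the simplicial space `X`. -/
abbrev AbSheaf (X : SimplicialObject TopCat.{u}) := Sheaf (SOpen.topology X) AddCommGrpCat.{u}

open Classical in
/-- extension by zero -/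
noncomputable def ext0 {X : Type*} {K : Type*} [Zero K] {U : Set X} (f : U → K) (z : X) : K :=
  if h : z ∈ U then f ⟨z, h⟩ else 0

theorem ext0_of_mem {X : Type*} {K : Type*} [Zero K] {U : Set X} (f : U → K) {z : X} (h : z ∈ U) :
    ext0 f z = f ⟨z, h⟩ := dif_pos h

/-- Data for a simplicial sheaf of functions with values in an abelian group `K`: a local condition
`P n f z` (the function `f` on `X_n` belongs to the sheaf near `z`), and for `θ : [m] → [n]` and
`z ∈ X_n` a map `τ θ z : K → K`, so that the structure map of `θ` sends `f` on `X_m` to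
`z ↦ τ θ z (f (X_θ z))` on `X_n`. -/
structure FunSheaf (X : SimplicialObject TopCat.{u}) where
  K : Type u
  [grp : AddCommGroup K]
  τ : ∀ {m n : SimplexCategory} (_ : m ⟶ n) (_ : X.obj (op n)), K →+ K
  τ_id : ∀ (n : SimplexCategory) (z : X.obj (op n)) (k : K), τ (𝟙 n) z k = k
  τ_comp : ∀ {l m n : SimplexCategory} (ψ : l ⟶ m) (θ : m ⟶ n) (z : X.obj (op n)) (k : K),
    τ (ψ ≫ θ) z k = τ θ z (τ ψ (X.map θ.op z) k)
  P : ∀ n : SimplexCategory, (X.obj (op n) → K) → X.obj (op n) → Prop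
  P_congr : ∀ {n : SimplexCategory} {f g : X.obj (op n) → K} {z : X.obj (op n)},
    f =ᶠ[𝓝 z] g → P n f z → P n g z
  P_zero : ∀ {n : SimplexCategory} (z : X.obj (op n)), P n (fun _ => 0) z
  P_add : ∀ {n : SimplexCategory} {f g : X.obj (op n) → K} {z : X.obj (op n)},
    P n f z → P n g z → P n (fun y => f y + g y) z
  P_neg : ∀ {n : SimplexCategory} {f : X.obj (op n) → K} {z : X.obj (op n)},
    P n f z → P n (fun y => - f y) z
  P_pull : ∀ {m n : SimplexCategory} (θ : m ⟶ n) {f : X.obj (op m) → K} {z : X.obj (op n)},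
    P m f (X.map θ.op z) → P n (fun y => τ θ y (f (X.map θ.op y))) z

namespace FunSheaf
attribute [instance] FunSheaf.grp
variable {X : SimplicialObject TopCat.{u}} (S : FunSheaf X)

/-- The sections over an open subset: the functions that satisfy the condition at each point. -/
def sec (A : SOpen X) : AddSubgroup (A.carrier → S.K) where
  carrier := {f | ∀ z ∈ A.carrier, S.P A.level (ext0 f) z}
  zero_mem' := fun z hz => S.P_congr (Eventually.of_forall fun y => by simp [ext0]) (S.P_zero z)
  add_mem' := fun {f g} hf hg z hz => S.P_congr
    (Eventually.of_forall fun y => by by_cases h : y ∈ A.carrier <;> simp [ext0, h])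
    (S.P_add (hf z hz) (hg z hz))
  neg_mem' := fun {f} hf z hz => S.P_congr
    (Eventually.of_forall fun y => by by_cases h : y ∈ A.carrier <;> simp [ext0, h])
    (S.P_neg (hf z hz))

/-- The restriction and structure maps. -/
def res {A B : SOpen X} (θ : A ⟶ B) : S.sec B →+ S.sec A where
  toFun f := ⟨fun z => S.τ θ.1 z (f.1 ⟨X.map θ.1.op z, θ.2 z z.2⟩), fun z hz => by
    refine S.P_congr ?_ (S.P_pull θ.1 (f.2 (X.map θ.1.op z) (θ.2 z hz)))
    filter_upwards [A.carrier.2.mem_nhds hz] with y hy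
    rw [ext0_of_mem _ hy, ext0_of_mem _ (θ.2 y hy)]⟩
  map_zero' := by ext z; simp
  map_add' f g := by ext z; simp

/-- The presheaf on the site of `X`. -/
def presheaf : (SOpen X)ᵒᵖ ⥤ AddCommGrpCat.{u} where
  obj A := AddCommGrpCat.of (S.sec A.unop)
  map θ := AddCommGrpCat.ofHom (S.res θ.unop)
  map_id A := by
    ext f z
    refine (S.τ_id _ _ _).trans (congrArg f.1 (Subtype.ext ?_))
    change X.map (𝟙 _) z.1 = z.1
    simp
  map_comp {A B C} θ ψ := by
    ext f z
    refine (S.τ_comp _ _ _ _).trans ?_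
    refine congrArg _ (congrArg _ (congrArg f.1 (Subtype.ext ?_)))
    change X.map ((ψ.unop ≫ θ.unop).1).op z.1 = X.map θ.unop.1.op (X.map ψ.unop.1.op z.1)
    simp [SOpen.comp_val]

theorem presheaf_map_incl {n : SimplexCategory} {V U : Opens (X.obj (op n))} (h : V ≤ U)
    (f : S.sec ⟨n, U⟩) (z : X.obj (op n)) (hz : z ∈ V) :
    (S.res (SOpen.incl h) f).1 ⟨z, hz⟩ = f.1 ⟨z, h hz⟩ := by
  refine (S.τ_id _ _ _).trans (congrArg f.1 (Subtype.ext ?_))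
  change X.map (𝟙 _) z = z
  simp

theorem isSheaf : Presheaf.IsSheaf (SOpen.topology X) S.presheaf := by
  rw [Presheaf.isSheaf_iff_isSheaf_forget (SOpen.topology X) S.presheaf
    (CategoryTheory.forget AddCommGrpCat.{u}), isSheaf_iff_isSheaf_of_type,
    Presieve.isSheaf_coverage]
  rintro ⟨n, U⟩ _ ⟨𝒱, hle, hcov, rfl⟩
  intro x hx
  -- value of the local section over `V` at `z`
  let val : ∀ (V : Opens (X.obj (op n))) (hV : V ∈ 𝒱), S.sec ⟨n, V⟩ := fun V hV =>
    x (SOpen.incl (hle V hV))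
      (@SOpen.coverPresieve.mk X ⟨n, U⟩ 𝒱 hle V hV)
  have agree : ∀ V hV V' hV' (z : X.obj (op n)) (h : z ∈ V) (h' : z ∈ V'),
      (val V hV).1 ⟨z, h⟩ = (val V' hV').1 ⟨z, h'⟩ := by
    intro V hV V' hV' z h h'
    have := hx (SOpen.incl (X := X) (inf_le_left : V ⊓ V' ≤ V))
      (SOpen.incl (X := X) (inf_le_right : V ⊓ V' ≤ V'))
      (@SOpen.coverPresieve.mk X ⟨n, U⟩ 𝒱 hle V hV)
      (@SOpen.coverPresieve.mk X ⟨n, U⟩ 𝒱 hle V' hV') rfl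
    have h2 := congrFun (congrArg Subtype.val this) ⟨z, h, h'⟩
    have e1 := S.presheaf_map_incl (inf_le_left : V ⊓ V' ≤ V) (val V hV) z ⟨h, h'⟩
    have e2 := S.presheaf_map_incl (inf_le_right : V ⊓ V' ≤ V') (val V' hV') z ⟨h, h'⟩
    exact e1.symm.trans (h2.trans e2)
  choose V hV hzV using hcov
  let f : U → S.K := fun z => (val (V z z.2) (hV z z.2)).1 ⟨z, hzV z z.2⟩
  have hf : ∀ V' hV' (z : X.obj (op n)) (h : z ∈ V'), f ⟨z, hle V' hV' h⟩ = (val V' hV').1 ⟨z, h⟩ :=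
    fun V' hV' z h => agree _ (hV _ _) _ hV' z _ h
  have hfs : f ∈ S.sec ⟨n, U⟩ := by
    intro z hz
    refine S.P_congr ?_ ((val (V z hz) (hV z hz)).2 z (hzV z hz))
    filter_upwards [(V z hz).2.mem_nhds (hzV z hz)] with y hy
    rw [ext0_of_mem _ hy, ext0_of_mem _ (hle _ (hV z hz) hy)]
    exact (hf _ (hV z hz) y hy).symm
  refine ⟨(⟨f, hfs⟩ : S.sec ⟨n, U⟩), ?_, ?_⟩
  · rintro _ _ ⟨V', hV'⟩
    refine Subtype.ext (funext fun z => ?_)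
    exact (S.presheaf_map_incl (hle V' hV') ⟨f, hfs⟩ z.1 z.2).trans (hf V' hV' z.1 z.2)
  · intro g hg
    refine Subtype.ext (funext fun z => ?_)
    have h1 := congrFun (congrArg Subtype.val (hg (SOpen.incl (hle _ (hV z.1 z.2)))
      (@SOpen.coverPresieve.mk X ⟨n, U⟩ 𝒱 hle _ (hV z.1 z.2)))) ⟨z.1, hzV z.1 z.2⟩
    exact (S.presheaf_map_incl (hle _ (hV z.1 z.2)) g z.1 (hzV z.1 z.2)).symm.trans h1

/-- The simplicial sheaf on `X`. -/
def toSheaf : AbSheaf X := ⟨S.presheaf, S.isSheaf⟩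

/-- A morphism given by an operator `fn n f z` that depends only on the germ of `f` at `z`, is additive
and commutes with the structure maps. -/
structure Hom (S T : FunSheaf X) where
  fn : ∀ n : SimplexCategory, (X.obj (op n) → S.K) → X.obj (op n) → T.K
  congr : ∀ {n : SimplexCategory} {f g : X.obj (op n) → S.K} {z : X.obj (op n)},
    f =ᶠ[𝓝 z] g → fn n f z = fn n g z
  P : ∀ {n : SimplexCategory} {f : X.obj (op n) → S.K} {z : X.obj (op n)},
    S.P n f z → T.P n (fn n f) z
  add : ∀ {n : SimplexCategory} {f g : X.obj (op n) → S.K} {z : X.obj (op n)},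
    S.P n f z → S.P n g z → fn n (fun y => f y + g y) z = fn n f z + fn n g z
  nat : ∀ {m n : SimplexCategory} (θ : m ⟶ n) {f : X.obj (op m) → S.K}
    {z : X.obj (op n)}, S.P m f (X.map θ.op z) →
    fn n (fun y => S.τ θ y (f (X.map θ.op y))) z = T.τ θ z (fn m f (X.map θ.op z))

/-- zero operator -/
def Hom.zero (S T : FunSheaf X) : Hom S T where
  fn _ _ _ := 0
  congr _ := rfl
  P {_ _ z} _ := T.P_zero z
  add _ _ := (add_zero _).symm
  nat {_ _} _ {_f _z} _ := (map_zero _).symm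

variable {S} {T R : FunSheaf X}

theorem Hom.ext0_eventuallyEq (φ : Hom S T) {A : SOpen X} (f : A.carrier → S.K)
    {z : X.obj (op A.level)} (hz : z ∈ A.carrier) :
    ext0 (fun y : A.carrier => φ.fn A.level (ext0 f) y) =ᶠ[𝓝 z] φ.fn A.level (ext0 f) := by
  filter_upwards [A.carrier.2.mem_nhds hz] with y hy
  exact ext0_of_mem _ hy

/-- The map on sections over an open subset. -/
noncomputable def Hom.onSec (φ : Hom S T) (A : SOpen X) : S.sec A →+ T.sec A :=
  AddMonoidHom.mk' (fun f => ⟨fun z => φ.fn A.level (ext0 f.1) z, fun z hz =>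
      T.P_congr (φ.ext0_eventuallyEq f.1 hz).symm (φ.P (f.2 z hz))⟩) fun f g => by
    refine Subtype.ext (funext fun z => ?_)
    refine (φ.congr (Eventually.of_forall fun y => ?_)).trans (φ.add (f.2 z z.2) (g.2 z z.2))
    by_cases h : y ∈ A.carrier <;> simp [ext0, h]

/-- The morphism of simplicial sheaves. -/
noncomputable def Hom.toSheafHom (φ : Hom S T) : S.toSheaf ⟶ T.toSheaf :=
  ⟨{ app := fun A => AddCommGrpCat.ofHom (φ.onSec A.unop)
     naturality := fun A B θ => by
      ext f
      refine Subtype.ext (funext fun z => ?_)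
      refine (φ.congr ?_).trans (φ.nat θ.unop.1 (f.2 _ (θ.unop.2 z.1 z.2)))
      filter_upwards [B.unop.carrier.2.mem_nhds z.2] with y hy
      rw [ext0_of_mem _ hy, ext0_of_mem _ (θ.unop.2 y hy)]
      rfl }⟩

theorem Hom.comp_eq_zero (φ : Hom S T) (ψ : Hom T R)
    (h : ∀ {n : SimplexCategory} {f : X.obj (op n) → S.K} {z : X.obj (op n)},
      S.P n f z → ψ.fn n (φ.fn n f) z = 0) : φ.toSheafHom ≫ ψ.toSheafHom = 0 := by
  apply Sheaf.hom_ext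
  ext A f
  refine Subtype.ext (funext fun z => ?_)
  exact (ψ.congr (φ.ext0_eventuallyEq f.1 z.2)).trans (h (f.2 z.1 z.2))

end FunSheaf

section SmoothAPI
variable {E : Type u} [AddCommGroup E] [Module ℝ E] [TopologicalSpace E]
  [IsTopologicalAddGroup E] [ContinuousSMul ℝ E] [LocallyConvexSpace ℝ E] [T2Space E]
  {F : Type v} [AddCommGroup F] [Module ℝ F] [TopologicalSpace F]
  [IsTopologicalAddGroup F] [ContinuousSMul ℝ F] [LocallyConvexSpace ℝ F] [T2Space F]
  {H : Type w} [AddCommGroup H] [Module ℝ H] [TopologicalSpace H]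
  [IsTopologicalAddGroup H] [ContinuousSMul ℝ H] [LocallyConvexSpace ℝ H] [T2Space H]

theorem SmoothOn.mono {f : E → F} {U V : Set E} (h : SmoothOn f U) (hV : V ⊆ U) : SmoothOn f V :=
  fun k => (h k).mono hV

theorem SmoothOn.congr {f g : E → F} {U : Set E} (hU : IsOpen U) (h : SmoothOn f U)
    (hfg : EqOn f g U) : SmoothOn g U :=
  fun k => (h k).congr hU hfg

theorem SmoothOn.of_local {f : E → F} {U : Set E}
    (h : ∀ x ∈ U, ∃ V, IsOpen V ∧ x ∈ V ∧ SmoothOn f V) : SmoothOn f U :=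
  fun k => CkOn.of_local fun x hx => by
    obtain ⟨V, hV, hxV, hf⟩ := h x hx
    exact ⟨V, hV, hxV, hf k⟩

theorem SmoothOn.comp {f : F → H} {g : E → F} {U : Set E} {V : Set F} (hU : IsOpen U)
    (hV : IsOpen V) (hf : SmoothOn f V) (hg : SmoothOn g U) (h : MapsTo g U V) :
    SmoothOn (fun x => f (g x)) U :=
  fun k => CkOn.comp k hU hV (hf k) (hg k) h

theorem SmoothOn.prodMk {f : E → F} {g : E → H} {U : Set E} (hU : IsOpen U)
    (hf : SmoothOn f U) (hg : SmoothOn g U) : SmoothOn (fun x => (f x, g x)) U :=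
  fun k => CkOn.prodMk k hU (hf k) (hg k)

theorem SmoothOn.pi {ι : Type*} {f : ι → E → F} {U : Set E} (hU : IsOpen U)
    (hf : ∀ i, SmoothOn (f i) U) : SmoothOn (fun x i => f i x) U :=
  fun k => CkOn.pi k hU fun i => hf i k

theorem SmoothOn.const (c : F) (U : Set E) : SmoothOn (fun _ : E => c) U :=
  fun k => CkOn.const k c U

theorem SmoothOn.clm (L : E →L[ℝ] F) (U : Set E) : SmoothOn (fun x => L x) U :=
  fun k => CkOn.clm k L U

theorem SmoothOn.deriv {f : E → F} {U : Set E} (hf : SmoothOn f U) :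
    SmoothOn (fun p : E × E => dirDeriv f p.1 p.2) (U ×ˢ univ) :=
  fun k => (hf (k + 1)).2.2

theorem SmoothOn.comp_clm {f : F → H} {V : Set F} (hf : SmoothOn f V) (L : E →L[ℝ] F) {U : Set E}
    (h : MapsTo L U V) : SmoothOn (fun x => f (L x)) U :=
  fun k => CkOn.comp_clm k L (hf k) h

theorem smoothOn_of_contDiff {E : Type u} [NormedAddCommGroup E] [NormedSpace ℝ E]
    {F : Type v} [NormedAddCommGroup F] [NormedSpace ℝ F] {f : E → F}
    (h : ∀ k : ℕ, ContDiff ℝ k f) : SmoothOn f univ :=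
  fun k => ckOn_of_contDiffOn k isOpen_univ (h k).contDiffOn

theorem SmoothOn.clm_comp {f : E → F} {U : Set E} (hU : IsOpen U) (hf : SmoothOn f U)
    (L : F →L[ℝ] H) : SmoothOn (fun x => L (f x)) U :=
  SmoothOn.comp hU isOpen_univ (SmoothOn.clm L univ) hf (mapsTo_univ _ _)

theorem SmoothOn.add {f g : E → F} {U : Set E} (hU : IsOpen U) (hf : SmoothOn f U)
    (hg : SmoothOn g U) : SmoothOn (fun x => f x + g x) U :=
  (hf.prodMk hU hg).clm_comp hU (ContinuousLinearMap.fst ℝ F F + ContinuousLinearMap.snd ℝ F F)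

theorem SmoothOn.sum {ι : Type*} (s : Finset ι) {f : ι → E → F} {U : Set E} (hU : IsOpen U)
    (hf : ∀ i ∈ s, SmoothOn (f i) U) : SmoothOn (fun x => ∑ i ∈ s, f i x) U := by
  classical
  induction s using Finset.induction_on with
  | empty => simpa using SmoothOn.const (0 : F) U
  | insert a s ha ih =>
    simp only [Finset.sum_insert ha]
    exact (hf a (by simp)).add hU (ih fun i hi => hf i (by simp [hi]))

theorem derivLM_id (x : E) : derivLM (fun y : E => y) x = LinearMap.id := by
  ext v
  have h := derivLM_apply (f := fun y : E => y) isOpen_univ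
    (CkOn.clm 1 (ContinuousLinearMap.id ℝ E) univ) (mem_univ x) v
  exact h.trans (hasDirDeriv_id x v).eq

theorem derivLM_comp {f : F → H} {g : E → F} {U : Set E} {V : Set F} (hU : IsOpen U)
    (hV : IsOpen V) (hf : CkOn 1 f V) (hg : CkOn 1 g U) {x : E} (hx : x ∈ U) (hgx : g x ∈ V) :
    derivLM (fun y => f (g y)) x = (derivLM f (g x)) ∘ₗ (derivLM g x) := by
  have hc : ContinuousOn g U := hg.1
  have hU' : IsOpen (U ∩ g ⁻¹' V) := hc.isOpen_inter_preimage hU hV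
  have hcomp : CkOn 1 (fun y => f (g y)) (U ∩ g ⁻¹' V) :=
    CkOn.comp 1 hU' hV hf (hg.mono inter_subset_left) fun _ h => h.2
  ext v
  rw [derivLM_apply hU' hcomp ⟨hx, hgx⟩, LinearMap.comp_apply, derivLM_apply hU hg hx,
    derivLM_apply hV hf hgx]
  exact (hasDirDeriv_comp hV hf (hasDirDeriv_of_exists (hg.2.1 x hx v)) hgx).eq

end SmoothAPI

section Manifolds

/-- `M` with its atlas is a smooth manifold modelled on the locally convex space `E`: the transition
maps between charts are smooth. -/
class LCManifold (E : Type u) [AddCommGroup E] [Module ℝ E] [TopologicalSpace E]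
    (M : Type v) [TopologicalSpace M] [ChartedSpace E M] : Prop where
  smooth_transition : ∀ e ∈ atlas E M, ∀ e' ∈ atlas E M,
    SmoothOn (fun y => e' (e.symm y)) (e.target ∩ e.symm ⁻¹' e'.source)

/-- `f`, with values in a locally convex space, is smooth on the open set `O`, in all charts. -/
def SmoothFunOn (E : Type u) [AddCommGroup E] [Module ℝ E] [TopologicalSpace E]
    {M : Type v} [TopologicalSpace M] [ChartedSpace E M] {F : Type w} [AddCommGroup F] [Module ℝ F]
    [TopologicalSpace F] (f : M → F) (O : Set M) : Prop :=
  ∀ e ∈ atlas E M, SmoothOn (fun y => f (e.symm y)) (e.target ∩ e.symm ⁻¹' O)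

/-- Smooth maps between manifolds modelled on `E` and `F`. -/
structure MSmooth (E : Type u) [AddCommGroup E] [Module ℝ E] [TopologicalSpace E]
    (F : Type v) [AddCommGroup F] [Module ℝ F] [TopologicalSpace F]
    {M : Type*} [TopologicalSpace M] [ChartedSpace E M]
    {N : Type*} [TopologicalSpace N] [ChartedSpace F N] (f : M → N) : Prop where
  continuous : Continuous f
  smooth : ∀ e ∈ atlas E M, ∀ e' ∈ atlas F N,
    SmoothOn (fun y => e' (f (e.symm y))) (e.target ∩ e.symm ⁻¹' (f ⁻¹' e'.source))

/-- Product manifolds, with the products of charts as charts. -/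
noncomputable instance prodCharts {E X F Y : Type*} [TopologicalSpace E] [TopologicalSpace X]
    [ChartedSpace E X] [TopologicalSpace F] [TopologicalSpace Y] [ChartedSpace F Y] :
    ChartedSpace (E × F) (X × Y) :=
  prodChartedSpace E X F Y

/-- Finite powers of a manifold, with the products of charts as charts. -/
noncomputable instance piCharts {ι E X : Type*} [Finite ι] [TopologicalSpace E]
    [TopologicalSpace X] [ChartedSpace E X] : ChartedSpace (ι → E) (ι → X) :=
  piChartedSpace (fun _ : ι => E) (fun _ : ι => X)

theorem mem_atlas_prod {E X F Y : Type*} [TopologicalSpace E] [TopologicalSpace X]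
    [ChartedSpace E X] [TopologicalSpace F] [TopologicalSpace Y] [ChartedSpace F Y]
    {e : OpenPartialHomeomorph (X × Y) (E × F)} :
    e ∈ atlas (E × F) (X × Y) ↔ ∃ a ∈ atlas E X, ∃ b ∈ atlas F Y, a.prod b = e :=
  Iff.rfl

theorem mem_atlas_pi {ι E X : Type*} [Finite ι] [TopologicalSpace E]
    [TopologicalSpace X] [ChartedSpace E X] {e : OpenPartialHomeomorph (ι → X) (ι → E)} :
    e ∈ atlas (ι → E) (ι → X) ↔
      ∃ a : ι → OpenPartialHomeomorph X E, (∀ i, a i ∈ atlas E X) ∧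
        OpenPartialHomeomorph.pi a = e := by
  constructor
  · rintro ⟨a, ha, rfl⟩
    exact ⟨a, fun i => ha i trivial, rfl⟩
  · rintro ⟨a, ha, rfl⟩
    exact ⟨a, fun i _ => ha i, rfl⟩

variable {E : Type u} [AddCommGroup E] [Module ℝ E] [TopologicalSpace E]
  [IsTopologicalAddGroup E] [ContinuousSMul ℝ E] [LocallyConvexSpace ℝ E] [T2Space E]
  {F : Type u} [AddCommGroup F] [Module ℝ F] [TopologicalSpace F]
  [IsTopologicalAddGroup F] [ContinuousSMul ℝ F] [LocallyConvexSpace ℝ F] [T2Space F]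
  {H : Type u} [AddCommGroup H] [Module ℝ H] [TopologicalSpace H]
  [IsTopologicalAddGroup H] [ContinuousSMul ℝ H] [LocallyConvexSpace ℝ H] [T2Space H]
  {X : Type u} [TopologicalSpace X] [ChartedSpace E X]
  {Y : Type u} [TopologicalSpace Y] [ChartedSpace F Y]
  {Z : Type u} [TopologicalSpace Z] [ChartedSpace H Z]

theorem MSmooth.isOpen_dom {f : X → Y} (hf : Continuous f) (e : OpenPartialHomeomorph X E)
    (e' : OpenPartialHomeomorph Y F) : IsOpen (e.target ∩ e.symm ⁻¹' (f ⁻¹' e'.source)) :=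
  e.isOpen_inter_preimage_symm (e'.open_source.preimage hf)

theorem mSmooth_id [LCManifold E X] : MSmooth E E (fun x : X => x) :=
  ⟨continuous_id, fun e he e' he' => LCManifold.smooth_transition e he e' he'⟩

theorem MSmooth.comp {g : Y → Z} {f : X → Y} (hg : MSmooth F H g) (hf : MSmooth E F f) :
    MSmooth E H (fun x => g (f x)) := by
  refine ⟨hg.continuous.comp hf.continuous, fun e he e'' he'' => SmoothOn.of_local ?_⟩
  rintro y ⟨hy, hy'⟩
  let e' := chartAt F (f (e.symm y))
  have he' : e' ∈ atlas F Y := chart_mem_atlas _ _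
  have h1 := hf.smooth e he e' he'
  have h2 := hg.smooth e' he' e'' he''
  have o1 := MSmooth.isOpen_dom (E := E) (F := F) hf.continuous e e'
  have o2 := MSmooth.isOpen_dom (E := F) (F := H) hg.continuous e' e''
  have o3 : IsOpen (e.target ∩ e.symm ⁻¹' ((fun x => g (f x)) ⁻¹' e''.source)) :=
    MSmooth.isOpen_dom (hg.continuous.comp hf.continuous) e e''
  refine ⟨_, o1.inter o3, ⟨⟨hy, mem_chart_source _ _⟩, hy, hy'⟩, ?_⟩
  refine (SmoothOn.comp (o1.inter o3) o2 h2 (h1.mono inter_subset_left) ?_).congr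
    (o1.inter o3) ?_
  · rintro z ⟨⟨hz, hz'⟩, _, hz''⟩
    refine ⟨e'.map_source hz', ?_⟩
    simp only [mem_preimage] at hz' hz'' ⊢
    rwa [e'.left_inv hz']
  · rintro z ⟨⟨hz, hz'⟩, _, hz''⟩
    simp only [mem_preimage] at hz'
    simp only [e'.left_inv hz']

theorem mSmooth_const [LCManifold F Y] (y : Y) : MSmooth E F (fun _ : X => y) :=
  ⟨continuous_const, fun _ _ _ _ => SmoothOn.const _ _⟩

theorem mSmooth_fst [LCManifold E X] : MSmooth (E × F) E (Prod.fst : X × Y → X) := by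
  refine ⟨continuous_fst, ?_⟩
  rintro _ ⟨a, ha, b, hb, rfl⟩ e' he'
  exact (LCManifold.smooth_transition a ha e' he').comp_clm (ContinuousLinearMap.fst ℝ E F)
    fun p hp => ⟨hp.1.1, hp.2⟩

theorem mSmooth_snd [LCManifold F Y] : MSmooth (E × F) F (Prod.snd : X × Y → Y) := by
  refine ⟨continuous_snd, ?_⟩
  rintro _ ⟨a, ha, b, hb, rfl⟩ e' he'
  exact (LCManifold.smooth_transition b hb e' he').comp_clm (ContinuousLinearMap.snd ℝ E F)
    fun p hp => ⟨hp.1.2, hp.2⟩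

theorem MSmooth.prodMk {f : Z → X} {g : Z → Y} (hf : MSmooth H E f) (hg : MSmooth H F g) :
    MSmooth H (E × F) (fun z => (f z, g z)) := by
  refine ⟨hf.continuous.prodMk hg.continuous, ?_⟩
  rintro e he _ ⟨a, ha, b, hb, rfl⟩
  have o := MSmooth.isOpen_dom (E := H) (F := E × F) (hf.continuous.prodMk hg.continuous) e
    (a.prod b)
  exact SmoothOn.prodMk o ((hf.smooth e he a ha).mono fun z hz => ⟨hz.1, hz.2.1⟩)
    ((hg.smooth e he b hb).mono fun z hz => ⟨hz.1, hz.2.2⟩)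

theorem mSmooth_apply [LCManifold E X] {ι : Type} [Finite ι] (i : ι) :
    MSmooth (ι → E) E (fun f : ι → X => f i) := by
  refine ⟨continuous_apply i, ?_⟩
  rintro e he e' he'
  obtain ⟨a, ha, rfl⟩ := mem_atlas_pi.1 he
  exact (LCManifold.smooth_transition (a i) (ha i) e' he').comp_clm
    (ContinuousLinearMap.proj (R := ℝ) (φ := fun _ : ι => E) i) fun p hp => ⟨hp.1 i trivial, hp.2⟩

theorem MSmooth.pi {ι : Type} [Finite ι] {f : ι → Z → X} (hf : ∀ i, MSmooth H E (f i)) :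
    MSmooth H (ι → E) (fun z i => f i z) := by
  have hc : Continuous (fun z i => f i z) := continuous_pi fun i => (hf i).continuous
  refine ⟨hc, ?_⟩
  rintro e he e' he'
  obtain ⟨a, ha, rfl⟩ := mem_atlas_pi.1 he'
  have o := MSmooth.isOpen_dom (E := H) (F := ι → E) hc e (OpenPartialHomeomorph.pi a)
  exact SmoothOn.pi o fun i => ((hf i).smooth e he (a i) (ha i)).mono
    fun z hz => ⟨hz.1, hz.2 i trivial⟩

theorem SmoothFunOn.comp {G : Type v} [AddCommGroup G] [Module ℝ G] [TopologicalSpace G]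
    [IsTopologicalAddGroup G] [ContinuousSMul ℝ G] [LocallyConvexSpace ℝ G] [T2Space G]
    {g : Y → G} {O : Set Y} (hO : IsOpen O) (hg : SmoothFunOn F g O) {f : X → Y}
    (hf : MSmooth E F f) : SmoothFunOn E (fun x => g (f x)) (f ⁻¹' O) := by
  intro e he
  refine SmoothOn.of_local ?_
  rintro y ⟨hy, hy'⟩
  let e' := chartAt F (f (e.symm y))
  have he' : e' ∈ atlas F Y := chart_mem_atlas _ _
  have h1 := hf.smooth e he e' he'
  have o1 := MSmooth.isOpen_dom (E := E) (F := F) hf.continuous e e'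
  have o2 : IsOpen (e'.target ∩ e'.symm ⁻¹' O) := e'.isOpen_inter_preimage_symm hO
  have o3 : IsOpen (e.target ∩ e.symm ⁻¹' (f ⁻¹' O)) :=
    e.isOpen_inter_preimage_symm (hO.preimage hf.continuous)
  refine ⟨_, o1.inter o3, ⟨⟨hy, mem_chart_source _ _⟩, hy, hy'⟩, ?_⟩
  refine (SmoothOn.comp (o1.inter o3) o2 (hg e' he') (h1.mono inter_subset_left) ?_).congr
    (o1.inter o3) ?_
  · rintro z ⟨⟨hz, hz'⟩, _, hz''⟩
    refine ⟨e'.map_source hz', ?_⟩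
    simp only [mem_preimage] at hz' hz'' ⊢
    rwa [e'.left_inv hz']
  · rintro z ⟨⟨hz, hz'⟩, _, hz''⟩
    simp only [mem_preimage] at hz'
    simp only [e'.left_inv hz']

end Manifolds

section Forms

/-- The differential `T_x X → T_{φ x} Y`. The tangent space at `x` is identified with the model space
by the preferred chart `chartAt E x`. -/
noncomputable def mderiv (E : Type u) [AddCommGroup E] [Module ℝ E] [TopologicalSpace E]
    (F : Type u) [AddCommGroup F] [Module ℝ F] [TopologicalSpace F]
    {X : Type u} [TopologicalSpace X] [ChartedSpace E X]
    {Y : Type u} [TopologicalSpace Y] [ChartedSpace F Y] (φ : X → Y) (x : X) : E →ₗ[ℝ] F :=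
  derivLM (fun y => chartAt F (φ x) (φ ((chartAt E x).symm y))) (chartAt E x x)

/-- The coordinate expression of a form in the chart `e`, that is its pullback along `e.symm`. A
`q`-form on `X` is a family of alternating forms `η x` on `T_x X`, which is identified with `E` by
`chartAt E x`. -/
noncomputable def chartForm {E : Type u} [AddCommGroup E] [Module ℝ E] [TopologicalSpace E]
    {X : Type u} [TopologicalSpace X] [ChartedSpace E X] {q : ℕ}
    (η : X → E [⋀^Fin q]→ₗ[ℝ] ℝ) (e : OpenPartialHomeomorph X E) (y : E) : E [⋀^Fin q]→ₗ[ℝ] ℝ :=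
  (η (e.symm y)).compLinearMap (derivLM (fun z => chartAt E (e.symm y) (e.symm z)) y)

/-- The exterior derivative on a manifold, computed at `x` in the chart at `x`. -/
noncomputable def extDM {E : Type u} [AddCommGroup E] [Module ℝ E] [TopologicalSpace E]
    {X : Type u} [TopologicalSpace X] [ChartedSpace E X] {q : ℕ}
    (η : X → E [⋀^Fin q]→ₗ[ℝ] ℝ) (x : X) : E [⋀^Fin (q + 1)]→ₗ[ℝ] ℝ :=
  extD (chartForm η (chartAt E x)) (chartAt E x x)

/-- Smooth forms on the open set `O`: in each chart the map `(y, v) ↦ η_y(v)` is smooth. -/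
def SmoothFormOn {E : Type u} [AddCommGroup E] [Module ℝ E] [TopologicalSpace E]
    {X : Type u} [TopologicalSpace X] [ChartedSpace E X] {q : ℕ}
    (η : X → E [⋀^Fin q]→ₗ[ℝ] ℝ) (O : Set X) : Prop :=
  ∀ e ∈ atlas E X, SmoothOn (fun p : E × (Fin q → E) => chartForm η e p.1 p.2)
    ((e.target ∩ e.symm ⁻¹' O) ×ˢ univ)

/-- Smooth relative forms on an open subset `O` of `B × X` over `B`: families of alternating forms on
the tangent spaces of the fibres of `B × X → B`, smooth in all variables. They form the quotient of
the sheaf of `q`-forms on `B × X` by the subsheaf `F¹` of the forms with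
`ι_{V₁} ⋯ ι_{V_q} ω = 0` for all tangent vectors `V₁, …, V_q` along the fibres. -/
def SmoothVFormOn (D : Type u) [AddCommGroup D] [Module ℝ D] [TopologicalSpace D]
    {B : Type u} [TopologicalSpace B] [ChartedSpace D B]
    {E : Type u} [AddCommGroup E] [Module ℝ E] [TopologicalSpace E]
    {X : Type u} [TopologicalSpace X] [ChartedSpace E X] {q : ℕ}
    (ω : B × X → E [⋀^Fin q]→ₗ[ℝ] ℝ) (O : Set (B × X)) : Prop :=
  ∀ a ∈ atlas D B, ∀ e ∈ atlas E X,
    SmoothOn (fun p : (D × E) × (Fin q → E) =>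
      chartForm (fun x => ω (a.symm p.1.1, x)) e p.1.2 p.2)
      (((a.prod e).target ∩ (a.prod e).symm ⁻¹' O) ×ˢ univ)

variable {D : Type u} [AddCommGroup D] [Module ℝ D] [TopologicalSpace D]
  [IsTopologicalAddGroup D] [ContinuousSMul ℝ D] [LocallyConvexSpace ℝ D] [T2Space D]
  {B : Type u} [TopologicalSpace B] [ChartedSpace D B]
  {D' : Type u} [AddCommGroup D'] [Module ℝ D'] [TopologicalSpace D']
  [IsTopologicalAddGroup D'] [ContinuousSMul ℝ D'] [LocallyConvexSpace ℝ D'] [T2Space D']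
  {B' : Type u} [TopologicalSpace B'] [ChartedSpace D' B']
  {E : Type u} [AddCommGroup E] [Module ℝ E] [TopologicalSpace E]
  [IsTopologicalAddGroup E] [ContinuousSMul ℝ E] [LocallyConvexSpace ℝ E] [T2Space E]
  {F : Type u} [AddCommGroup F] [Module ℝ F] [TopologicalSpace F]
  [IsTopologicalAddGroup F] [ContinuousSMul ℝ F] [LocallyConvexSpace ℝ F] [T2Space F]
  {H : Type u} [AddCommGroup H] [Module ℝ H] [TopologicalSpace H]
  [IsTopologicalAddGroup H] [ContinuousSMul ℝ H] [LocallyConvexSpace ℝ H] [T2Space H]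
  {X : Type u} [TopologicalSpace X] [ChartedSpace E X] [LCManifold E X]
  {Y : Type u} [TopologicalSpace Y] [ChartedSpace F Y] [LCManifold F Y]
  {Z : Type u} [TopologicalSpace Z] [ChartedSpace H Z] [LCManifold H Z] {q : ℕ}

theorem derivLM_chart_comp {φ : X → Y} (hφ : MSmooth E F φ) {g : Y → Z} (hg : MSmooth F H g)
    {e : OpenPartialHomeomorph X E} (he : e ∈ atlas E X)
    {e' : OpenPartialHomeomorph Y F} (he' : e' ∈ atlas F Y)
    {e'' : OpenPartialHomeomorph Z H} (he'' : e'' ∈ atlas H Z) {y : E} (hy : y ∈ e.target)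
    (hy' : φ (e.symm y) ∈ e'.source) (hy'' : g (φ (e.symm y)) ∈ e''.source) :
    derivLM (fun z => e'' (g (φ (e.symm z)))) y =
      derivLM (fun z => e'' (g (e'.symm z))) (e' (φ (e.symm y))) ∘ₗ
        derivLM (fun z => e' (φ (e.symm z))) y := by
  have o1 := MSmooth.isOpen_dom (E := E) (F := F) hφ.continuous e e'
  have o2 := MSmooth.isOpen_dom (E := F) (F := H) hg.continuous e' e''
  have m2 : e' (φ (e.symm y)) ∈ e'.target ∩ e'.symm ⁻¹' (g ⁻¹' e''.source) :=
    ⟨e'.map_source hy', by simpa [e'.left_inv hy'] using hy''⟩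
  rw [← derivLM_comp (f := fun z => e'' (g (e'.symm z))) (g := fun z => e' (φ (e.symm z)))
    o1 o2 (hg.smooth e' he' e'' he'' 1) (hφ.smooth e he e' he' 1) ⟨hy, hy'⟩ m2]
  refine derivLM_congr ?_
  filter_upwards [o1.mem_nhds ⟨hy, hy'⟩] with z hz
  rw [e'.left_inv hz.2]

theorem mderiv_id (x : X) : mderiv E E (fun y : X => y) x = LinearMap.id := by
  unfold mderiv
  rw [← derivLM_id (chartAt E x x)]
  refine derivLM_congr ?_
  filter_upwards [(chartAt E x).open_target.mem_nhds (mem_chart_target E x)] with z hz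
  exact (chartAt E x).right_inv hz

theorem mderiv_comp {φ : X → Y} (hφ : MSmooth E F φ) {g : Y → Z} (hg : MSmooth F H g) (x : X) :
    mderiv E H (fun y => g (φ y)) x = mderiv F H g (φ x) ∘ₗ mderiv E F φ x := by
  have := derivLM_chart_comp hφ hg (chart_mem_atlas E x) (chart_mem_atlas F (φ x))
    (chart_mem_atlas H (g (φ x))) (mem_chart_target E x)
    (by simp [(chartAt E x).left_inv (mem_chart_source E x)])
    (by simp [(chartAt E x).left_inv (mem_chart_source E x)])
  simp only [(chartAt E x).left_inv (mem_chart_source E x)] at this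
  exact this

/-- pullback in charts -/
theorem chartForm_pullback {φ : X → Y} (hφ : MSmooth E F φ) (η : Y → F [⋀^Fin q]→ₗ[ℝ] ℝ)
    {e : OpenPartialHomeomorph X E} (he : e ∈ atlas E X)
    {e' : OpenPartialHomeomorph Y F} (he' : e' ∈ atlas F Y) {y : E} (hy : y ∈ e.target)
    (hy' : φ (e.symm y) ∈ e'.source) :
    chartForm (fun x => (η (φ x)).compLinearMap (mderiv E F φ x)) e y =
      (chartForm η e' (e' (φ (e.symm y)))).compLinearMap
        (derivLM (fun z => e' (φ (e.symm z))) y) := by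
  have h1 := derivLM_chart_comp (mSmooth_id (E := E) (X := X)) hφ he
    (chart_mem_atlas E (e.symm y)) (chart_mem_atlas F (φ (e.symm y))) hy
    (mem_chart_source _ _) (mem_chart_source _ _)
  have h2 := derivLM_chart_comp hφ (mSmooth_id (E := F) (X := Y)) he he'
    (chart_mem_atlas F (φ (e.symm y))) hy hy' (mem_chart_source _ _)
  have h3 := h1.symm.trans h2
  unfold chartForm
  rw [e'.left_inv hy']
  ext v
  simp only [AlternatingMap.compLinearMap_apply]
  congr 1
  funext i
  exact LinearMap.congr_fun h3 (v i)

theorem chartForm_change (η : X → E [⋀^Fin q]→ₗ[ℝ] ℝ)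
    {e : OpenPartialHomeomorph X E} (he : e ∈ atlas E X)
    {e' : OpenPartialHomeomorph X E} (he' : e' ∈ atlas E X) {y : E} (hy : y ∈ e.target)
    (hy' : e.symm y ∈ e'.source) :
    chartForm η e y = (chartForm η e' (e' (e.symm y))).compLinearMap
        (derivLM (fun z => e' (e.symm z)) y) := by
  have := chartForm_pullback (mSmooth_id (E := E) (X := X)) η he he' hy hy'
  rw [← this]
  simp only [mderiv_id]
  rfl

theorem extD_chartForm_pullback {φ : X → Y} (hφ : MSmooth E F φ) {η : Y → F [⋀^Fin q]→ₗ[ℝ] ℝ}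
    {O : Set Y} (hO : IsOpen O) (hη : SmoothFormOn η O)
    {e : OpenPartialHomeomorph X E} (he : e ∈ atlas E X)
    {e' : OpenPartialHomeomorph Y F} (he' : e' ∈ atlas F Y) {y : E} (hy : y ∈ e.target)
    (hy' : φ (e.symm y) ∈ e'.source) (hyO : φ (e.symm y) ∈ O) :
    extD (chartForm (fun x => (η (φ x)).compLinearMap (mderiv E F φ x)) e) y =
      (extD (chartForm η e') (e' (φ (e.symm y)))).compLinearMap
        (derivLM (fun z => e' (φ (e.symm z))) y) := by
  have o1 : IsOpen (e.target ∩ e.symm ⁻¹' (φ ⁻¹' (e'.source ∩ O))) :=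
    e.isOpen_inter_preimage_symm ((e'.open_source.inter hO).preimage hφ.continuous)
  have o2 : IsOpen (e'.target ∩ e'.symm ⁻¹' O) := e'.isOpen_inter_preimage_symm hO
  rw [← extD_pullback o2 (hη e' he' 1) o1
    ((hφ.smooth e he e' he' 2).mono fun z hz => ⟨hz.1, hz.2.1⟩)
    (fun z hz => ⟨e'.map_source hz.2.1, by
      simpa [e'.left_inv hz.2.1] using hz.2.2⟩) ⟨hy, hy', hyO⟩]
  refine extD_congr ?_
  filter_upwards [o1.mem_nhds ⟨hy, hy', hyO⟩] with z hz
  exact chartForm_pullback hφ η he he' hz.1 hz.2.1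

theorem extD_chartForm_change {η : X → E [⋀^Fin q]→ₗ[ℝ] ℝ}
    {O : Set X} (hO : IsOpen O) (hη : SmoothFormOn η O)
    {e : OpenPartialHomeomorph X E} (he : e ∈ atlas E X)
    {e' : OpenPartialHomeomorph X E} (he' : e' ∈ atlas E X) {y : E} (hy : y ∈ e.target)
    (hy' : e.symm y ∈ e'.source) (hyO : e.symm y ∈ O) :
    extD (chartForm η e) y = (extD (chartForm η e') (e' (e.symm y))).compLinearMap
        (derivLM (fun z => e' (e.symm z)) y) := by
  have := extD_chartForm_pullback (mSmooth_id (E := E) (X := X)) hO hη he he' hy hy' hyO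
  rw [← this]
  simp only [mderiv_id]
  rfl

theorem chartForm_extDM {η : X → E [⋀^Fin q]→ₗ[ℝ] ℝ}
    {O : Set X} (hO : IsOpen O) (hη : SmoothFormOn η O)
    {e : OpenPartialHomeomorph X E} (he : e ∈ atlas E X) {y : E} (hy : y ∈ e.target)
    (hyO : e.symm y ∈ O) : chartForm (extDM η) e y = extD (chartForm η e) y := by
  rw [extD_chartForm_change hO hη he (chart_mem_atlas E (e.symm y)) hy (mem_chart_source _ _) hyO]
  rfl

/-- naturality of the exterior derivative -/
theorem extDM_pullback {φ : X → Y} (hφ : MSmooth E F φ) {η : Y → F [⋀^Fin q]→ₗ[ℝ] ℝ}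
    {O : Set Y} (hO : IsOpen O) (hη : SmoothFormOn η O) {x : X} (hx : φ x ∈ O) :
    extDM (fun x => (η (φ x)).compLinearMap (mderiv E F φ x)) x =
      (extDM η (φ x)).compLinearMap (mderiv E F φ x) := by
  have := extD_chartForm_pullback hφ hO hη (chart_mem_atlas E x) (chart_mem_atlas F (φ x))
    (mem_chart_target E x) (by simp [(chartAt E x).left_inv (mem_chart_source E x)])
    (by simpa [(chartAt E x).left_inv (mem_chart_source E x)] using hx)
  simp only [(chartAt E x).left_inv (mem_chart_source E x)] at this
  exact this

theorem extDM_congr {η η' : X → E [⋀^Fin q]→ₗ[ℝ] ℝ} {x : X} (h : η =ᶠ[𝓝 x] η') :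
    extDM η x = extDM η' x := by
  refine extD_congr ?_
  have hc : Tendsto (chartAt E x).symm (𝓝 (chartAt E x x)) (𝓝 x) := by
    have := (chartAt E x).continuousAt_symm (mem_chart_target E x)
    rwa [ContinuousAt, (chartAt E x).left_inv (mem_chart_source E x)] at this
  filter_upwards [hc.eventually h] with y hy
  unfold chartForm
  rw [hy]

theorem extDM_extDM {η : X → E [⋀^Fin q]→ₗ[ℝ] ℝ} {O : Set X} (hO : IsOpen O)
    (hη : SmoothFormOn η O) {x : X} (hx : x ∈ O) : extDM (extDM η) x = 0 := by
  have he := chart_mem_atlas E x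
  have o : IsOpen ((chartAt E x).target ∩ (chartAt E x).symm ⁻¹' O) :=
    (chartAt E x).isOpen_inter_preimage_symm hO
  have hm : chartAt E x x ∈ (chartAt E x).target ∩ (chartAt E x).symm ⁻¹' O :=
    ⟨mem_chart_target E x, by simpa [(chartAt E x).left_inv (mem_chart_source E x)] using hx⟩
  have h1 : chartForm (extDM η) (chartAt E x) =ᶠ[𝓝 (chartAt E x x)]
      extD (chartForm η (chartAt E x)) := by
    filter_upwards [o.mem_nhds hm] with y hy
    exact chartForm_extDM hO hη he hy.1 hy.2
  unfold extDM at h1 ⊢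
  rw [extD_congr h1]
  exact extD_extD o (fun v => (hη _ he 2).form_apply o v) hm

theorem extDM_add {η η' : X → E [⋀^Fin q]→ₗ[ℝ] ℝ} {O : Set X} (hO : IsOpen O)
    (hη : SmoothFormOn η O) (hη' : SmoothFormOn η' O) {x : X} (hx : x ∈ O) :
    extDM (fun x => η x + η' x) x = extDM η x + extDM η' x := by
  have he := chart_mem_atlas E x
  have o : IsOpen ((chartAt E x).target ∩ (chartAt E x).symm ⁻¹' O) :=
    (chartAt E x).isOpen_inter_preimage_symm hO
  have hm : chartAt E x x ∈ (chartAt E x).target ∩ (chartAt E x).symm ⁻¹' O :=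
    ⟨mem_chart_target E x, by simpa [(chartAt E x).left_inv (mem_chart_source E x)] using hx⟩
  exact extD_add o (fun v => (hη _ he 1).form_apply o v) (fun v => (hη' _ he 1).form_apply o v) hm

theorem SmoothVFormOn.mono {ω : B × X → E [⋀^Fin q]→ₗ[ℝ] ℝ} {O O' : Set (B × X)}
    (h : SmoothVFormOn D ω O) (hO : O' ⊆ O) : SmoothVFormOn D ω O' := fun a ha e he =>
  (h a ha e he).mono (prod_mono (inter_subset_inter_right _ (preimage_mono hO)) subset_rfl)

theorem isOpen_vdom (a : OpenPartialHomeomorph B D) (e : OpenPartialHomeomorph X E)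
    {O : Set (B × X)} (hO : IsOpen O) :
    IsOpen ((((a.prod e).target ∩ (a.prod e).symm ⁻¹' O) ×ˢ univ : Set ((D × E) × (Fin q → E)))) :=
  ((a.prod e).isOpen_inter_preimage_symm hO).prod isOpen_univ

theorem SmoothVFormOn.congr {ω ω' : B × X → E [⋀^Fin q]→ₗ[ℝ] ℝ} {O : Set (B × X)} (hO : IsOpen O)
    (h : SmoothVFormOn D ω O) (hω : EqOn ω ω' O) : SmoothVFormOn D ω' O := fun a ha e he =>
  (h a ha e he).congr (isOpen_vdom a e hO) fun p hp => by
    have h1 : ω (a.symm p.1.1, e.symm p.1.2) = ω' (a.symm p.1.1, e.symm p.1.2) := hω hp.1.2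
    simp only [chartForm, h1]

theorem SmoothVFormOn.zero (O : Set (B × X)) :
    SmoothVFormOn D (fun _ => (0 : E [⋀^Fin q]→ₗ[ℝ] ℝ)) O :=
  fun _ _ _ _ => SmoothOn.const (0 : ℝ) _

theorem SmoothVFormOn.add {ω ω' : B × X → E [⋀^Fin q]→ₗ[ℝ] ℝ} {O : Set (B × X)} (hO : IsOpen O)
    (h : SmoothVFormOn D ω O) (h' : SmoothVFormOn D ω' O) :
    SmoothVFormOn D (fun z => ω z + ω' z) O := fun a ha e he =>
  SmoothOn.add (isOpen_vdom a e hO) (h a ha e he) (h' a ha e he)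

theorem SmoothVFormOn.neg {ω : B × X → E [⋀^Fin q]→ₗ[ℝ] ℝ} {O : Set (B × X)} (hO : IsOpen O)
    (h : SmoothVFormOn D ω O) :
    SmoothVFormOn D (fun z => - ω z) O := fun a ha e he =>
  SmoothOn.clm_comp (isOpen_vdom a e hO) (h a ha e he) (-ContinuousLinearMap.id ℝ ℝ)

theorem SmoothVFormOn.slice {ω : B × X → E [⋀^Fin q]→ₗ[ℝ] ℝ} {O : Set (B × X)} (hO : IsOpen O)
    (h : SmoothVFormOn D ω O) (b : B) : SmoothFormOn (fun x => ω (b, x)) {x | (b, x) ∈ O} := by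
  intro e he
  have ha := chart_mem_atlas D b
  have hb := mem_chart_source D b
  have o : IsOpen (e.target ∩ e.symm ⁻¹' {x | (b, x) ∈ O}) :=
    e.isOpen_inter_preimage_symm (hO.preimage (by fun_prop))
  have h1 : SmoothOn (fun p : E × (Fin q → E) => ((chartAt D b b, p.1), p.2))
      ((e.target ∩ e.symm ⁻¹' {x | (b, x) ∈ O}) ×ˢ univ) :=
    SmoothOn.prodMk (o.prod isOpen_univ) (SmoothOn.prodMk (o.prod isOpen_univ) (SmoothOn.const _ _)
      (SmoothOn.clm (ContinuousLinearMap.fst ℝ E (Fin q → E)) _))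
      (SmoothOn.clm (ContinuousLinearMap.snd ℝ E (Fin q → E)) _)
  refine (SmoothOn.comp (o.prod isOpen_univ) (isOpen_vdom _ e hO) (h _ ha e he) h1 ?_).congr
    (o.prod isOpen_univ) ?_
  · rintro p ⟨⟨hp, hp'⟩, -⟩
    refine ⟨⟨⟨mem_chart_target D b, hp⟩, ?_⟩, trivial⟩
    change ((chartAt D b).symm (chartAt D b b), e.symm p.1) ∈ O
    rw [(chartAt D b).left_inv hb]
    exact hp'
  · intro p hp
    simp only [(chartAt D b).left_inv hb]

/-- smoothness of the vertical exterior derivative -/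
theorem SmoothVFormOn.extDM {ω : B × X → E [⋀^Fin q]→ₗ[ℝ] ℝ} {O : Set (B × X)} (hO : IsOpen O)
    (h : SmoothVFormOn D ω O) :
    SmoothVFormOn D (fun z => EqDeligne.extDM (fun x => ω (z.1, x)) z.2) O := by
  intro a ha e he
  have hs := h a ha e he
  have o := isOpen_vdom (q := q) a e hO
  let P := (D × E) × (Fin q → E)
  let Ω : P → ℝ := fun p => chartForm (fun x => ω (a.symm p.1.1, x)) e p.1.2 p.2
  have key : ∀ i : Fin (q + 1), SmoothOn (fun p : (D × E) × (Fin (q + 1) → E) =>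
      dirDeriv Ω (p.1, i.removeNth p.2) ((0, p.2 i), 0))
      (((a.prod e).target ∩ (a.prod e).symm ⁻¹' O) ×ˢ univ) := by
    intro i
    let R : (Fin (q + 1) → E) →L[ℝ] (Fin q → E) :=
      ContinuousLinearMap.pi fun j => ContinuousLinearMap.proj (i.succAbove j)
    let L : ((D × E) × (Fin (q + 1) → E)) →L[ℝ] P × P :=
      ((ContinuousLinearMap.fst ℝ _ _).prod (R.comp (ContinuousLinearMap.snd ℝ _ _))).prod
        (((0 : _ →L[ℝ] D).prod ((ContinuousLinearMap.proj (R := ℝ) (φ := fun _ : Fin (q + 1) => E)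
          i).comp (ContinuousLinearMap.snd ℝ _ _))).prod 0)
    exact hs.deriv.comp_clm L fun p hp => ⟨⟨hp.1, trivial⟩, trivial⟩
  refine (SmoothOn.sum Finset.univ (isOpen_vdom a e hO) fun i _ =>
    (key i).clm_comp (isOpen_vdom a e hO) (((-1 : ℝ) ^ (i : ℕ)) • ContinuousLinearMap.id ℝ ℝ)).congr
      (isOpen_vdom a e hO) ?_
  rintro ⟨⟨t, y⟩, v⟩ ⟨⟨⟨ht, hy⟩, hO'⟩, -⟩
  have hsl := h.slice hO (a.symm t)
  have hOt : IsOpen {x | (a.symm t, x) ∈ O} := hO.preimage (by fun_prop)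
  have o' : IsOpen (e.target ∩ e.symm ⁻¹' {x | (a.symm t, x) ∈ O}) :=
    e.isOpen_inter_preimage_symm hOt
  change _ = chartForm (EqDeligne.extDM fun x => ω (a.symm t, x)) e y v
  rw [chartForm_extDM hOt hsl he hy hO',
    extD_apply o' (fun v => (hsl e he 1).form_apply o' v) ⟨hy, hO'⟩]
  refine Finset.sum_congr rfl fun i _ => ?_
  have hd : dirDeriv Ω ((t, y), i.removeNth v) ((0, v i), 0) =
      dirDeriv (fun z => chartForm (fun x => ω (a.symm t, x)) e z (i.removeNth v)) y (v i) := by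
    refine dirDeriv_eq_of_eq ?_
    have hlin : ∀ s : ℝ, ((((t, y), i.removeNth v) : (D × E) × (Fin q → E)) + s • ((0, v i), 0)) =
        ((t, y + s • v i), i.removeNth v) := fun s => by simp
    ext c
    simp only [HasDirDeriv]
    have hΩ : ∀ s : ℝ, Ω (((t, y), i.removeNth v) + s • ((0, v i), 0)) =
        chartForm (fun x => ω (a.symm t, x)) e (y + s • v i) (i.removeNth v) := fun s => by
      rw [hlin]
    simp only [hΩ]
    rfl
  rw [hd]
  rcases Nat.even_or_odd (i : ℕ) with h | h <;> simp [h.neg_one_pow]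

/-- pullback of vertical forms along a smooth fibrewise map -/
theorem SmoothVFormOn.pullback [LCManifold D B] {ω : B' × Y → F [⋀^Fin q]→ₗ[ℝ] ℝ}
    {O : Set (B' × Y)} (hO : IsOpen O)
    (h : SmoothVFormOn D' ω O) {β : B → B'} (hβ : MSmooth D D' β) {φ : B × X → Y}
    (hφ : MSmooth (D × E) F φ) :
    SmoothVFormOn D (fun z : B × X => (ω (β z.1, φ z)).compLinearMap
      (mderiv E F (fun x => φ (z.1, x)) z.2)) {z | (β z.1, φ z) ∈ O} := by
  intro a ha e he
  have hcont : Continuous fun z : B × X => (β z.1, φ z) :=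
    (hβ.continuous.comp continuous_fst).prodMk hφ.continuous
  have o := isOpen_vdom (q := q) a e (hO.preimage hcont)
  refine SmoothOn.of_local ?_
  rintro ⟨⟨t₀, y₀⟩, v₀⟩ ⟨⟨⟨ht₀, hy₀⟩, hO₀⟩, -⟩
  let a' := chartAt D' (β (a.symm t₀))
  let e' := chartAt F (φ (a.symm t₀, e.symm y₀))
  have ha' : a' ∈ atlas D' B' := chart_mem_atlas _ _
  have he' : e' ∈ atlas F Y := chart_mem_atlas _ _
  let V : Set (D × E) := (a.prod e).target ∩ (a.prod e).symm ⁻¹'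
    {z | β z.1 ∈ a'.source ∧ φ z ∈ e'.source ∧ (β z.1, φ z) ∈ O}
  have oS : IsOpen {z : B × X | β z.1 ∈ a'.source ∧ φ z ∈ e'.source ∧ (β z.1, φ z) ∈ O} :=
    (a'.open_source.preimage (hβ.continuous.comp continuous_fst)).inter
      ((e'.open_source.preimage hφ.continuous).inter (hO.preimage hcont))
  have oV : IsOpen V := (a.prod e).isOpen_inter_preimage_symm oS
  have oVq : IsOpen (V ×ˢ (univ : Set (Fin q → E))) := oV.prod isOpen_univ
  refine ⟨V ×ˢ univ, oVq, ⟨⟨⟨ht₀, hy₀⟩, mem_chart_source _ _, mem_chart_source _ _, hO₀⟩, trivial⟩,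
    ?_⟩
  -- the coordinate expressions
  let βt : D × E → D' := fun p => a' (β (a.symm p.1))
  let φt : D × E → F := fun p => e' (φ (a.symm p.1, e.symm p.2))
  have hβt : SmoothOn βt V :=
    (hβ.smooth a ha a' ha').comp_clm (ContinuousLinearMap.fst ℝ D E) fun p hp =>
      ⟨hp.1.1, hp.2.1⟩
  have hφt : SmoothOn φt V :=
    (hφ.smooth (a.prod e) ⟨a, ha, e, he, rfl⟩ e' he').mono fun p hp => ⟨hp.1, hp.2.2.1⟩
  have hfst : SmoothOn (fun p : (D × E) × (Fin q → E) => p.1) (V ×ˢ univ) :=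
    SmoothOn.clm (ContinuousLinearMap.fst ℝ (D × E) (Fin q → E)) (V ×ˢ univ)
  have hφd : ∀ i : Fin q, SmoothOn (fun p : (D × E) × (Fin q → E) =>
      dirDeriv φt p.1 (0, p.2 i)) (V ×ˢ univ) := by
    intro i
    let L : ((D × E) × (Fin q → E)) →L[ℝ] (D × E) × (D × E) :=
      (ContinuousLinearMap.fst ℝ _ _).prod ((0 : _ →L[ℝ] D).prod
        ((ContinuousLinearMap.proj (R := ℝ) (φ := fun _ : Fin q => E)
          i).comp (ContinuousLinearMap.snd ℝ _ _)))
    exact hφt.deriv.comp_clm L fun p hp => ⟨hp.1, trivial⟩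
  have hg : SmoothOn (fun p : (D × E) × (Fin q → E) =>
      ((βt p.1, φt p.1), fun i => dirDeriv φt p.1 (0, p.2 i))) (V ×ˢ univ) :=
    SmoothOn.prodMk oVq (SmoothOn.prodMk oVq (hβt.comp oVq oV hfst fun p hp => hp.1)
      (hφt.comp oVq oV hfst fun p hp => hp.1)) (SmoothOn.pi oVq hφd)
  refine (SmoothOn.comp oVq (isOpen_vdom (q := q) a' e' hO) (h a' ha' e' he') hg ?_).congr oVq ?_
  · rintro p ⟨⟨hp, hp1, hp2, hp3⟩, -⟩
    refine ⟨⟨⟨a'.map_source hp1, e'.map_source hp2⟩, ?_⟩, trivial⟩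
    change (a'.symm (a' (β (a.symm p.1.1))), e'.symm (e' (φ (a.symm p.1.1, e.symm p.1.2)))) ∈ O
    have hp1' : β (a.symm p.1.1) ∈ a'.source := hp1
    have hp2' : φ (a.symm p.1.1, e.symm p.1.2) ∈ e'.source := hp2
    rw [a'.left_inv hp1', e'.left_inv hp2']
    exact hp3
  · rintro ⟨⟨t, y⟩, v⟩ ⟨⟨hp, hp1, hp2, hp3⟩, -⟩
    have hp1' : β (a.symm t) ∈ a'.source := hp1
    have hp2' : φ (a.symm t, e.symm y) ∈ e'.source := hp2
    have hφb : MSmooth E F (fun x => φ (a.symm t, x)) :=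
      hφ.comp (MSmooth.prodMk (mSmooth_const (a.symm t)) mSmooth_id)
    have e1 := chartForm_pullback hφb (fun y => ω (β (a.symm t), y)) he he' hp.2 hp2'
    change chartForm (fun y => ω (a'.symm (a' (β (a.symm t))), y)) e' _ _ =
      chartForm (fun x => (ω (β (a.symm t), φ (a.symm t, x))).compLinearMap
        (mderiv E F (fun x => φ (a.symm t, x)) x)) e y v
    rw [e1, a'.left_inv hp1', AlternatingMap.compLinearMap_apply]
    congr 1
    funext i
    have o2 := MSmooth.isOpen_dom (E := E) (F := F) hφb.continuous e e'
    rw [derivLM_apply o2 (hφb.smooth e he e' he' 1) ⟨hp.2, hp2'⟩]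
    refine dirDeriv_eq_of_eq ?_
    ext c
    simp [HasDirDeriv, φt]

end Forms

section DLog

/-- `(1/2πi) f⁻¹ df` for a function `f` with `|f| = 1` on an open subset of `E`. Here `f⁻¹` is the
complex conjugate of `f` and `f⁻¹ df` is imaginary. -/
noncomputable def dlogL {E : Type u} [AddCommGroup E] [Module ℝ E] [TopologicalSpace E]
    (f : E → ℂ) (y : E) : E [⋀^Fin 1]→ₗ[ℝ] ℝ :=
  AlternatingMap.ofSubsingleton ℝ E ℝ (0 : Fin 1)
    ((2 * Real.pi)⁻¹ • (Complex.imLm ∘ₗ LinearMap.mulLeft ℝ (starRingEnd ℂ (f y)) ∘ₗ derivLM f y))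

/-- `(1/2πi) d log f` for a function `f` with `|f| = 1` on a manifold. -/
noncomputable def dlogM {E : Type u} [AddCommGroup E] [Module ℝ E] [TopologicalSpace E]
    {X : Type u} [TopologicalSpace X] [ChartedSpace E X] (f : X → ℂ) (x : X) :
    E [⋀^Fin 1]→ₗ[ℝ] ℝ :=
  dlogL (fun y => f ((chartAt E x).symm y)) (chartAt E x x)

variable {D : Type u} [AddCommGroup D] [Module ℝ D] [TopologicalSpace D]
  [IsTopologicalAddGroup D] [ContinuousSMul ℝ D] [LocallyConvexSpace ℝ D] [T2Space D]
  {B : Type u} [TopologicalSpace B] [ChartedSpace D B] [LCManifold D B]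
  {E : Type u} [AddCommGroup E] [Module ℝ E] [TopologicalSpace E]
  [IsTopologicalAddGroup E] [ContinuousSMul ℝ E] [LocallyConvexSpace ℝ E] [T2Space E]
  {F : Type u} [AddCommGroup F] [Module ℝ F] [TopologicalSpace F]
  [IsTopologicalAddGroup F] [ContinuousSMul ℝ F] [LocallyConvexSpace ℝ F] [T2Space F]
  {X : Type u} [TopologicalSpace X] [ChartedSpace E X] [LCManifold E X]
  {Y : Type u} [TopologicalSpace Y] [ChartedSpace F Y] [LCManifold F Y]

theorem dlogL_apply {f : E → ℂ} {U : Set E} (hU : IsOpen U) (hf : CkOn 1 f U) {y : E}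
    (hy : y ∈ U) (v : Fin 1 → E) :
    dlogL f y v = (2 * Real.pi)⁻¹ * (starRingEnd ℂ (f y) * dirDeriv f y (v 0)).im := by
  unfold dlogL
  simp [derivLM_apply hU hf hy]

theorem dlogL_congr {f g : E → ℂ} {y : E} (h : f =ᶠ[𝓝 y] g) : dlogL f y = dlogL g y := by
  unfold dlogL
  rw [derivLM_congr h, h.eq_of_nhds]

theorem dlogL_comp {f : F → ℂ} {g : E → F} {U : Set E} {V : Set F} (hU : IsOpen U)
    (hV : IsOpen V) (hf : CkOn 1 f V) (hg : CkOn 1 g U) {y : E} (hy : y ∈ U) (hgy : g y ∈ V) :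
    dlogL (fun z => f (g z)) y = (dlogL f (g y)).compLinearMap (derivLM g y) := by
  unfold dlogL
  rw [derivLM_comp hU hV hf hg hy hgy]
  ext v
  simp

theorem hasDirDeriv_iff_hasDerivAt {A : Type*} [NormedAddCommGroup A] [NormedSpace ℝ A]
    {f : E → A} {x v : E} {a : A} :
    HasDirDeriv f x v a ↔ HasDerivAt (fun t : ℝ => f (x + t • v)) a 0 := by
  rw [hasDerivAt_iff_tendsto_slope_zero]
  simp [HasDirDeriv]

theorem hasDerivAt_line {f : E → ℂ} {U : Set E} (hf : CkOn 1 f U) {x : E} (hx : x ∈ U) (v : E) :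
    HasDerivAt (fun t : ℝ => f (x + t • v)) (dirDeriv f x v) 0 :=
  hasDirDeriv_iff_hasDerivAt.1 (hasDirDeriv_of_exists (hf.2.1 x hx v))

theorem dirDeriv_unitary {f : E → ℂ} {U : Set E} (hU : IsOpen U) (hf : CkOn 1 f U)
    (h1 : ∀ z ∈ U, Complex.normSq (f z) = 1) {x : E} (hx : x ∈ U) (v : E) :
    (starRingEnd ℂ (f x) * dirDeriv f x v).re = 0 := by
  have h := hasDerivAt_line hf hx v
  have hre : HasDerivAt (fun t : ℝ => (f (x + t • v)).re) (dirDeriv f x v).re 0 :=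
    Complex.reCLM.hasFDerivAt.comp_hasDerivAt (0 : ℝ) h
  have him : HasDerivAt (fun t : ℝ => (f (x + t • v)).im) (dirDeriv f x v).im 0 :=
    Complex.imCLM.hasFDerivAt.comp_hasDerivAt (0 : ℝ) h
  have h2 := (hre.mul hre).add (him.mul him)
  have hl : Tendsto (fun t : ℝ => x + t • v) (𝓝 0) (𝓝 x) := by
    have : Continuous (fun t : ℝ => x + t • v) := by fun_prop
    simpa using this.tendsto 0
  have h3 : HasDerivAt (fun _ : ℝ => (1 : ℝ)) 0 0 := hasDerivAt_const _ _
  have h4 := h2.unique (h3.congr_of_eventuallyEq (f := fun _ => (1 : ℝ)) (by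
    filter_upwards [hl.eventually (hU.mem_nhds hx)] with t ht
    simpa [Complex.normSq_apply] using h1 _ ht))
  simp only [zero_smul, add_zero] at h4
  simp only [Complex.mul_re, Complex.conj_re, Complex.conj_im]
  linarith

theorem dlogL_mul {f g : E → ℂ} {U : Set E} (hU : IsOpen U) (hf : CkOn 1 f U) (hg : CkOn 1 g U)
    (hf1 : ∀ z ∈ U, Complex.normSq (f z) = 1) (hg1 : ∀ z ∈ U, Complex.normSq (g z) = 1)
    {y : E} (hy : y ∈ U) : dlogL (fun z => f z * g z) y = dlogL f y + dlogL g y := by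
  have hm : CkOn 1 (fun p : ℂ × ℂ => p.1 * p.2) univ :=
    ckOn_of_contDiffOn 1 isOpen_univ (contDiff_fst.mul contDiff_snd).contDiffOn
  have hfg : CkOn 1 (fun z => f z * g z) U :=
    CkOn.comp 1 (g := fun z => (f z, g z)) hU isOpen_univ hm (CkOn.prodMk 1 hU hf hg)
      (mapsTo_univ _ _)
  ext v
  rw [AlternatingMap.add_apply, dlogL_apply hU hfg hy, dlogL_apply hU hf hy, dlogL_apply hU hg hy]
  have h := (hasDerivAt_line hf hy (v 0)).mul (hasDerivAt_line hg hy (v 0))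
  have hd : dirDeriv (fun z => f z * g z) y (v 0) =
      dirDeriv f y (v 0) * g y + f y * dirDeriv g y (v 0) := by
    have := (hasDirDeriv_iff_hasDerivAt (f := fun z => f z * g z).2 h).eq
    simpa using this
  have ef := hf1 y hy
  have eg := hg1 y hy
  rw [hd, ← mul_add]
  congr 1
  have e1 : starRingEnd ℂ (f y) * f y = 1 := by
    rw [mul_comm, Complex.mul_conj, ef]; simp
  have e2 : starRingEnd ℂ (g y) * g y = 1 := by
    rw [mul_comm, Complex.mul_conj, eg]; simp
  rw [← Complex.add_im]
  congr 1
  rw [map_mul]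
  linear_combination (starRingEnd ℂ (f y) * dirDeriv f y (v 0)) * e2 +
    (starRingEnd ℂ (g y) * dirDeriv g y (v 0)) * e1

theorem extD_dlogL {f : E → ℂ} {U : Set E} (hU : IsOpen U) (hf : CkOn 2 f U)
    (hf1 : ∀ z ∈ U, Complex.normSq (f z) = 1) {y : E} (hy : y ∈ U) :
    extD (dlogL f) y = 0 := by
  have hf' : CkOn 1 f U := hf.of_succ
  have hc : ∀ w, CkOn 1 (fun z => dirDeriv f z w) U := fun w => hf.dirDeriv_const hU w
  have hm : CkOn 1 (fun p : ℂ × ℂ => (2 * Real.pi)⁻¹ * (starRingEnd ℂ p.1 * p.2).im) univ := by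
    refine ckOn_of_contDiffOn 1 isOpen_univ (ContDiff.contDiffOn ?_)
    refine contDiff_const.mul (Complex.imCLM.contDiff.comp
      ((Complex.conjCLE.contDiff.comp contDiff_fst).mul contDiff_snd))
  have hW : ∀ v : Fin 1 → E, CkOn 1 (fun z => dlogL f z v) U := fun v =>
    (CkOn.comp 1 (g := fun z => (f z, dirDeriv f z (v 0))) hU isOpen_univ hm
      (CkOn.prodMk 1 hU hf' (hc (v 0))) (mapsTo_univ _ _)).congr hU
      fun z hz => (dlogL_apply hU hf' hz v).symm
  have hd : ∀ (v : Fin 1 → E) (u : E), dirDeriv (fun z => dlogL f z v) y u =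
      (2 * Real.pi)⁻¹ * (starRingEnd ℂ (dirDeriv f y u) * dirDeriv f y (v 0) +
        starRingEnd ℂ (f y) * dirDeriv (fun z => dirDeriv f z (v 0)) y u).im := by
    intro v u
    rw [dirDeriv_congr (g := fun z =>
      (2 * Real.pi)⁻¹ * (starRingEnd ℂ (f z) * dirDeriv f z (v 0)).im) (by
      filter_upwards [hU.mem_nhds hy] with z hz using dlogL_apply hU hf' hz v)]
    refine HasDirDeriv.eq (hasDirDeriv_iff_hasDerivAt.2 ?_)
    have h1 := hasDerivAt_line hf' hy u
    have h2 := hasDerivAt_line (hc (v 0)) hy u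
    have h3 : HasDerivAt (fun t : ℝ => starRingEnd ℂ (f (y + t • u)))
        (starRingEnd ℂ (dirDeriv f y u)) 0 :=
      Complex.conjCLE.toContinuousLinearMap.hasFDerivAt.comp_hasDerivAt (0 : ℝ) h1
    have h4 := h3.mul h2
    have h5 : HasDerivAt (fun t : ℝ => (starRingEnd ℂ (f (y + t • u)) *
        dirDeriv f (y + t • u) (v 0)).im) _ 0 :=
      Complex.imCLM.hasFDerivAt.comp_hasDerivAt (0 : ℝ) h4
    simpa using h5.const_mul ((2 * Real.pi)⁻¹)
  ext v
  rw [extD_apply hU hW hy, Fin.sum_univ_two]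
  simp only [hd, AlternatingMap.zero_apply]
  have r0 : (Fin.removeNth (0 : Fin 2) v) 0 = v 1 := rfl
  have r1 : (Fin.removeNth (1 : Fin 2) v) 0 = v 0 := rfl
  rw [r0, r1, dirDeriv_symm hU hf hy (v 0) (v 1)]
  have k0 := dirDeriv_unitary hU hf' hf1 hy (v 0)
  have k1 := dirDeriv_unitary hU hf' hf1 hy (v 1)
  have n := hf1 y hy
  simp only [Complex.normSq_apply, Complex.mul_re, Complex.mul_im, Complex.add_im, Complex.conj_re,
    Complex.conj_im] at k0 k1 n ⊢
  generalize dirDeriv f y (v 0) = a at *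
  generalize dirDeriv f y (v 1) = b at *
  generalize f y = c at *
  have key : a.re * b.im - a.im * b.re = 0 := by
    have : (a.re * b.im - a.im * b.re) * (c.re * c.re + c.im * c.im) = 0 := by
      linear_combination (c.re * b.im - c.im * b.re) * k0 + (c.im * a.re - c.re * a.im) * k1
    rwa [n, mul_one] at this
  simp only [Fin.val_zero, pow_zero, one_smul, Fin.val_one, pow_one, neg_smul]
  linear_combination (2 * (2 * Real.pi)⁻¹) * key


theorem dlogL_chart {f : Y → ℂ} {O : Set Y} (hO : IsOpen O) (hf : SmoothFunOn F f O) {φ : X → Y}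
    (hφ : MSmooth E F φ)
    {e : OpenPartialHomeomorph X E} (he : e ∈ atlas E X)
    {e' : OpenPartialHomeomorph Y F} (he' : e' ∈ atlas F Y) {y : E} (hy : y ∈ e.target)
    (hy' : φ (e.symm y) ∈ e'.source) (hyO : φ (e.symm y) ∈ O) :
    dlogL (fun z => f (φ (e.symm z))) y =
      (dlogL (fun z => f (e'.symm z)) (e' (φ (e.symm y)))).compLinearMap
        (derivLM (fun z => e' (φ (e.symm z))) y) := by
  have o1 : IsOpen (e.target ∩ e.symm ⁻¹' (φ ⁻¹' e'.source)) :=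
    MSmooth.isOpen_dom (E := E) (F := F) hφ.continuous e e'
  have o2 : IsOpen (e'.target ∩ e'.symm ⁻¹' O) := e'.isOpen_inter_preimage_symm hO
  rw [← dlogL_comp (f := fun z => f (e'.symm z)) (g := fun z => e' (φ (e.symm z))) o1 o2
    (hf e' he' 1) (hφ.smooth e he e' he' 1) ⟨hy, hy'⟩
    ⟨e'.map_source hy', by simpa [e'.left_inv hy'] using hyO⟩]
  refine dlogL_congr ?_
  filter_upwards [o1.mem_nhds ⟨hy, hy'⟩] with z hz
  rw [e'.left_inv hz.2]

theorem chartForm_dlogM {f : X → ℂ} {O : Set X} (hO : IsOpen O) (hf : SmoothFunOn E f O)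
    {e : OpenPartialHomeomorph X E} (he : e ∈ atlas E X) {y : E} (hy : y ∈ e.target)
    (hyO : e.symm y ∈ O) :
    chartForm (dlogM f) e y = dlogL (fun z => f (e.symm z)) y :=
  (dlogL_chart hO hf (mSmooth_id (E := E) (X := X)) he (chart_mem_atlas E (e.symm y)) hy
    (mem_chart_source _ _) hyO).symm

theorem dlogM_comp {f : Y → ℂ} {O : Set Y} (hO : IsOpen O) (hf : SmoothFunOn F f O) {φ : X → Y}
    (hφ : MSmooth E F φ) {x : X} (hx : φ x ∈ O) :
    dlogM (fun x => f (φ x)) x = (dlogM f (φ x)).compLinearMap (mderiv E F φ x) := by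
  have := dlogL_chart hO hf hφ (chart_mem_atlas E x) (chart_mem_atlas F (φ x))
    (mem_chart_target E x) (by simp [(chartAt E x).left_inv (mem_chart_source E x)])
    (by simpa [(chartAt E x).left_inv (mem_chart_source E x)] using hx)
  simp only [(chartAt E x).left_inv (mem_chart_source E x)] at this
  exact this

theorem tendsto_chart_symm (x : X) :
    Tendsto (chartAt E x).symm (𝓝 (chartAt E x x)) (𝓝 x) := by
  have := (chartAt E x).continuousAt_symm (mem_chart_target E x)
  rwa [ContinuousAt, (chartAt E x).left_inv (mem_chart_source E x)] at this

theorem dlogM_congr {f g : X → ℂ} {x : X} (h : f =ᶠ[𝓝 x] g) :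
    dlogM (E := E) f x = dlogM g x :=
  dlogL_congr ((tendsto_chart_symm (E := E) x).eventually h)

theorem dlogM_mul {f g : X → ℂ} {O : Set X} (hO : IsOpen O) (hf : SmoothFunOn E f O)
    (hg : SmoothFunOn E g O) (hf1 : ∀ z, Complex.normSq (f z) = 1)
    (hg1 : ∀ z, Complex.normSq (g z) = 1) {x : X} (hx : x ∈ O) :
    dlogM (E := E) (fun z => f z * g z) x = dlogM f x + dlogM g x :=
  dlogL_mul ((chartAt E x).isOpen_inter_preimage_symm hO) (hf _ (chart_mem_atlas E x) 1)
    (hg _ (chart_mem_atlas E x) 1) (fun _ _ => hf1 _) (fun _ _ => hg1 _)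
    ⟨mem_chart_target E x, by simpa [(chartAt E x).left_inv (mem_chart_source E x)] using hx⟩

theorem extDM_dlogM {f : X → ℂ} {O : Set X} (hO : IsOpen O) (hf : SmoothFunOn E f O)
    (hf1 : ∀ z, Complex.normSq (f z) = 1) {x : X} (hx : x ∈ O) :
    extDM (dlogM (E := E) f) x = 0 := by
  have he := chart_mem_atlas E x
  have o : IsOpen ((chartAt E x).target ∩ (chartAt E x).symm ⁻¹' O) :=
    (chartAt E x).isOpen_inter_preimage_symm hO
  have hm : chartAt E x x ∈ (chartAt E x).target ∩ (chartAt E x).symm ⁻¹' O :=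
    ⟨mem_chart_target E x, by simpa [(chartAt E x).left_inv (mem_chart_source E x)] using hx⟩
  have h1 : chartForm (dlogM f) (chartAt E x) =ᶠ[𝓝 (chartAt E x x)]
      dlogL (fun z => f ((chartAt E x).symm z)) := by
    filter_upwards [o.mem_nhds hm] with y hy
    exact chartForm_dlogM hO hf he hy.1 hy.2
  rw [extDM, extD_congr h1]
  exact extD_dlogL o (hf _ he 2) (fun _ _ => hf1 _) hm

theorem SmoothFunOn.slice {A : Type v} [AddCommGroup A] [Module ℝ A] [TopologicalSpace A]
    [IsTopologicalAddGroup A] [ContinuousSMul ℝ A] [LocallyConvexSpace ℝ A] [T2Space A]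
    {f : B × X → A} {O : Set (B × X)} (hO : IsOpen O) (hf : SmoothFunOn (D × E) f O) (b : B) :
    SmoothFunOn E (fun x => f (b, x)) {x | (b, x) ∈ O} :=
  hf.comp hO (MSmooth.prodMk (mSmooth_const (E := E) (F := D) b) mSmooth_id)

theorem SmoothFunOn.dlogM {f : B × X → ℂ} {O : Set (B × X)} (hO : IsOpen O)
    (hf : SmoothFunOn (D × E) f O) :
    SmoothVFormOn D (fun z : B × X => EqDeligne.dlogM (E := E) (fun x => f (z.1, x)) z.2) O := by
  intro a ha e he
  have oV : IsOpen ((a.prod e).target ∩ (a.prod e).symm ⁻¹' O) :=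
    (a.prod e).isOpen_inter_preimage_symm hO
  have o := isOpen_vdom (q := 1) a e hO
  have hf' : SmoothOn (fun p : D × E => f (a.symm p.1, e.symm p.2))
      ((a.prod e).target ∩ (a.prod e).symm ⁻¹' O) := hf _ ⟨a, ha, e, he, rfl⟩
  let ft : D × E → ℂ := fun p => f (a.symm p.1, e.symm p.2)
  have hm : SmoothOn (fun p : ℂ × ℂ => (2 * Real.pi)⁻¹ * (starRingEnd ℂ p.1 * p.2).im) univ :=
    smoothOn_of_contDiff fun k => contDiff_const.mul (Complex.imCLM.contDiff.comp
      ((Complex.conjCLE.contDiff.comp contDiff_fst).mul contDiff_snd))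
  have h1 : SmoothOn (fun p : (D × E) × (Fin 1 → E) => ft p.1)
      (((a.prod e).target ∩ (a.prod e).symm ⁻¹' O) ×ˢ univ) :=
    hf'.comp_clm (ContinuousLinearMap.fst ℝ (D × E) (Fin 1 → E)) fun p hp => hp.1
  have h2 : SmoothOn (fun p : (D × E) × (Fin 1 → E) => dirDeriv ft p.1 (0, p.2 0))
      (((a.prod e).target ∩ (a.prod e).symm ⁻¹' O) ×ˢ univ) := by
    let L : ((D × E) × (Fin 1 → E)) →L[ℝ] (D × E) × (D × E) :=
      (ContinuousLinearMap.fst ℝ _ _).prod ((0 : _ →L[ℝ] D).prod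
        ((ContinuousLinearMap.proj (R := ℝ) (φ := fun _ : Fin 1 => E)
          0).comp (ContinuousLinearMap.snd ℝ _ _)))
    exact hf'.deriv.comp_clm L fun p hp => ⟨hp.1, trivial⟩
  refine (SmoothOn.comp o isOpen_univ hm (h1.prodMk o h2) (mapsTo_univ _ _)).congr o ?_
  rintro ⟨⟨t, y⟩, v⟩ ⟨⟨⟨ht, hy⟩, hyO⟩, -⟩
  have hO' : IsOpen {x | (a.symm t, x) ∈ O} := hO.preimage (by fun_prop)
  have hs := hf.slice hO (a.symm t)
  have o' := e.isOpen_inter_preimage_symm hO'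
  change _ = chartForm (EqDeligne.dlogM fun x => f (a.symm t, x)) e y v
  rw [chartForm_dlogM hO' hs he hy hyO, dlogL_apply o' (hs e he 1) ⟨hy, hyO⟩]
  have hd : dirDeriv ft (t, y) (0, v 0) =
      dirDeriv (fun z => f (a.symm t, e.symm z)) y (v 0) := by
    refine dirDeriv_eq_of_eq ?_
    ext c
    simp [HasDirDeriv, ft]
  simp only [hd]
  rfl

end DLog

section Actions

/-- Lie groups modelled on the locally convex space `D`. -/
class LCLieGroup (D : Type u) [AddCommGroup D] [Module ℝ D] [TopologicalSpace D]
    (G : Type u) [TopologicalSpace G] [ChartedSpace D G] [Group G] : Prop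
    extends LCManifold D G where
  smooth_mul : MSmooth (D × D) D (fun p : G × G => p.1 * p.2)
  smooth_inv : MSmooth D D (fun g : G => g⁻¹)

/-- The left action of the Lie group `G` on the manifold `M` is smooth. -/
class LCSmoothAction (D : Type u) [AddCommGroup D] [Module ℝ D] [TopologicalSpace D]
    (G : Type u) [TopologicalSpace G] [ChartedSpace D G] [Group G]
    (E : Type u) [AddCommGroup E] [Module ℝ E] [TopologicalSpace E]
    (M : Type u) [TopologicalSpace M] [ChartedSpace E M] [MulAction G M] : Prop where
  smooth_smul : MSmooth (D × E) E (fun p : G × M => p.1 • p.2)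

variable {D : Type u} [AddCommGroup D] [Module ℝ D] [TopologicalSpace D]
  [IsTopologicalAddGroup D] [ContinuousSMul ℝ D] [LocallyConvexSpace ℝ D] [T2Space D]
  {G : Type u} [TopologicalSpace G] [ChartedSpace D G]
  {E : Type u} [AddCommGroup E] [Module ℝ E] [TopologicalSpace E]
  [IsTopologicalAddGroup E] [ContinuousSMul ℝ E] [LocallyConvexSpace ℝ E] [T2Space E]
  {M : Type u} [TopologicalSpace M] [ChartedSpace E M]

instance piLCManifold [LCManifold D G] {ι : Type} [Finite ι] : LCManifold (ι → D) (ι → G) :=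
  ⟨fun e he e' he' => (MSmooth.pi fun i => mSmooth_apply (E := D) (X := G) i).smooth e he e' he'⟩

instance prodLCManifold [LCManifold D G] [LCManifold E M] : LCManifold (D × E) (G × M) :=
  ⟨fun e he e' he' => (MSmooth.prodMk mSmooth_fst (mSmooth_snd (E := D) (F := E) (X := G)
    (Y := M))).smooth e he e' he'⟩

section
variable [Group G]

/-- The structure map of `θ : [m] → [n]` on group coordinates: with `p_i = g₁ ⋯ g_i`, the `j`-th
entry is `p_{θ(j-1)}⁻¹ p_{θ(j)} = g_{θ(j-1)+1} ⋯ g_{θ(j)}`. The inner cofaces multiply adjacent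
entries, the outer ones drop the first or last entry, the codegeneracies insert `1`. -/
def faceG {m n : SimplexCategory} (θ : m ⟶ n) (g : Fin n.len → G) : Fin m.len → G :=
  fun j => (Fin.partialProd g (θ j.castSucc))⁻¹ * Fin.partialProd g (θ j.succ)

/-- The group element `g_{θ(m)+1} ⋯ g_n` by which the structure map of `θ : [m] → [n]` moves the
point of `M`. It is `g_n` for the last coface and `1` for all other cofaces and all
codegeneracies. -/
def actG {m n : SimplexCategory} (θ : m ⟶ n) (g : Fin n.len → G) : G :=
  (Fin.partialProd g (θ (Fin.last _)))⁻¹ * Fin.partialProd g (Fin.last _)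

theorem partialProd_faceG {m n : SimplexCategory} (θ : m ⟶ n) (g : Fin n.len → G)
    (i : Fin (m.len + 1)) : Fin.partialProd (faceG θ g) i =
      (Fin.partialProd g (θ 0))⁻¹ * Fin.partialProd g (θ i) := by
  have := congrFun (Fin.partialProd_left_inv fun i => Fin.partialProd g (θ i)) i
  rw [← this]
  simp only [Pi.smul_apply, smul_eq_mul, inv_mul_cancel_left]
  rfl

theorem faceG_id (n : SimplexCategory) (g : Fin n.len → G) : faceG (𝟙 n) g = g := by
  funext j
  simp [faceG, Fin.partialProd_succ]

theorem actG_id (n : SimplexCategory) (g : Fin n.len → G) : actG (𝟙 n) g = 1 := by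
  simp [actG]

theorem faceG_comp {l m n : SimplexCategory} (ψ : l ⟶ m) (θ : m ⟶ n) (g : Fin n.len → G) :
    faceG (ψ ≫ θ) g = faceG ψ (faceG θ g) := by
  funext j
  change _ = (Fin.partialProd (faceG θ g) _)⁻¹ * Fin.partialProd (faceG θ g) _
  rw [partialProd_faceG, partialProd_faceG]
  simp [faceG, mul_assoc]

theorem actG_comp {l m n : SimplexCategory} (ψ : l ⟶ m) (θ : m ⟶ n) (g : Fin n.len → G) :
    actG (ψ ≫ θ) g = actG ψ (faceG θ g) * actG θ g := by
  change _ = ((Fin.partialProd (faceG θ g) _)⁻¹ * Fin.partialProd (faceG θ g) _) * _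
  rw [partialProd_faceG, partialProd_faceG]
  simp [actG, mul_assoc]

variable [LCLieGroup D G]

theorem mSmooth_partialProd {n : ℕ} (i : Fin (n + 1)) :
    MSmooth (Fin n → D) D (fun g : Fin n → G => Fin.partialProd g i) := by
  induction i using Fin.induction with
  | zero => simpa using mSmooth_const (E := Fin n → D) (F := D) (X := Fin n → G) (1 : G)
  | succ i ih =>
    simp only [Fin.partialProd_succ]
    exact (LCLieGroup.smooth_mul (D := D) (G := G)).comp (ih.prodMk (mSmooth_apply i))

theorem mSmooth_div {n : ℕ} (i j : Fin (n + 1)) :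
    MSmooth (Fin n → D) D (fun g : Fin n → G => (Fin.partialProd g i)⁻¹ * Fin.partialProd g j) :=
  (LCLieGroup.smooth_mul (D := D) (G := G)).comp
    (((LCLieGroup.smooth_inv (D := D) (G := G)).comp (mSmooth_partialProd i)).prodMk
      (mSmooth_partialProd j))

theorem mSmooth_faceG {m n : SimplexCategory} (θ : m ⟶ n) :
    MSmooth (Fin n.len → D) (Fin m.len → D) (faceG (G := G) θ) :=
  MSmooth.pi fun _ => mSmooth_div _ _

theorem mSmooth_actG {m n : SimplexCategory} (θ : m ⟶ n) :
    MSmooth (Fin n.len → D) D (actG (G := G) θ) :=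
  mSmooth_div _ _

variable [LCManifold E M] [MulAction G M] [LCSmoothAction D G E M]

theorem mSmooth_act {m n : SimplexCategory} (θ : m ⟶ n) :
    MSmooth ((Fin n.len → D) × E) E (fun z : (Fin n.len → G) × M => actG θ z.1 • z.2) :=
  (LCSmoothAction.smooth_smul (D := D) (G := G) (E := E) (M := M)).comp
    (((mSmooth_actG θ).comp mSmooth_fst).prodMk mSmooth_snd)

theorem mSmooth_simp {m n : SimplexCategory} (θ : m ⟶ n) :
    MSmooth ((Fin n.len → D) × E) ((Fin m.len → D) × E)
      (fun z : (Fin n.len → G) × M => (faceG θ z.1, actG θ z.1 • z.2)) :=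
  ((mSmooth_faceG θ).comp mSmooth_fst).prodMk (mSmooth_act θ)

theorem mSmooth_translation (D : Type u) [AddCommGroup D] [Module ℝ D] [TopologicalSpace D]
    [IsTopologicalAddGroup D] [ContinuousSMul ℝ D] [LocallyConvexSpace ℝ D] [T2Space D]
    {G : Type u} [TopologicalSpace G] [ChartedSpace D G] [Group G] [LCLieGroup D G] [MulAction G M]
    [LCSmoothAction D G E M] (g : G) : MSmooth E E (fun x : M => g • x) :=
  (LCSmoothAction.smooth_smul (D := D) (G := G) (E := E) (M := M)).comp
    ((mSmooth_const g).prodMk mSmooth_id)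

variable (D G E M) in
/-- The simplicial space `G^• × M`, with `G^n × M` in level `n`, faces
`∂₀(g₁, …, g_n, x) = (g₂, …, g_n, x)`, `∂ᵢ(g₁, …, g_n, x) = (g₁, …, gᵢ gᵢ₊₁, …, g_n, x)`,
`∂_n(g₁, …, g_n, x) = (g₁, …, g_{n-1}, g_n x)`, and degeneracies inserting the unit element. -/
def simpSpace : SimplicialObject TopCat.{u} where
  obj n := TopCat.of ((Fin n.unop.len → G) × M)
  map θ := TopCat.ofHom ⟨fun z => (faceG θ.unop z.1, actG θ.unop z.1 • z.2),
    (mSmooth_simp (D := D) (E := E) θ.unop).continuous⟩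
  map_id n := by
    refine TopCat.hom_ext (ContinuousMap.ext fun z => ?_)
    change (faceG (𝟙 _) z.1, actG (𝟙 _) z.1 • z.2) = z
    rw [faceG_id, actG_id, one_smul]
  map_comp θ ψ := by
    refine TopCat.hom_ext (ContinuousMap.ext fun z => ?_)
    change (faceG (ψ.unop ≫ θ.unop) z.1, actG (ψ.unop ≫ θ.unop) z.1 • z.2) = _
    rw [faceG_comp, actG_comp, mul_smul]
    rfl

end
end Actions

section Sheaves

/-- The circle group `𝕋`, written additively. -/
abbrev TVal : Type u := ULift.{u} (Additive Circle)

/-- The complex number of an element of `𝕋`. -/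
def TVal.toC (k : TVal.{u}) : ℂ := ((Additive.toMul k.down : Circle) : ℂ)

theorem TVal.toC_zero : TVal.toC (0 : TVal.{u}) = 1 := rfl
theorem TVal.toC_add (k l : TVal.{u}) : TVal.toC (k + l) = TVal.toC k * TVal.toC l := rfl
theorem TVal.toC_neg (k : TVal.{u}) : TVal.toC (-k) = starRingEnd ℂ (TVal.toC k) :=
  Circle.coe_inv_eq_conj _
theorem TVal.normSq_toC (k : TVal.{u}) : Complex.normSq (TVal.toC k) = 1 :=
  Circle.normSq_coe _

variable {D : Type u} [AddCommGroup D] [Module ℝ D] [TopologicalSpace D]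
  [IsTopologicalAddGroup D] [ContinuousSMul ℝ D] [LocallyConvexSpace ℝ D] [T2Space D]
  {E : Type u} [AddCommGroup E] [Module ℝ E] [TopologicalSpace E]
  [IsTopologicalAddGroup E] [ContinuousSMul ℝ E] [LocallyConvexSpace ℝ E] [T2Space E]
  {X : Type u} [TopologicalSpace X] [ChartedSpace E X]
  {B : Type u} [TopologicalSpace B] [ChartedSpace D B]

theorem smoothFunOn_mono {A : Type v} [AddCommGroup A] [Module ℝ A] [TopologicalSpace A]
    {f : X → A} {O O' : Set X}
    (h : SmoothFunOn E f O) (hO : O' ⊆ O) : SmoothFunOn E f O' := fun e he k =>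
  (h e he k).mono (inter_subset_inter_right _ (preimage_mono hO))

theorem smoothFunOn_congr {A : Type v} [AddCommGroup A] [Module ℝ A] [TopologicalSpace A]
    [IsTopologicalAddGroup A] [ContinuousSMul ℝ A] [LocallyConvexSpace ℝ A] [T2Space A]
    {f g : X → A} {O : Set X} (hO : IsOpen O)
    (h : SmoothFunOn E f O) (hfg : EqOn f g O) : SmoothFunOn E g O := fun e he =>
  (h e he).congr (e.isOpen_inter_preimage_symm hO) fun _ hy => hfg hy.2

theorem smoothFunOn_mul {f g : X → ℂ} {O : Set X} (hO : IsOpen O)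
    (h : SmoothFunOn E f O) (h' : SmoothFunOn E g O) : SmoothFunOn E (fun x => f x * g x) O :=
  fun e he => SmoothOn.comp (g := fun y => (f (e.symm y), g (e.symm y)))
    (e.isOpen_inter_preimage_symm hO) isOpen_univ
    (smoothOn_of_contDiff (f := fun p : ℂ × ℂ => p.1 * p.2) fun _ => contDiff_fst.mul contDiff_snd)
    ((h e he).prodMk (e.isOpen_inter_preimage_symm hO) (h' e he)) (mapsTo_univ _ _)

theorem smoothFunOn_conj {f : X → ℂ} {O : Set X} (hO : IsOpen O)
    (h : SmoothFunOn E f O) : SmoothFunOn E (fun x => starRingEnd ℂ (f x)) O :=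
  fun e he => (h e he).clm_comp (e.isOpen_inter_preimage_symm hO)
    Complex.conjCLE.toContinuousLinearMap

/-- The `𝕋`-valued function `f` is smooth near `x`. -/
def TGerm (E : Type u) [AddCommGroup E] [Module ℝ E] [TopologicalSpace E]
    {X : Type u} [TopologicalSpace X] [ChartedSpace E X] (f : X → TVal.{u}) (x : X) : Prop :=
  ∃ O, IsOpen O ∧ x ∈ O ∧ SmoothFunOn E (fun y => (f y).toC) O

theorem TGerm.congr {f g : X → TVal.{u}} {x : X} (h : f =ᶠ[𝓝 x] g) (hf : TGerm E f x) :
    TGerm E g x := by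
  obtain ⟨O, hO, hx, hs⟩ := hf
  obtain ⟨V, hV, hVo, hxV⟩ := eventually_nhds_iff.1 h
  exact ⟨O ∩ V, hO.inter hVo, ⟨hx, hxV⟩, smoothFunOn_congr (hO.inter hVo)
    (smoothFunOn_mono hs inter_subset_left) fun y hy => by simp only [hV y hy.2]⟩

theorem TGerm.zero (x : X) : TGerm E (fun _ : X => (0 : TVal.{u})) x :=
  ⟨univ, isOpen_univ, trivial, fun _ _ => SmoothOn.const _ _⟩

theorem TGerm.add {f g : X → TVal.{u}} {x : X} (hf : TGerm E f x) (hg : TGerm E g x) :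
    TGerm E (fun y => f y + g y) x := by
  obtain ⟨O, hO, hx, hs⟩ := hf
  obtain ⟨O', hO', hx', hs'⟩ := hg
  exact ⟨O ∩ O', hO.inter hO', ⟨hx, hx'⟩, smoothFunOn_mul (hO.inter hO')
    (smoothFunOn_mono hs inter_subset_left) (smoothFunOn_mono hs' inter_subset_right)⟩

theorem TGerm.neg {f : X → TVal.{u}} {x : X} (hf : TGerm E f x) :
    TGerm E (fun y => - f y) x := by
  obtain ⟨O, hO, hx, hs⟩ := hf
  exact ⟨O, hO, hx, by simpa only [TVal.toC_neg] using smoothFunOn_conj hO hs⟩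

theorem TGerm.comp {F Y : Type u} [AddCommGroup F] [Module ℝ F] [TopologicalSpace F]
    [IsTopologicalAddGroup F] [ContinuousSMul ℝ F] [LocallyConvexSpace ℝ F] [T2Space F]
    [TopologicalSpace Y] [ChartedSpace F Y] {f : Y → TVal.{u}} {φ : X → Y} (hφ : MSmooth E F φ)
    {x : X} (hf : TGerm F f (φ x)) : TGerm E (fun y => f (φ y)) x := by
  obtain ⟨O, hO, hx, hs⟩ := hf
  exact ⟨φ ⁻¹' O, hO.preimage hφ.continuous, hx, hs.comp hO hφ⟩

/-- `ω` is a smooth relative form near `z`. -/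
def VGerm (D : Type u) [AddCommGroup D] [Module ℝ D] [TopologicalSpace D]
    {B : Type u} [TopologicalSpace B] [ChartedSpace D B]
    {E : Type u} [AddCommGroup E] [Module ℝ E] [TopologicalSpace E]
    {X : Type u} [TopologicalSpace X] [ChartedSpace E X] {q : ℕ}
    (ω : B × X → E [⋀^Fin q]→ₗ[ℝ] ℝ) (z : B × X) : Prop :=
  ∃ O, IsOpen O ∧ z ∈ O ∧ SmoothVFormOn D ω O

/-- The relative exterior derivative, along the fibres of `B × X → B`. -/
noncomputable def vd {B E X : Type u} [AddCommGroup E] [Module ℝ E] [TopologicalSpace E]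
    [TopologicalSpace X] [ChartedSpace E X] {q : ℕ}
    (ω : B × X → E [⋀^Fin q]→ₗ[ℝ] ℝ) (z : B × X) : E [⋀^Fin (q + 1)]→ₗ[ℝ] ℝ :=
  extDM (fun x => ω (z.1, x)) z.2

/-- The relative `(1/2πi) d log`, along the fibres of `B × X → B`. -/
noncomputable def vdlog {B E X : Type u} [AddCommGroup E] [Module ℝ E] [TopologicalSpace E]
    [TopologicalSpace X] [ChartedSpace E X] (f : B × X → TVal.{u}) (z : B × X) :
    E [⋀^Fin 1]→ₗ[ℝ] ℝ :=
  dlogM (fun x => (f (z.1, x)).toC) z.2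

variable [LCManifold D B] [LCManifold E X] {q : ℕ}

theorem VGerm.congr {ω ω' : B × X → E [⋀^Fin q]→ₗ[ℝ] ℝ} {z : B × X} (h : ω =ᶠ[𝓝 z] ω')
    (hω : VGerm D ω z) : VGerm D ω' z := by
  obtain ⟨O, hO, hx, hs⟩ := hω
  obtain ⟨V, hV, hVo, hxV⟩ := eventually_nhds_iff.1 h
  exact ⟨O ∩ V, hO.inter hVo, ⟨hx, hxV⟩, (hs.mono inter_subset_left).congr (hO.inter hVo)
    fun y hy => hV y hy.2⟩

theorem VGerm.zero (z : B × X) : VGerm D (fun _ => (0 : E [⋀^Fin q]→ₗ[ℝ] ℝ)) z :=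
  ⟨univ, isOpen_univ, trivial, SmoothVFormOn.zero _⟩

theorem VGerm.add {ω ω' : B × X → E [⋀^Fin q]→ₗ[ℝ] ℝ} {z : B × X}
    (hω : VGerm D ω z) (hω' : VGerm D ω' z) : VGerm D (fun y => ω y + ω' y) z := by
  obtain ⟨O, hO, hx, hs⟩ := hω
  obtain ⟨O', hO', hx', hs'⟩ := hω'
  exact ⟨O ∩ O', hO.inter hO', ⟨hx, hx'⟩, (hs.mono inter_subset_left).add (hO.inter hO')
    (hs'.mono inter_subset_right)⟩

theorem VGerm.neg {ω : B × X → E [⋀^Fin q]→ₗ[ℝ] ℝ} {z : B × X}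
    (hω : VGerm D ω z) : VGerm D (fun y => - ω y) z := by
  obtain ⟨O, hO, hx, hs⟩ := hω
  exact ⟨O, hO, hx, hs.neg hO⟩

theorem VGerm.vd {ω : B × X → E [⋀^Fin q]→ₗ[ℝ] ℝ} {z : B × X}
    (hω : VGerm D ω z) : VGerm D (vd ω) z := by
  obtain ⟨O, hO, hx, hs⟩ := hω
  exact ⟨O, hO, hx, hs.extDM hO⟩

theorem TGerm.vdlog {f : B × X → TVal.{u}} {z : B × X} (hf : TGerm (D × E) f z) :
    VGerm D (vdlog (E := E) f) z := by
  obtain ⟨O, hO, hx, hs⟩ := hf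
  have h := SmoothFunOn.dlogM (f := fun y => (f y).toC) hO hs
  exact ⟨O, hO, hx, h⟩

theorem vd_congr {ω ω' : B × X → E [⋀^Fin q]→ₗ[ℝ] ℝ} {z : B × X} (h : ω =ᶠ[𝓝 z] ω') :
    vd ω z = vd ω' z := by
  refine extDM_congr ?_
  have : Continuous fun x : X => (z.1, x) := by fun_prop
  exact (this.tendsto z.2).eventually h

theorem vdlog_congr {f g : B × X → TVal.{u}} {z : B × X} (h : f =ᶠ[𝓝 z] g) :
    vdlog (E := E) f z = vdlog g z := by
  refine dlogM_congr ?_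
  have : Continuous fun x : X => (z.1, x) := by fun_prop
  filter_upwards [(this.tendsto z.2).eventually h] with x hx
  simp only [hx]

theorem vd_zero (z : B × X) : vd (fun _ => (0 : E [⋀^Fin q]→ₗ[ℝ] ℝ)) z = 0 := by
  have h : extD (fun _ : E => (0 : E [⋀^Fin q]→ₗ[ℝ] ℝ)) (chartAt E z.2 z.2) = 0 := by
    ext v
    rw [extD_apply isOpen_univ (fun v => CkOn.const 1 (0 : ℝ) univ) (mem_univ _)]
    have : ∀ (y u : E), dirDeriv (fun _ : E => (0 : ℝ)) y u = 0 := fun y u =>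
      (hasDirDeriv_const 0 y u).eq
    simp [this]
  exact h

theorem vd_eq_zero {ω : B × X → E [⋀^Fin q]→ₗ[ℝ] ℝ} {z : B × X} (h : ω =ᶠ[𝓝 z] 0) :
    vd ω z = 0 := (vd_congr h).trans (vd_zero z)

theorem vd_add {ω ω' : B × X → E [⋀^Fin q]→ₗ[ℝ] ℝ} {z : B × X}
    (hω : VGerm D ω z) (hω' : VGerm D ω' z) : vd (fun y => ω y + ω' y) z = vd ω z + vd ω' z := by
  obtain ⟨O, hO, hx, hs⟩ := hω
  obtain ⟨O', hO', hx', hs'⟩ := hω'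
  have c : Continuous fun x : X => (z.1, x) := by fun_prop
  exact extDM_add ((hO.inter hO').preimage c) ((hs.mono inter_subset_left).slice (hO.inter hO') z.1)
    ((hs'.mono inter_subset_right).slice (hO.inter hO') z.1) ⟨hx, hx'⟩

theorem vdlog_add {f g : B × X → TVal.{u}} {z : B × X}
    (hf : TGerm (D × E) f z) (hg : TGerm (D × E) g z) :
    vdlog (E := E) (fun y => f y + g y) z = vdlog f z + vdlog g z := by
  obtain ⟨O, hO, hx, hs⟩ := hf
  obtain ⟨O', hO', hx', hs'⟩ := hg
  have c : Continuous fun x : X => (z.1, x) := by fun_prop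
  exact dlogM_mul ((hO.inter hO').preimage c)
    ((smoothFunOn_mono hs inter_subset_left).slice (hO.inter hO') z.1)
    ((smoothFunOn_mono hs' inter_subset_right).slice (hO.inter hO') z.1)
    (fun _ => TVal.normSq_toC _) (fun _ => TVal.normSq_toC _) ⟨hx, hx'⟩

theorem vd_vd {ω : B × X → E [⋀^Fin q]→ₗ[ℝ] ℝ} {z : B × X} (hω : VGerm D ω z) :
    vd (vd ω) z = 0 := by
  obtain ⟨O, hO, hx, hs⟩ := hω
  have c : Continuous fun x : X => (z.1, x) := by fun_prop
  exact extDM_extDM (hO.preimage c) (hs.slice hO z.1) hx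

theorem vd_vdlog {f : B × X → TVal.{u}} {z : B × X} (hf : TGerm (D × E) f z) :
    vd (vdlog (E := E) f) z = 0 := by
  obtain ⟨O, hO, hx, hs⟩ := hf
  have c : Continuous fun x : X => (z.1, x) := by fun_prop
  exact extDM_dlogM (hO.preimage c) (hs.slice hO z.1) (fun _ => TVal.normSq_toC _) hx

theorem VGerm.eventually {ω : B × X → E [⋀^Fin q]→ₗ[ℝ] ℝ} {z : B × X} (hω : VGerm D ω z) :
    ∀ᶠ y in 𝓝 z, VGerm D ω y := by
  obtain ⟨O, hO, hx, hs⟩ := hω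
  filter_upwards [hO.mem_nhds hx] with y hy using ⟨O, hO, hy, hs⟩

theorem TGerm.eventually {f : X → TVal.{u}} {x : X} (hf : TGerm E f x) :
    ∀ᶠ y in 𝓝 x, TGerm E f y := by
  obtain ⟨O, hO, hx, hs⟩ := hf
  filter_upwards [hO.mem_nhds hx] with y hy using ⟨O, hO, hy, hs⟩

section pull
variable {D' : Type u} [AddCommGroup D'] [Module ℝ D'] [TopologicalSpace D']
  [IsTopologicalAddGroup D'] [ContinuousSMul ℝ D'] [LocallyConvexSpace ℝ D'] [T2Space D']
  {B' : Type u} [TopologicalSpace B'] [ChartedSpace D' B']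
  {β : B → B'} (hβ : MSmooth D D' β) {φ : B × X → X} (hφ : MSmooth (D × E) E φ)

theorem VGerm.pullback (hβ : MSmooth D D' β) (hφ : MSmooth (D × E) E φ)
    {ω : B' × X → E [⋀^Fin q]→ₗ[ℝ] ℝ} {z : B × X}
    (hω : VGerm D' ω (β z.1, φ z)) : VGerm D (fun z : B × X => (ω (β z.1, φ z)).compLinearMap
      (mderiv E E (fun x => φ (z.1, x)) z.2)) z := by
  obtain ⟨O, hO, hx, hs⟩ := hω
  have c : Continuous fun z : B × X => (β z.1, φ z) :=
    (hβ.continuous.comp continuous_fst).prodMk hφ.continuous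
  exact ⟨_, hO.preimage c, hx, hs.pullback hO hβ hφ⟩

theorem vd_pullback (hφ : MSmooth (D × E) E φ)
    {ω : B' × X → E [⋀^Fin q]→ₗ[ℝ] ℝ} {z : B × X}
    (hω : VGerm D' ω (β z.1, φ z)) : vd (fun z : B × X => (ω (β z.1, φ z)).compLinearMap
      (mderiv E E (fun x => φ (z.1, x)) z.2)) z =
        (vd ω (β z.1, φ z)).compLinearMap (mderiv E E (fun x => φ (z.1, x)) z.2) := by
  obtain ⟨O, hO, hx, hs⟩ := hω
  have c : Continuous fun x : X => (β z.1, x) := by fun_prop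
  have hφz : MSmooth E E (fun x => φ (z.1, x)) :=
    hφ.comp (MSmooth.prodMk (mSmooth_const z.1) mSmooth_id)
  exact extDM_pullback hφz (hO.preimage c) (hs.slice hO (β z.1)) hx

theorem vdlog_pullback [LCManifold D' B'] (hφ : MSmooth (D × E) E φ)
    {f : B' × X → TVal.{u}} {z : B × X}
    (hf : TGerm (D' × E) f (β z.1, φ z)) : vdlog (fun z : B × X => f (β z.1, φ z)) z =
        (vdlog f (β z.1, φ z)).compLinearMap (mderiv E E (fun x => φ (z.1, x)) z.2) := by
  obtain ⟨O, hO, hx, hs⟩ := hf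
  have c : Continuous fun x : X => (β z.1, x) := by fun_prop
  have hφz : MSmooth E E (fun x => φ (z.1, x)) :=
    hφ.comp (MSmooth.prodMk (mSmooth_const z.1) mSmooth_id)
  exact dlogM_comp (hO.preimage c) (hs.slice hO (β z.1)) hφz hx

end pull
end Sheaves

section Concrete

variable (D : Type u) [AddCommGroup D] [Module ℝ D] [TopologicalSpace D]
  [IsTopologicalAddGroup D] [ContinuousSMul ℝ D] [LocallyConvexSpace ℝ D] [T2Space D]
  (G : Type u) [TopologicalSpace G] [ChartedSpace D G] [Group G] [LCLieGroup D G]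
  (E : Type u) [AddCommGroup E] [Module ℝ E] [TopologicalSpace E]
  [IsTopologicalAddGroup E] [ContinuousSMul ℝ E] [LocallyConvexSpace ℝ E] [T2Space E]
  (M : Type u) [TopologicalSpace M] [ChartedSpace E M] [LCManifold E M]
  [MulAction G M] [LCSmoothAction D G E M]

/-- The simplicial sheaf `𝕋` of smooth `𝕋`-valued functions on `G^• × M`. -/
noncomputable def shT : FunSheaf (simpSpace D G E M) where
  K := TVal.{u}
  τ _ _ := AddMonoidHom.id _
  τ_id _ _ _ := rfl
  τ_comp _ _ _ _ := rfl
  P n f z := TGerm ((Fin n.len → D) × E) (X := (Fin n.len → G) × M) f z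
  P_congr h hf := TGerm.congr h hf
  P_zero _ := TGerm.zero _
  P_add hf hg := TGerm.add hf hg
  P_neg hf := TGerm.neg hf
  P_pull θ _ _ hf := TGerm.comp (mSmooth_simp θ) hf

/-- The simplicial sheaf `π⁻¹𝕋`, the inverse image of the sheaf of smooth `𝕋`-valued functions under
`π : G^• × M → G^• × pt`. As `π` is open and surjective, its sections are the functions that are
locally of the form `h ∘ π` with `h` smooth. -/
noncomputable def shPiT : FunSheaf (simpSpace D G E M) where
  K := TVal.{u}
  τ _ _ := AddMonoidHom.id _
  τ_id _ _ _ := rfl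
  τ_comp _ _ _ _ := rfl
  P n f (z : (Fin n.len → G) × M) := ∃ h : (Fin n.len → G) → TVal.{u},
    TGerm (Fin n.len → D) h z.1 ∧ f =ᶠ[𝓝 z] fun y : (Fin n.len → G) × M => h y.1
  P_congr := by
    rintro n f g z hfg ⟨h, hh, hf⟩
    exact ⟨h, hh, hfg.symm.trans hf⟩
  P_zero z := ⟨_, TGerm.zero _, EventuallyEq.rfl⟩
  P_add := by
    rintro n f g z ⟨h, hh, hf⟩ ⟨h', hh', hf'⟩
    exact ⟨_, hh.add hh', hf.add hf'⟩
  P_neg := by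
    rintro n f z ⟨h, hh, hf⟩
    exact ⟨_, hh.neg, hf.neg⟩
  P_pull := by
    rintro m n θ f z ⟨h, hh, hf⟩
    exact ⟨fun g => h (faceG θ g), TGerm.comp (mSmooth_faceG θ) hh,
      ((simpSpace D G E M).map θ.op).hom.continuous.tendsto z |>.eventually hf⟩

variable {G M}

/-- Pullback of relative forms at `z = (g, x)` along the structure map of `θ`: on the fibre through `z`
it is the pullback along the translation by `actG θ g`. -/
noncomputable def pullV (q : ℕ) {m n : SimplexCategory} (θ : m ⟶ n)
    (z : (Fin n.len → G) × M) : E [⋀^Fin q]→ₗ[ℝ] ℝ →+ E [⋀^Fin q]→ₗ[ℝ] ℝ :=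
  (compLM q (mderiv E E (fun x : M => actG θ z.1 • x) z.2)).toAddMonoidHom

variable {E} in
theorem pullV_id (q : ℕ) (n : SimplexCategory) (z : (Fin n.len → G) × M)
    (k : E [⋀^Fin q]→ₗ[ℝ] ℝ) : pullV E q (𝟙 n) z k = k := by
  have h : mderiv E E (fun x : M => actG (𝟙 n) z.1 • x) z.2 = LinearMap.id := by
    simp only [actG_id, one_smul]
    exact mderiv_id z.2
  change k.compLinearMap _ = k
  rw [h]
  rfl

theorem pullV_comp (ht : ∀ g : G, MSmooth E E (fun x : M => g • x)) (q : ℕ) {l m n : SimplexCategory} (ψ : l ⟶ m) (θ : m ⟶ n)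
    (z : (Fin n.len → G) × M) (k : E [⋀^Fin q]→ₗ[ℝ] ℝ) :
    pullV E q (ψ ≫ θ) z k = pullV E q θ z (pullV E q ψ (faceG θ z.1, actG θ z.1 • z.2) k) := by
  have h := mderiv_comp (ht (actG θ z.1)) (ht (actG ψ (faceG θ z.1))) z.2
  simp only [smul_smul, ← actG_comp] at h
  change k.compLinearMap _ = (k.compLinearMap _).compLinearMap _
  rw [h]
  rfl

variable (G M)

/-- The simplicial sheaf `A^q_rel` of smooth relative `q`-forms on `G^• × M` over `G^•` if the
proposition `R` holds, and the zero sheaf otherwise. -/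
noncomputable def shA (q : ℕ) (R : Prop) : FunSheaf (simpSpace D G E M) where
  K := E [⋀^Fin q]→ₗ[ℝ] ℝ
  τ θ z := pullV E q θ z
  τ_id n z k := pullV_id q n z k
  τ_comp ψ θ z k := pullV_comp E (mSmooth_translation D) q ψ θ z k
  P n f (z : (Fin n.len → G) × M) :=
    VGerm (Fin n.len → D) (X := M) f z ∧ (R ∨ f =ᶠ[𝓝 z] fun _ => 0)
  P_congr := fun h hf => ⟨hf.1.congr h, hf.2.imp_right fun h0 => h.symm.trans h0⟩
  P_zero z := ⟨VGerm.zero _, Or.inr EventuallyEq.rfl⟩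
  P_add := fun {n f g z} hf hg => ⟨VGerm.add hf.1 hg.1, hf.2.elim Or.inl fun hf0 =>
    hg.2.imp_right fun hg0 => by
      filter_upwards [hf0, hg0] with y h1 h2
      rw [h1, h2, add_zero]⟩
  P_neg := fun {n f z} hf => ⟨VGerm.neg hf.1, hf.2.imp_right fun hf0 => by
      filter_upwards [hf0] with y h1
      rw [h1, neg_zero]⟩
  P_pull := fun {m n} θ {f z} hf => ⟨VGerm.pullback (mSmooth_faceG θ) (mSmooth_act θ) hf.1,
    hf.2.imp_right fun hf0 => by
      filter_upwards [((simpSpace D G E M).map θ.op).hom.continuous.tendsto z |>.eventually hf0] with y hy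
      rw [hy, map_zero]⟩

/-- The simplicial sheaf `A^q_{rel,cl}` of closed smooth relative `q`-forms. -/
noncomputable def shAcl (q : ℕ) : FunSheaf (simpSpace D G E M) where
  K := E [⋀^Fin q]→ₗ[ℝ] ℝ
  τ θ z := pullV E q θ z
  τ_id n z k := pullV_id q n z k
  τ_comp ψ θ z k := pullV_comp E (mSmooth_translation D) q ψ θ z k
  P n f (z : (Fin n.len → G) × M) :=
    VGerm (Fin n.len → D) (X := M) f z ∧ vd f =ᶠ[𝓝 z] fun _ => 0
  P_congr := fun {n f g z} h hf => ⟨hf.1.congr h, by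
    have h' : ∀ᶠ y in 𝓝 z, f =ᶠ[𝓝 y] g := h.eventuallyEq_nhds
    filter_upwards [hf.2, h'] with y h1 h2
    exact (vd_congr h2).symm.trans h1⟩
  P_zero z := ⟨VGerm.zero _, Eventually.of_forall fun y => vd_zero y⟩
  P_add := fun {n f g z} hf hg => ⟨VGerm.add hf.1 hg.1, by
    filter_upwards [hf.1.eventually, hg.1.eventually, hf.2, hg.2] with y h1 h2 h3 h4
    exact (vd_add h1 h2).trans (by rw [h3, h4, add_zero])⟩
  P_neg := fun {n f z} hf => ⟨VGerm.neg hf.1, by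
    filter_upwards [hf.1.eventually, hf.2] with y h1 h2
    have := (vd_add h1 h1.neg).symm
    simp only [add_neg_cancel] at this
    rw [h2, zero_add] at this
    exact this.trans (vd_zero y)⟩
  P_pull := fun {m n} θ {f z} hf => ⟨VGerm.pullback (mSmooth_faceG θ) (mSmooth_act θ) hf.1, by
      have ht := ((simpSpace D G E M).map θ.op).hom.continuous.tendsto z
      filter_upwards [ht.eventually hf.2, ht.eventually hf.1.eventually] with y hy hy'
      refine (vd_pullback (B' := Fin m.len → G) (ω := f)
        (φ := fun y : (Fin n.len → G) × M => actG θ y.1 • y.2)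
        (mSmooth_act (D := D) θ) hy').trans ?_
      have hy2 : vd (B := Fin m.len → G) (X := M) f (faceG θ y.1, actG θ y.1 • y.2) = 0 := hy
      exact congrArg (fun k : E [⋀^Fin (q + 1)]→ₗ[ℝ] ℝ =>
        k.compLinearMap (mderiv E E (fun x : M => actG θ y.1 • x) y.2)) hy2⟩

end Concrete

section Hyper

/-- The derived category of simplicial sheaves is the localization of the complexes at the
quasi-isomorphisms. -/
noncomputable instance (X : SimplicialObject TopCat.{u}) : HasDerivedCategory (AbSheaf X) :=
  HasDerivedCategory.standard _

variable {X : SimplicialObject TopCat.{u}}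

/-- The constant simplicial sheaf `ℤ`. A morphism `ℤ → F` is a global section of `F`, that is a
compatible family of global sections over all levels. -/
noncomputable def constZ (X : SimplicialObject TopCat.{u}) : AbSheaf X :=
  (constantSheaf (SOpen.topology X) AddCommGrpCat.{u}).obj (AddCommGrpCat.of (ULift.{u} ℤ))

/-- The object of the derived category given by a complex of simplicial sheaves in degrees `≥ 0`. -/
noncomputable def toDerived (X : SimplicialObject TopCat.{u}) :
    CochainComplex (AbSheaf X) ℕ ⥤ DerivedCategory (AbSheaf X) :=
  ComplexShape.embeddingUpNat.extendFunctor (AbSheaf X) ⋙ DerivedCategory.Q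

/-- Hypercohomology `H^m(X, K)` of a simplicial space with coefficients in a complex of simplicial
sheaves: the derived functors of global sections, `Hom_D(ℤ, K[m])`. -/
abbrev HypCoh (K : CochainComplex (AbSheaf X) ℕ) (m : ℕ) :=
  ShiftedHom ((DerivedCategory.singleFunctor (AbSheaf X) 0).obj (constZ X))
    ((toDerived X).obj K) (m : ℤ)

/-- The map on hypercohomology induced by a morphism of complexes. -/
noncomputable def HypCoh.map {K L : CochainComplex (AbSheaf X) ℕ} (f : K ⟶ L) (m : ℕ) :
    HypCoh K m →+ HypCoh L m :=
  AddMonoidHom.mk' (fun c => c ≫ ((toDerived X).map f)⟦(m : ℤ)⟧') fun c c' => by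
    rw [Preadditive.add_comp]

/-- The restriction of a global section `ℤ → F` to an open subset. -/
noncomputable def evalZ {F : AbSheaf X} (s : constZ X ⟶ F) (A : SOpen X) :
    F.obj.obj (op A) :=
  (((sheafificationAdjunction (SOpen.topology X) AddCommGrpCat.{u}).homEquiv _ _ s).app (op A)).hom
    (ULift.up (1 : ℤ) : ULift.{u} ℤ)

theorem evalZ_map {F : AbSheaf X} (s : constZ X ⟶ F) {A B : SOpen X} (f : A ⟶ B) :
    F.obj.map f.op (evalZ s B) = evalZ s A := by
  have h := ((sheafificationAdjunction (SOpen.topology X) AddCommGrpCat.{u}).homEquiv _ _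
    s).naturality f.op
  exact (ConcreteCategory.congr_hom h (ULift.up (1 : ℤ) : ULift.{u} ℤ)).symm

theorem homEquiv_add {P : (SOpen X)ᵒᵖ ⥤ AddCommGrpCat.{u}} {F : AbSheaf X}
    (s t : (presheafToSheaf (SOpen.topology X) AddCommGrpCat.{u}).obj P ⟶ F) :
    (sheafificationAdjunction (SOpen.topology X) AddCommGrpCat.{u}).homEquiv P F (s + t) =
      (sheafificationAdjunction (SOpen.topology X) AddCommGrpCat.{u}).homEquiv P F s +
        (sheafificationAdjunction (SOpen.topology X) AddCommGrpCat.{u}).homEquiv P F t := by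
  rw [Adjunction.homEquiv_unit, Adjunction.homEquiv_unit, Adjunction.homEquiv_unit,
    Functor.map_add, Preadditive.comp_add]

theorem evalZ_add {F : AbSheaf X} (s t : constZ X ⟶ F) (A : SOpen X) :
    evalZ (s + t) A = evalZ s A + evalZ t A :=
  congrArg (fun φ : (Functor.const (SOpen X)ᵒᵖ).obj (AddCommGrpCat.of (ULift.{u} ℤ)) ⟶ F.obj =>
    (φ.app (op A)).hom (ULift.up (1 : ℤ) : ULift.{u} ℤ)) (homEquiv_add s t)

/-- The global section of `F` given by a class in `H^N` of the complex with `F` in degree `N` and `0`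
elsewhere. -/
noncomputable def singleHom (F : AbSheaf X) (N : ℕ)
    (c : HypCoh ((HomologicalComplex.single (AbSheaf X) (ComplexShape.up ℕ) N).obj F) N) :
    constZ X ⟶ F :=
  (DerivedCategory.singleFunctor (AbSheaf X) 0).preimage
    (c ≫ (DerivedCategory.Q.map (HomologicalComplex.extendSingleIso ComplexShape.embeddingUpNat
        F N (N : ℤ) rfl).hom)⟦(N : ℤ)⟧' ≫
      ((DerivedCategory.singleFunctors (AbSheaf X)).shiftIso (N : ℤ) 0 (N : ℤ)
        (add_zero _)).hom.app F)

theorem singleHom_add (F : AbSheaf X) (N : ℕ)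
    (c c' : HypCoh ((HomologicalComplex.single (AbSheaf X) (ComplexShape.up ℕ) N).obj F) N) :
    singleHom F N (c + c') = singleHom F N c + singleHom F N c' := by
  apply (DerivedCategory.singleFunctor (AbSheaf X) 0).map_injective
  rw [Functor.map_add]
  simp only [singleHom, Functor.map_preimage]
  rw [Preadditive.add_comp]

end Hyper

section Concrete2
variable (D : Type u) [AddCommGroup D] [Module ℝ D] [TopologicalSpace D]
  [IsTopologicalAddGroup D] [ContinuousSMul ℝ D] [LocallyConvexSpace ℝ D] [T2Space D]
  (G : Type u) [TopologicalSpace G] [ChartedSpace D G] [Group G] [LCLieGroup D G]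
  (E : Type u) [AddCommGroup E] [Module ℝ E] [TopologicalSpace E]
  [IsTopologicalAddGroup E] [ContinuousSMul ℝ E] [LocallyConvexSpace ℝ E] [T2Space E]
  (M : Type u) [TopologicalSpace M] [ChartedSpace E M] [LCManifold E M]
  [MulAction G M] [LCSmoothAction D G E M]

/-- `(1/2πi) d log : 𝕋 → A¹_rel`. -/
noncomputable def homDlog {R : Prop} (hR : R) : FunSheaf.Hom (shT D G E M) (shA D G E M 1 R) where
  fn n f (z : (Fin n.len → G) × M) := vdlog (B := Fin n.len → G) (X := M) f z
  congr h := vdlog_congr h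
  P hf := ⟨TGerm.vdlog hf, Or.inl hR⟩
  add hf hg := vdlog_add hf hg
  nat {m n} θ {f _} hf :=
    vdlog_pullback (B' := Fin m.len → G) (D' := Fin m.len → D) (f := f) (β := faceG θ)
      (φ := fun y : (Fin n.len → G) × M => actG θ y.1 • y.2) (mSmooth_act (D := D) θ) hf

/-- `d : A^q_rel → A^{q+1}_rel`. -/
noncomputable def homD (q : ℕ) (R' : Prop) {R : Prop} (hR : R) :
    FunSheaf.Hom (shA D G E M q R') (shA D G E M (q + 1) R) where
  fn n f (z : (Fin n.len → G) × M) := vd (B := Fin n.len → G) (X := M) f z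
  congr h := vd_congr h
  P hf := ⟨VGerm.vd hf.1, Or.inl hR⟩
  add hf hg := vd_add hf.1 hg.1
  nat {m n} θ {f _} hf :=
    vd_pullback (B' := Fin m.len → G) (D' := Fin m.len → D) (ω := f) (β := faceG θ)
      (φ := fun y : (Fin n.len → G) × M => actG θ y.1 • y.2) (mSmooth_act (D := D) θ) hf.1

/-- `(1/2πi) d log : 𝕋 → A¹_{rel,cl}`. -/
noncomputable def homDlogCl : FunSheaf.Hom (shT D G E M) (shAcl D G E M 1) where
  fn n f (z : (Fin n.len → G) × M) := vdlog (B := Fin n.len → G) (X := M) f z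
  congr h := vdlog_congr h
  P hf := ⟨TGerm.vdlog hf, (TGerm.eventually hf).mono fun _ hy => vd_vdlog hy⟩
  add hf hg := vdlog_add hf hg
  nat {m n} θ {f _} hf :=
    vdlog_pullback (B' := Fin m.len → G) (D' := Fin m.len → D) (f := f) (β := faceG θ)
      (φ := fun y : (Fin n.len → G) × M => actG θ y.1 • y.2) (mSmooth_act (D := D) θ) hf

/-- `d : A^q_rel → A^{q+1}_{rel,cl}`. -/
noncomputable def homDCl (q : ℕ) (R : Prop) :
    FunSheaf.Hom (shA D G E M q R) (shAcl D G E M (q + 1)) where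
  fn n f (z : (Fin n.len → G) × M) := vd (B := Fin n.len → G) (X := M) f z
  congr h := vd_congr h
  P hf := ⟨VGerm.vd hf.1, hf.1.eventually.mono fun _ hy => vd_vd hy⟩
  add hf hg := vd_add hf.1 hg.1
  nat {m n} θ {f _} hf :=
    vd_pullback (B' := Fin m.len → G) (D' := Fin m.len → D) (ω := f) (β := faceG θ)
      (φ := fun y : (Fin n.len → G) × M => actG θ y.1 • y.2) (mSmooth_act (D := D) θ) hf.1

/-- The inclusion `π⁻¹𝕋 → 𝕋`. -/
noncomputable def homPi : FunSheaf.Hom (shPiT D G E M) (shT D G E M) where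
  fn _ f z := f z
  congr h := h.eq_of_nhds
  P {n f z} hf := by
    obtain ⟨h, hh, hf⟩ := hf
    exact TGerm.congr hf.symm (TGerm.comp (φ := fun y : (Fin n.len → G) × M => y.1) mSmooth_fst hh)
  add _ _ := rfl
  nat {_ _} _ {_f _z} _ := rfl

/-- The terms of the complex `F̄(N)`: `𝕋` in degree `0`, `A^k_rel` in degrees `1 ≤ k ≤ N`, and `0` in
degrees `k > N`. -/
noncomputable def delX (N : ℕ) : ℕ → FunSheaf (simpSpace D G E M)
  | 0 => shT D G E M
  | k + 1 => shA D G E M (k + 1) (k + 1 ≤ N)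

/-- The differentials of the complex `F̄(N)`. -/
noncomputable def delD (N : ℕ) : ∀ k, FunSheaf.Hom (delX D G E M N k) (delX D G E M N (k + 1))
  | 0 => if h : 1 ≤ N then homDlog D G E M h else FunSheaf.Hom.zero _ _
  | k + 1 => if h : k + 2 ≤ N then homD D G E M (k + 1) (k + 1 ≤ N) h else FunSheaf.Hom.zero _ _

theorem delD_zero {N : ℕ} (h : 1 ≤ N) : delD D G E M N 0 = homDlog D G E M h := dif_pos h

theorem delD_succ {N k : ℕ} (h : k + 2 ≤ N) :
    delD D G E M N (k + 1) = homD D G E M (k + 1) (k + 1 ≤ N) h := dif_pos h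

theorem delD_of_lt {N k : ℕ} (h : N < k + 1) : delD D G E M N k = FunSheaf.Hom.zero _ _ := by
  cases k with
  | zero => exact dif_neg (by omega)
  | succ k => exact dif_neg (by omega)

theorem delD_comp (N k : ℕ) :
    (delD D G E M N k).toSheafHom ≫ (delD D G E M N (k + 1)).toSheafHom = 0 := by
  refine FunSheaf.Hom.comp_eq_zero _ _ ?_
  intro n f z hf
  rcases le_or_gt (k + 2) N with h2 | h2
  · rw [delD_succ D G E M h2]
    cases k with
    | zero =>
      rw [delD_zero D G E M (by omega)]
      exact vd_vdlog hf
    | succ k =>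
      rw [delD_succ D G E M (by omega)]
      exact vd_vd hf.1
  · rw [delD_of_lt D G E M h2]
    rfl

/-- The complex `F̄(N) = (𝕋 → A¹_rel → ⋯ → A^N_rel)` of simplicial sheaves on `G^• × M`, with
differentials `(1/2πi) d log, d, …, d`. -/
noncomputable def delComplex (N : ℕ) : CochainComplex (AbSheaf (simpSpace D G E M)) ℕ :=
  CochainComplex.of (fun k => (delX D G E M N k).toSheaf)
    (fun k => (delD D G E M N k).toSheafHom) (delD_comp D G E M N)

theorem delComplex_d (N k : ℕ) :
    (delComplex D G E M N).d k (k + 1) = (delD D G E M N k).toSheafHom :=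
  CochainComplex.of_d (fun k => (delX D G E M N k).toSheaf)
    (fun k => (delD D G E M N k).toSheafHom) k

/-- The sheaf `π⁻¹𝕋` as a complex in degree `0`. -/
noncomputable def piTComplex : CochainComplex (AbSheaf (simpSpace D G E M)) ℕ :=
  (CochainComplex.single₀ _).obj (shPiT D G E M).toSheaf

/-- The complex `0 → ⋯ → 0 → A^{N+1}_{rel,cl}` with the sheaf in degree `N`. -/
noncomputable def aclComplex (N : ℕ) : CochainComplex (AbSheaf (simpSpace D G E M)) ℕ :=
  (HomologicalComplex.single _ _ N).obj (shAcl D G E M (N + 1)).toSheaf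

theorem vdlog_pi {B : Type u} {h : B → TVal.{u}} {z : B × M} :
    vdlog (E := E) (fun y : B × M => h y.1) z = 0 := by
  have hd : dlogL (fun _ : E => (h z.1).toC) (chartAt E z.2 z.2) = 0 := by
    ext v
    rw [dlogL_apply isOpen_univ (CkOn.const 1 _ univ) (mem_univ _),
      (hasDirDeriv_const ((h z.1).toC) (chartAt E z.2 z.2) (v 0)).eq]
    simp
  exact hd

theorem homPi_comp (N : ℕ) : (homPi D G E M).toSheafHom ≫ (delD D G E M N 0).toSheafHom = 0 := by
  refine FunSheaf.Hom.comp_eq_zero _ _ ?_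
  rintro n f z ⟨h, hh, hf⟩
  rcases le_or_gt 1 N with h1 | h1
  · rw [delD_zero D G E M h1]
    exact (vdlog_congr hf).trans (vdlog_pi E M)
  · rw [delD_of_lt D G E M h1]
    rfl

/-- The inclusion `π⁻¹𝕋 → F̄(N)`. -/
noncomputable def piToDel (N : ℕ) : piTComplex D G E M ⟶ delComplex D G E M N :=
  HomologicalComplex.mkHomFromSingle (homPi D G E M).toSheafHom (by
    rintro _ rfl
    exact (congrArg _ (delComplex_d D G E M N 0)).trans (homPi_comp D G E M N))

/-- The exterior derivative from the degree `N` term of `F̄(N)` to `A^{N+1}_{rel,cl}`; for `N = 0` it is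
`(1/2πi) d log`. -/
noncomputable def curvHom : ∀ N : ℕ,
    FunSheaf.Hom (delX D G E M N N) (shAcl D G E M (N + 1))
  | 0 => homDlogCl D G E M
  | k + 1 => homDCl D G E M (k + 1) (k + 1 ≤ k + 1)

theorem delD_curv (k : ℕ) : (delD D G E M (k + 1) k).toSheafHom ≫
    (curvHom D G E M (k + 1)).toSheafHom = 0 := by
  refine FunSheaf.Hom.comp_eq_zero _ _ ?_
  intro n f z hf
  cases k with
  | zero =>
    rw [delD_zero D G E M (le_refl 1)]
    exact vd_vdlog hf
  | succ k =>
    rw [delD_succ D G E M (le_refl (k + 2))]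
    exact vd_vd hf.1

/-- The morphism `d` from `F̄(N)` to `A^{N+1}_{rel,cl}` in degree `N`. -/
noncomputable def delToAcl (N : ℕ) : delComplex D G E M N ⟶ aclComplex D G E M N :=
  HomologicalComplex.mkHomToSingle (curvHom D G E M N).toSheafHom (by
    rintro k rfl
    exact (congrArg (· ≫ _) (delComplex_d D G E M (k + 1) k)).trans (delD_curv D G E M k))

end Concrete2

section Final
variable (D : Type u) [AddCommGroup D] [Module ℝ D] [TopologicalSpace D]
  [IsTopologicalAddGroup D] [ContinuousSMul ℝ D] [LocallyConvexSpace ℝ D] [T2Space D]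
  (G : Type u) [TopologicalSpace G] [ChartedSpace D G] [Group G] [LCLieGroup D G]
  (E : Type u) [AddCommGroup E] [Module ℝ E] [TopologicalSpace E]
  [IsTopologicalAddGroup E] [ContinuousSMul ℝ E] [LocallyConvexSpace ℝ E] [T2Space E]
  (M : Type u) [TopologicalSpace M] [ChartedSpace E M] [LCManifold E M]
  [MulAction G M] [LCSmoothAction D G E M]

theorem SmoothFormOn.univ_add {q : ℕ} {η η' : M → E [⋀^Fin q]→ₗ[ℝ] ℝ} (h : SmoothFormOn η univ)
    (h' : SmoothFormOn η' univ) : SmoothFormOn (fun x => η x + η' x) univ := fun e he =>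
  SmoothOn.add ((e.isOpen_inter_preimage_symm isOpen_univ).prod isOpen_univ) (h e he) (h' e he)

theorem SmoothFormOn.univ_neg {q : ℕ} {η : M → E [⋀^Fin q]→ₗ[ℝ] ℝ} (h : SmoothFormOn η univ) :
    SmoothFormOn (fun x => - η x) univ := fun e he =>
  SmoothOn.clm_comp ((e.isOpen_inter_preimage_symm isOpen_univ).prod isOpen_univ) (h e he)
    (-ContinuousLinearMap.id ℝ ℝ)

theorem extDM_zero {q : ℕ} (x : M) : extDM (fun _ : M => (0 : E [⋀^Fin q]→ₗ[ℝ] ℝ)) x = 0 :=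
  vd_zero (B := M) (x, x)

/-- `A^q(M)^G_cl`, the closed `G`-invariant smooth `q`-forms on `M`. -/
def invClosedForms (q : ℕ) : AddSubgroup (M → E [⋀^Fin q]→ₗ[ℝ] ℝ) where
  carrier := {η | SmoothFormOn η univ ∧ (∀ x, extDM η x = 0) ∧
    ∀ (g : G) (x : M), (η (g • x)).compLinearMap (mderiv E E (fun y : M => g • y) x) = η x}
  zero_mem' := ⟨fun _ _ => SmoothOn.const (0 : ℝ) _, fun x => extDM_zero E M x, fun _ _ => rfl⟩
  add_mem' {η η'} h h' := ⟨h.1.univ_add E M h'.1, fun x => by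
      refine (extDM_add isOpen_univ h.1 h'.1 (mem_univ x)).trans ?_
      rw [h.2.1, h'.2.1, add_zero], fun g x => by
      rw [Pi.add_apply, Pi.add_apply, AlternatingMap.add_compLinearMap, h.2.2, h'.2.2]⟩
  neg_mem' {η} h := ⟨h.1.univ_neg E M, fun x => by
      have h1 := extDM_add isOpen_univ h.1 (h.1.univ_neg E M) (mem_univ x)
      simp only [add_neg_cancel] at h1
      rw [extDM_zero E M x, h.2.1, zero_add] at h1
      exact h1.symm, fun g x => by
      have := congrArg (fun k : E [⋀^Fin q]→ₗ[ℝ] ℝ => - k) (h.2.2 g x)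
      exact this⟩

variable {D G E M}

/-- a point of `M` in level zero -/
def pt0 (G : Type u) {M : Type u} (x : M) :
    (Fin (SimplexCategory.mk 0).len → G) × M := (fun i => Fin.elim0 i, x)

/-- the form on `M` of a global section of the sheaf of closed vertical forms -/
noncomputable def sectionForm {q : ℕ} (s : constZ (simpSpace D G E M) ⟶ (shAcl D G E M q).toSheaf)
    (x : M) : E [⋀^Fin q]→ₗ[ℝ] ℝ :=
  ((evalZ s ⟨SimplexCategory.mk 0, ⊤⟩ : (shAcl D G E M q).sec ⟨SimplexCategory.mk 0, ⊤⟩)).1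
    ⟨pt0 G x, trivial⟩

theorem sectionForm_mem {q : ℕ} (s : constZ (simpSpace D G E M) ⟶ (shAcl D G E M q).toSheaf) :
    sectionForm s ∈ invClosedForms G E M q := by
  let A : ∀ n : SimplexCategory, SOpen (simpSpace D G E M) := fun n => ⟨n, ⊤⟩
  let t : ∀ n : SimplexCategory, (shAcl D G E M q).sec (A n) := fun n => evalZ s (A n)
  let η : (Fin (SimplexCategory.mk 0).len → G) × M → E [⋀^Fin q]→ₗ[ℝ] ℝ := ext0 (t (.mk 0)).1
  have hη : ∀ x, η (pt0 G x) = sectionForm s x := fun x => dif_pos trivial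
  have hP : ∀ x, VGerm (Fin (SimplexCategory.mk 0).len → D) η (pt0 G x) ∧
      vd η =ᶠ[𝓝 (pt0 G x)] fun _ => 0 := fun x => (t (.mk 0)).2 (pt0 G x) trivial
  have hs : sectionForm s = fun x => η ((pt0 G x).1, x) := funext fun x => (hη x).symm
  refine ⟨fun e he => SmoothOn.of_local ?_, fun x => ?_, fun g x => ?_⟩
  · rintro ⟨y, v⟩ ⟨⟨hy, -⟩, -⟩
    obtain ⟨O, hO, hx, hsm⟩ := (hP (e.symm y)).1
    have h1 := hsm.slice hO (pt0 G (e.symm y)).1 e he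
    refine ⟨_, (e.isOpen_inter_preimage_symm (hO.preimage
      (continuous_const.prodMk continuous_id))).prod isOpen_univ,
      ⟨⟨hy, hx⟩, trivial⟩, ?_⟩
    rw [hs]
    exact h1
  · have h1 := (hP x).2.eq_of_nhds
    rw [hs]
    exact h1
  · let z : (Fin (SimplexCategory.mk 1).len → G) × M := (fun _ => g, x)
    have key : ∀ θ : SimplexCategory.mk 0 ⟶ SimplexCategory.mk 1,
        (t (.mk 1)).1 ⟨z, trivial⟩ = (sectionForm s (actG θ z.1 • x)).compLinearMap
          (mderiv E E (fun y : M => actG θ z.1 • y) x) := by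
      intro θ
      let f : A (.mk 1) ⟶ A (.mk 0) := ⟨θ, fun _ _ => trivial⟩
      have h1 := congrFun (congrArg Subtype.val (evalZ_map s f :
        (shAcl D G E M q).res f (t (.mk 0)) = t (.mk 1))) ⟨z, trivial⟩
      rw [← h1]
      change ((t (.mk 0)).1 ⟨(faceG θ z.1, actG θ z.1 • x), _⟩).compLinearMap _ = _
      have h2 : (faceG θ z.1, actG θ z.1 • x) = pt0 G (actG θ z.1 • x) :=
        Prod.ext (funext fun i => Fin.elim0 i) rfl
      have h3 : ∀ (w : (Fin (SimplexCategory.mk 0).len → G) × M) (hw : w ∈ (A (.mk 0)).carrier),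
          w = pt0 G (actG θ z.1 • x) → (t (.mk 0)).1 ⟨w, hw⟩ = sectionForm s (actG θ z.1 • x) := by
        rintro w hw rfl
        rfl
      exact congrArg (fun k : E [⋀^Fin q]→ₗ[ℝ] ℝ =>
        k.compLinearMap (mderiv E E (fun y : M => actG θ z.1 • y) x)) (h3 _ _ h2)
    have k0 := key (SimplexCategory.δ 0)
    have k1 := key (SimplexCategory.δ 1)
    have a0 : actG (SimplexCategory.δ 0 : SimplexCategory.mk 0 ⟶ SimplexCategory.mk 1) z.1 = 1 := by
      change (Fin.partialProd _ 1)⁻¹ * Fin.partialProd _ 1 = 1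
      simp
    have a1 : actG (SimplexCategory.δ 1 : SimplexCategory.mk 0 ⟶ SimplexCategory.mk 1) z.1 = g := by
      change (Fin.partialProd z.1 (0 : Fin 2))⁻¹ * Fin.partialProd z.1 (Fin.succ (0 : Fin 1)) = g
      rw [Fin.partialProd_succ]
      simp [z]
    rw [k0, a0] at k1
    rw [a1] at k1
    rw [← k1]
    simp only [one_smul, mderiv_id]
    rfl

variable (D G E M)

/-- The canonical homomorphism `H^N(0 → ⋯ → 0 → A^{N+1}_{rel,cl}) → A^{N+1}(M)^G_cl`: it takes the
global section of `A^{N+1}_{rel,cl}` given by a class to its value on level zero, a form on `M`. -/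
noncomputable def evalAcl (N : ℕ) :
    HypCoh (aclComplex D G E M N) N →+ invClosedForms G E M (N + 1) :=
  AddMonoidHom.mk' (fun c => ⟨sectionForm (singleHom _ N c), sectionForm_mem _⟩) fun c c' => by
    refine Subtype.ext (funext fun x => ?_)
    have h1 := (congrArg (fun s => evalZ s ⟨SimplexCategory.mk 0, ⊤⟩) (singleHom_add _ N c c')).trans
      (evalZ_add (singleHom (shAcl D G E M (N + 1)).toSheaf N c) (singleHom _ N c')
        ⟨SimplexCategory.mk 0, ⊤⟩)
    exact congrArg (fun t : (shAcl D G E M (N + 1)).sec ⟨SimplexCategory.mk 0, ⊤⟩ =>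
      t.1 ⟨pt0 G x, trivial⟩) h1

/-- The homomorphism `d : H^N(G^• × M, F̄(N)) → A^{N+1}(M)^G_cl`, induced by the exterior derivative
from `F̄(N)` to `A^{N+1}_{rel,cl}` in degree `N`. -/
noncomputable def curvature (N : ℕ) :
    HypCoh (delComplex D G E M N) N →+ invClosedForms G E M (N + 1) :=
  (evalAcl D G E M N).comp (HypCoh.map (delToAcl D G E M N) N)

end Final

end EqDeligne

open EqDeligne

/-!
The proof rests on a fibrewise Poincaré lemma: on every level `G^p × M` a relative closed form is
locally the relative differential of a relative form of one degree less (`exists_vd_eq`), a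
relative closed `1`-form is locally `(1 / 2πi) d log` of a `𝕋`-valued function
(`exists_vdlog_eq`), and a `𝕋`-valued function whose relative `d log` vanishes is locally a
function of the base point (`exists_eq_comp_fst`). In a chart with convex image in the fibre
direction the potential is given by the radial homotopy operator (`radial`, `extD_radial`). Its
integrals over `[0, 1]` are integrals of continuous real-valued functions, so no completeness of
the model spaces is needed, and they may be differentiated under the integral sign because a map
of class `C¹` in the sense of Michal and Bastiani is strictly differentiable along lines
(`hasDirDeriv_integral`).

Exactness of simplicial sheaves can be tested on germs (`FunSheaf.Hom.exact`, `FunSheaf.Hom.epi`),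
so `0 → π⁻¹𝕋 → 𝕋 → A¹_rel → ⋯ → Aᴺ_rel → Aᴺ⁺¹_rel,cl → 0` is exact. Hence `π⁻¹𝕋` is
quasi-isomorphic to the kernel of the epimorphism `F̄(N) → Aᴺ⁺¹_rel,cl[-N]`, and this gives a
distinguished triangle (`exists_distinguished_of_resolution`, `exists_distinguished_piToDel`).

Everything else is read off from its long exact sequence of hypercohomology groups. The groups
`Hᵐ(Aᴺ⁺¹_rel,cl[-N])` vanish for `m < N` (`shiftedHom_single_eq_zero`). For `m = N` the group
consists of the global sections of `Aᴺ⁺¹_rel,cl`. Such a section is determined by a form on level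
`0`, because every object of the simplex category has a vertex, and the two face maps `G × M → M`
say that this form is invariant; therefore the evaluation map to invariant closed forms is
bijective (`evalAcl_bijective`) and `δ` is `b_*` composed with its inverse.
-/

namespace EqDeligne

/-! ### The distinguished triangle of a resolution -/

section ResolutionTriangle

open CategoryTheory.Limits

variable {C : Type*} [Category* C] [Abelian C]
  {F : CochainComplex C ℕ} {A B : C} {N : ℕ}

theorem single₀_comp_single_eq_zero (hN : N ≠ 0)
    (f : (CochainComplex.single₀ C).obj A ⟶ F)
    (g : F ⟶ (HomologicalComplex.single C (ComplexShape.up ℕ) N).obj B) : f ≫ g = 0 := by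
  refine HomologicalComplex.hom_ext _ _ fun k => ?_
  by_cases hk : k = N
  · exact (HomologicalComplex.isZero_single_obj_X (ComplexShape.up ℕ) 0 A k
      (hk ▸ hN)).eq_of_src _ _
  · exact (HomologicalComplex.isZero_single_obj_X (ComplexShape.up ℕ) N B k hk).eq_of_tgt _ _

/-- Suppose that `A` in degree `0` resolves the kernel of `g : F ⟶ B[-N]`, that is,
`0 → A → F⁰ → ⋯ → Fᴺ → B → 0` is exact and `F` vanishes above degree `N`. Then `A[0]` is
quasi-isomorphic to the kernel of `g`. -/
theorem quasiIso_kernel_lift (hN : N ≠ 0)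
    (f : (CochainComplex.single₀ C).obj A ⟶ F)
    (g : F ⟶ (HomologicalComplex.single C (ComplexShape.up ℕ) N).obj B)
    (w0 : f.f 0 ≫ F.d 0 1 = 0) (hf : Mono (f.f 0))
    (h0 : (ShortComplex.mk (f.f 0) (F.d 0 1) w0).Exact)
    (hk : ∀ k, k + 1 < N →
      (ShortComplex.mk (F.d k (k + 1)) (F.d (k + 1) (k + 2)) (F.d_comp_d _ _ _)).Exact)
    (hlast : ∀ k, k + 1 = N → ∀ w : F.d k (k + 1) ≫ g.f (k + 1) = 0,
      (ShortComplex.mk (F.d k (k + 1)) (g.f (k + 1)) w).Exact)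
    (hz : ∀ k, N < k → IsZero (F.X k)) :
    QuasiIso (kernel.lift g f (single₀_comp_single_eq_zero hN f g)) := by
  let S : ShortComplex (CochainComplex C ℕ) :=
    ShortComplex.mk (kernel.ι g) g (kernel.condition g)
  have hS : S.Exact := ShortComplex.exact_of_f_is_kernel _ (kernelIsKernel g)
  have hSk : ∀ k, (S.map (HomologicalComplex.eval C _ k)).Exact := fun k => hS.map _
  have hm : ∀ k, Mono ((kernel.ι g).f k) := fun k =>
    inferInstanceAs (Mono ((HomologicalComplex.eval C _ k).map (kernel.ι g)))
  have hlift : ∀ k {T : C} (x : T ⟶ F.X k), x ≫ g.f k = 0 →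
      ∃ y : T ⟶ (kernel g).X k, y ≫ (kernel.ι g).f k = x := fun k T x hx => by
    have : Mono (S.map (HomologicalComplex.eval C _ k)).f := hm k
    exact ⟨(hSk k).lift x hx, (hSk k).lift_f x hx⟩
  have hzero : ∀ k, k ≠ N → ∀ {T : C} (x : T ⟶ F.X k), x ≫ g.f k = 0 := fun k hk T x =>
    (HomologicalComplex.isZero_single_obj_X (ComplexShape.up ℕ) N B k hk).eq_of_tgt _ _
  set q := kernel.lift g f (single₀_comp_single_eq_zero hN f g) with hq
  have hqf : q ≫ kernel.ι g = f := kernel.lift_ι _ _ _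
  have hqf' : ∀ k, q.f k ≫ (kernel.ι g).f k = f.f k := fun k => by
    rw [← hqf]; rfl
  refine ⟨fun n => ?_⟩
  cases n with
  | zero =>
    rw [CochainComplex.quasiIsoAt₀_iff, ShortComplex.quasiIso_iff_of_zeros _ rfl rfl
      ((kernel g).shape _ _ (by simp))]
    refine ⟨?_, ?_⟩
    · rw [ShortComplex.exact_iff_exact_up_to_refinements]
      intro T (x : T ⟶ (kernel g).X 0) hx
      have hx' : x ≫ (kernel g).d 0 1 = 0 := hx
      have hx2 : (x ≫ (kernel.ι g).f 0) ≫ F.d 0 1 = 0 := by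
        rw [Category.assoc, (kernel.ι g).comm, reassoc_of% hx', zero_comp]
      obtain ⟨T', π, hπ, y, hy⟩ := h0.exact_up_to_refinements (x ≫ (kernel.ι g).f 0) hx2
      have e : π ≫ x = y ≫ q.f 0 := by
        have := hm 0
        rw [← cancel_mono ((kernel.ι g).f 0), Category.assoc, Category.assoc, hqf' 0]
        exact hy
      exact ⟨T', π, hπ, y, e⟩
    · have : Mono (q.f 0 ≫ (kernel.ι g).f 0) := by rw [hqf']; exact hf
      exact mono_of_mono (q.f 0) ((kernel.ι g).f 0)
  | succ k =>
    rw [quasiIsoAt_iff_exactAt]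
    · rw [HomologicalComplex.exactAt_iff' _ k (k + 1) (k + 2) (by simp) (by simp),
        ShortComplex.exact_iff_exact_up_to_refinements]
      intro T (x : T ⟶ (kernel g).X (k + 1)) hx
      have hx' : x ≫ (kernel g).d (k + 1) (k + 2) = 0 := hx
      have hm1 := hm (k + 1)
      -- it suffices to lift along the differential of `F`, because `g` vanishes in degree `k < N`
      have main : ∃ (T' : C) (π : T' ⟶ T) (_ : Epi π) (y : T' ⟶ F.X k), y ≫ g.f k = 0 ∧
          π ≫ x ≫ (kernel.ι g).f (k + 1) = y ≫ F.d k (k + 1) := by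
        rcases lt_trichotomy (k + 1) N with h | h | h
        · obtain ⟨T', π, hπ, y, hy⟩ := (hk k h).exact_up_to_refinements
            (x ≫ (kernel.ι g).f (k + 1)) (by
              change (x ≫ (kernel.ι g).f (k + 1)) ≫ F.d (k + 1) (k + 2) = 0
              rw [Category.assoc, (kernel.ι g).comm, reassoc_of% hx', zero_comp])
          exact ⟨T', π, hπ, y, hzero k (by omega) y, by simpa using hy⟩
        · have w : F.d k (k + 1) ≫ g.f (k + 1) = 0 := by
            rw [← g.comm, (HomologicalComplex.isZero_single_obj_X (ComplexShape.up ℕ) N B k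
              (by omega)).eq_of_tgt (g.f k) 0, zero_comp]
          obtain ⟨T', π, hπ, y, hy⟩ := (hlast k h w).exact_up_to_refinements
            (x ≫ (kernel.ι g).f (k + 1)) (by
              change (x ≫ (kernel.ι g).f (k + 1)) ≫ g.f (k + 1) = 0
              rw [Category.assoc, ← HomologicalComplex.comp_f, kernel.condition]
              simp)
          exact ⟨T', π, hπ, y, hzero k (by omega) y, by simpa using hy⟩
        · exact ⟨T, 𝟙 T, inferInstance, 0, by simp, (hz (k + 1) h).eq_of_tgt _ _⟩
      obtain ⟨T', π, hπ, y, hy, hxy⟩ := main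
      obtain ⟨y', hy'⟩ := hlift k y hy
      have e : π ≫ x = y' ≫ (kernel g).d k (k + 1) := by
        rw [← cancel_mono ((kernel.ι g).f (k + 1)), Category.assoc, hxy, Category.assoc,
          ← (kernel.ι g).comm, reassoc_of% hy']
      exact ⟨T', π, hπ, y', e⟩
    · exact HomologicalComplex.exactAt_single_obj _ _ _ _ (by simp)

/-- Extension of complexes from `ℕ` to `ℤ` preserves short exact sequences. -/
theorem shortExact_extend {S : ShortComplex (CochainComplex C ℕ)} (hS : S.ShortExact) :
    (S.map (ComplexShape.embeddingUpNat.extendFunctor C)).ShortExact := by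
  refine HomologicalComplex.shortExact_of_degreewise_shortExact _ fun i => ?_
  by_cases hi : ∃ k, ComplexShape.embeddingUpNat.f k = i
  · obtain ⟨k, hk⟩ := hi
    refine ShortComplex.shortExact_of_iso (ShortComplex.isoMk
      (S₁ := S.map (HomologicalComplex.eval C _ k))
      (S.X₁.extendXIso _ hk).symm (S.X₂.extendXIso _ hk).symm (S.X₃.extendXIso _ hk).symm ?_ ?_)
      (hS.map_of_exact _)
    · change _ ≫ (HomologicalComplex.extendMap S.f _).f i = _
      rw [HomologicalComplex.extendMap_f _ _ hk]
      exact Iso.inv_hom_id_assoc _ _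
    · change _ ≫ (HomologicalComplex.extendMap S.g _).f i = _
      rw [HomologicalComplex.extendMap_f _ _ hk]
      exact Iso.inv_hom_id_assoc _ _
  · have hz : ∀ K : CochainComplex C ℕ,
        IsZero ((K.extend ComplexShape.embeddingUpNat).X i) := fun K =>
      K.isZero_extend_X _ i fun k hk => hi ⟨k, hk⟩
    exact { exact := ShortComplex.exact_of_isZero_X₂ _ (hz _)
            mono_f := ⟨fun _ _ _ => (hz S.X₁).eq_of_tgt _ _⟩
            epi_g := ⟨fun _ _ _ => (hz S.X₃).eq_of_src _ _⟩ }

/-- An exact sequence `0 → A → F⁰ → ⋯ → Fᴺ → B → 0` gives a distinguished triangle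
`A → F → B[-N] → A[1]`. -/
theorem exists_distinguished_of_resolution [HasDerivedCategory C] (hN : N ≠ 0)
    (f : (CochainComplex.single₀ C).obj A ⟶ F)
    (g : F ⟶ (HomologicalComplex.single C (ComplexShape.up ℕ) N).obj B)
    (w0 : f.f 0 ≫ F.d 0 1 = 0) (hf : Mono (f.f 0))
    (h0 : (ShortComplex.mk (f.f 0) (F.d 0 1) w0).Exact)
    (hk : ∀ k, k + 1 < N →
      (ShortComplex.mk (F.d k (k + 1)) (F.d (k + 1) (k + 2)) (F.d_comp_d _ _ _)).Exact)
    (hlast : ∀ k, k + 1 = N → ∀ w : F.d k (k + 1) ≫ g.f (k + 1) = 0,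
      (ShortComplex.mk (F.d k (k + 1)) (g.f (k + 1)) w).Exact)
    (hz : ∀ k, N < k → IsZero (F.X k)) (hg : Epi (g.f N)) :
    ∃ b, Pretriangulated.Triangle.mk
      ((ComplexShape.embeddingUpNat.extendFunctor C ⋙ DerivedCategory.Q).map f)
      ((ComplexShape.embeddingUpNat.extendFunctor C ⋙ DerivedCategory.Q).map g) b ∈
        Pretriangulated.distinguishedTriangles := by
  have hq := quasiIso_kernel_lift hN f g w0 hf h0 hk hlast hz
  set q := kernel.lift g f (single₀_comp_single_eq_zero hN f g) with hq'
  have hqf : q ≫ kernel.ι g = f := kernel.lift_ι _ _ _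
  have hge : Epi g := by
    have : ∀ k, Epi (g.f k) := fun k => by
      by_cases hk : k = N
      · rw [hk]; exact hg
      · exact ⟨fun _ _ _ =>
          (HomologicalComplex.isZero_single_obj_X (ComplexShape.up ℕ) N B k hk).eq_of_src _ _⟩
    exact HomologicalComplex.epi_of_epi_f g this
  let S : ShortComplex (CochainComplex C ℕ) :=
    ShortComplex.mk (kernel.ι g) g (kernel.condition g)
  have hS : S.ShortExact :=
    { exact := ShortComplex.exact_of_f_is_kernel _ (kernelIsKernel g)
      mono_f := inferInstanceAs (Mono (kernel.ι g))
      epi_g := hge }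
  have hSe := shortExact_extend hS
  have hT := DerivedCategory.triangleOfSES_distinguished hSe
  let Φ := ComplexShape.embeddingUpNat.extendFunctor C ⋙ DerivedCategory.Q
  have hqe : QuasiIso ((ComplexShape.embeddingUpNat.extendFunctor C).map q) :=
    inferInstanceAs (QuasiIso (HomologicalComplex.extendMap q _))
  have hqi : IsIso (Φ.map q) :=
    inferInstanceAs (IsIso (DerivedCategory.Q.map
      ((ComplexShape.embeddingUpNat.extendFunctor C).map q)))
  let e := @asIso _ _ _ _ (Φ.map q) hqi
  -- the triangle of `0 → kernel g → F → B[-N] → 0`, transported along the quasi-isomorphism `q`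
  refine ⟨DerivedCategory.triangleOfSESδ hSe ≫ e.inv⟦(1 : ℤ)⟧', ?_⟩
  refine Pretriangulated.isomorphic_distinguished _ hT _
    (Pretriangulated.Triangle.isoMk _ _ e (Iso.refl _) (Iso.refl _) ?_ ?_ ?_)
  · change Φ.map f ≫ 𝟙 _ = Φ.map q ≫ Φ.map (kernel.ι g)
    rw [Category.comp_id, ← Φ.map_comp, hqf]
  · change Φ.map g ≫ 𝟙 _ = 𝟙 _ ≫ Φ.map g
    simp
  · change (DerivedCategory.triangleOfSESδ hSe ≫ e.inv⟦(1 : ℤ)⟧') ≫ e.hom⟦1⟧' =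
      𝟙 _ ≫ DerivedCategory.triangleOfSESδ hSe
    have he : e.inv⟦(1 : ℤ)⟧' ≫ e.hom⟦(1 : ℤ)⟧' = 𝟙 _ := by
      rw [← Functor.map_comp, Iso.inv_hom_id, CategoryTheory.Functor.map_id]
    exact (Category.assoc _ _ _).trans
      ((congrArg (DerivedCategory.triangleOfSESδ hSe ≫ ·) he).trans
        ((Category.comp_id _).trans (Category.id_comp _).symm))

end ResolutionTriangle

/-! ### Long exact sequences of morphisms from a fixed object -/

section LongExactSequence

open Pretriangulated

variable {D : Type*} [Category* D] [HasShift D ℤ] [Limits.HasZeroObject D] [Preadditive D]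
  [∀ n : ℤ, (shiftFunctor D n).Additive] [Pretriangulated D]

/-- Exactness of `Hom(Z, T₁[n]) → Hom(Z, T₂[n]) → Hom(Z, T₃[n])`. -/
theorem exact_comp_mor₁_comp_mor₂ (T : Triangle D) (hT : T ∈ distTriang D) (Z : D) (n : ℤ) :
    Function.Exact (fun c : Z ⟶ T.obj₁⟦n⟧ => c ≫ T.mor₁⟦n⟧')
      (fun c : Z ⟶ T.obj₂⟦n⟧ => c ≫ T.mor₂⟦n⟧') :=
  (ShortComplex.ab_exact_iff_function_exact _).1
    ((preadditiveCoyoneda.obj (op Z)).homologySequence_exact₂ T hT n)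

/-- Exactness of `Hom(Z, T₂[n]) → Hom(Z, T₃[n]) → Hom(Z, T₁[n + 1])`. -/
theorem exact_comp_mor₂_comp_mor₃ (T : Triangle D) (hT : T ∈ distTriang D) (Z : D) (n n' : ℤ)
    (h : 1 + n = n') :
    Function.Exact (fun c : Z ⟶ T.obj₂⟦n⟧ => c ≫ T.mor₂⟦n⟧')
      (fun c : ShiftedHom Z T.obj₃ n => ShiftedHom.comp (Z := T.obj₁) c T.mor₃ h) := by
  have e : (fun c : ShiftedHom Z T.obj₃ n => ShiftedHom.comp (Z := T.obj₁) c T.mor₃ h) =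
      fun c => (preadditiveCoyoneda.obj (op Z)).homologySequenceδ T n n' (by omega) c :=
    funext fun c => (preadditiveCoyoneda_homologySequenceδ_apply T n n' (by omega) c).symm
  rw [e]
  exact (ShortComplex.ab_exact_iff_function_exact _).1
    ((preadditiveCoyoneda.obj (op Z)).homologySequence_exact₃ T hT n n' (by omega))

/-- Exactness of `Hom(Z, T₃[n]) → Hom(Z, T₁[n + 1]) → Hom(Z, T₂[n + 1])`. -/
theorem exact_comp_mor₃_comp_mor₁ (T : Triangle D) (hT : T ∈ distTriang D) (Z : D) (n n' : ℤ)
    (h : 1 + n = n') :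
    Function.Exact (fun c : ShiftedHom Z T.obj₃ n => ShiftedHom.comp (Z := T.obj₁) c T.mor₃ h)
      (fun c : Z ⟶ T.obj₁⟦n'⟧ => c ≫ T.mor₁⟦n'⟧') := by
  have e : (fun c : ShiftedHom Z T.obj₃ n => ShiftedHom.comp (Z := T.obj₁) c T.mor₃ h) =
      fun c => (preadditiveCoyoneda.obj (op Z)).homologySequenceδ T n n' (by omega) c :=
    funext fun c => (preadditiveCoyoneda_homologySequenceδ_apply T n n' (by omega) c).symm
  rw [e]
  exact (ShortComplex.ab_exact_iff_function_exact _).1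
    ((preadditiveCoyoneda.obj (op Z)).homologySequence_exact₁ T hT n n' (by omega))

/-- There are no morphisms from `Z` in degree `0` to `B[-N]` shifted by `m < N`. -/
theorem shiftedHom_single_eq_zero {C : Type*} [Category* C] [Abelian C] [HasDerivedCategory C]
    (Z B : C) {N : ℕ} {m : ℤ} (hm : m < N)
    (c : ShiftedHom ((DerivedCategory.singleFunctor C 0).obj Z)
      ((ComplexShape.embeddingUpNat.extendFunctor C ⋙ DerivedCategory.Q).obj
        ((HomologicalComplex.single C (ComplexShape.up ℕ) N).obj B)) m) : c = 0 := by
  let e := DerivedCategory.Q.mapIso (HomologicalComplex.extendSingleIso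
    ComplexShape.embeddingUpNat B N (N : ℤ) rfl)
  have h1 : DerivedCategory.TStructure.t.IsGE ((DerivedCategory.singleFunctor C (N : ℤ)).obj B)
    (N : ℤ) := inferInstanceAs (DerivedCategory.IsGE _ _)
  have h2 := DerivedCategory.TStructure.t.isGE_of_iso
    (((DerivedCategory.singleFunctorIsoCompQ C (N : ℤ)).app B).trans e.symm) (N : ℤ)
  have h3 := DerivedCategory.TStructure.t.isGE_shift (DerivedCategory.Q.obj
    (((HomologicalComplex.single C (ComplexShape.up ℕ) N).obj B).extend
      ComplexShape.embeddingUpNat)) (N : ℤ) m (N - m)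
  have h0 : DerivedCategory.TStructure.t.IsLE ((DerivedCategory.singleFunctor C 0).obj Z) 0 :=
    inferInstanceAs (DerivedCategory.IsLE _ _)
  exact DerivedCategory.TStructure.t.zero_of_isLE_of_isGE c 0 (N - m) (by omega) h0 h3

end LongExactSequence

/-! ### Exactness of sequences of simplicial sheaves of functions -/

namespace FunSheaf

variable {X : SimplicialObject TopCat.{u}} {S T R : FunSheaf X}

/-- The condition that defines the sections of `S` is an open condition. -/
def IsOpenCond (S : FunSheaf X) : Prop :=
  ∀ ⦃n : SimplexCategory⦄ ⦃f : X.obj (op n) → S.K⦄ ⦃z : X.obj (op n)⦄,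
    S.P n f z → ∀ᶠ y in 𝓝 z, S.P n f y

/-- A morphism that is surjective on germs is an epimorphism of simplicial sheaves. -/
theorem Hom.epi (φ : Hom S T) (hS : S.IsOpenCond)
    (hφ : ∀ {n : SimplexCategory} {f : X.obj (op n) → T.K} {z : X.obj (op n)}, T.P n f z →
      ∃ g, S.P n g z ∧ φ.fn n g =ᶠ[𝓝 z] f) : Epi φ.toSheafHom := by
  rw [← Sheaf.isLocallySurjective_iff_epi']
  refine ⟨fun {A} s => ?_⟩
  obtain ⟨n, U⟩ := A
  let t : T.sec ⟨n, U⟩ := s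
  have hloc : ∀ z : U, ∃ V : Opens (X.obj (op n)), z.1 ∈ V ∧ V ≤ U ∧
      ∃ g : X.obj (op n) → S.K, ∀ y ∈ V, S.P n g y ∧ φ.fn n g y = ext0 t.1 y := by
    rintro ⟨z, hz⟩
    obtain ⟨g, hg, hgf⟩ := hφ (t.2 z hz)
    obtain ⟨V, hV, hVo, hzV⟩ := eventually_nhds_iff.1 ((hS hg).and hgf)
    exact ⟨⟨V, hVo⟩ ⊓ U, ⟨hzV, hz⟩, inf_le_right, g, fun y hy => hV y hy.1⟩
  choose V hzV hVU g hg using hloc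
  have hle : ∀ W ∈ range V, W ≤ U := by rintro _ ⟨z, rfl⟩; exact hVU z
  have hmem : Sieve.generate (SOpen.coverPresieve (X := X) ⟨n, U⟩ (range V) hle) ∈
      SOpen.topology X ⟨n, U⟩ :=
    Coverage.Saturate.of _ _ ⟨range V, hle, fun z hz => ⟨V ⟨z, hz⟩, ⟨_, rfl⟩, hzV ⟨z, hz⟩⟩, rfl⟩
  refine (SOpen.topology X).superset_covering ?_ hmem
  rw [Sieve.generate_le_iff]
  rintro _ _ ⟨_, z, rfl⟩
  have hr : ∀ y ∈ V z, ext0 (fun y : V z => g z y) =ᶠ[𝓝 y] g z := fun y hy => by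
    filter_upwards [(V z).2.mem_nhds hy] with y' hy'
    exact ext0_of_mem _ hy'
  refine ⟨(⟨fun y => g z y, fun y hy => S.P_congr (hr y hy).symm (hg z y hy).1⟩ :
    S.sec ⟨n, V z⟩), ?_⟩
  refine Subtype.ext (funext fun y => ?_)
  refine (φ.congr (hr y.1 y.2)).trans ((hg z y.1 y.2).2.trans ?_)
  rw [ext0_of_mem _ (hVU z y.2)]
  exact (T.presheaf_map_incl (hVU z) t y.1 y.2).symm

/-- A morphism that is injective on values is a monomorphism of simplicial sheaves. -/
theorem Hom.mono (φ : Hom S T)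
    (hφ : ∀ {n : SimplexCategory} {f : X.obj (op n) → S.K} {z : X.obj (op n)}, S.P n f z →
      φ.fn n f z = 0 → f z = 0) : Mono φ.toSheafHom := by
  refine Preadditive.mono_of_cancel_zero _ fun {Q} a ha => ?_
  apply Sheaf.hom_ext
  ext A x
  have h1 := congrArg (fun b : Q ⟶ T.toSheaf => (b.hom.app A).hom x) ha
  let s : S.sec A.unop := (a.hom.app A).hom x
  refine Subtype.ext (a1 := s) (a2 := 0) (funext fun z => ?_)
  have h2 : φ.fn _ (ext0 s.1) z.1 = 0 :=
    congrFun (congrArg (Subtype.val (p := fun f => f ∈ T.sec A.unop)) h1) z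
  exact (ext0_of_mem s.1 z.2).symm.trans (hφ (s.2 z.1 z.2) h2)

/-- The kernel of `ψ`, whose sections are the sections of `T` that `ψ` takes to `0`. -/
def kernelSheaf (ψ : Hom T R) (hT : T.IsOpenCond) : FunSheaf X where
  K := T.K
  τ := T.τ
  τ_id := T.τ_id
  τ_comp := T.τ_comp
  P n f z := T.P n f z ∧ ψ.fn n f =ᶠ[𝓝 z] fun _ => 0
  P_congr {n f g z} h hf := ⟨T.P_congr h hf.1, by
    filter_upwards [hf.2, h.eventuallyEq_nhds] with y h1 h2
    exact (ψ.congr h2).symm.trans h1⟩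
  P_zero {n} z := ⟨T.P_zero z, Eventually.of_forall fun y => by
    have := ψ.add (T.P_zero y) (T.P_zero y)
    simpa using this⟩
  P_add {n f g z} hf hg := ⟨T.P_add hf.1 hg.1, by
    filter_upwards [hT hf.1, hT hg.1, hf.2, hg.2] with y h1 h2 h3 h4
    exact (ψ.add h1 h2).trans (by rw [h3, h4, add_zero])⟩
  P_neg {n f z} hf := ⟨T.P_neg hf.1, by
    filter_upwards [hT hf.1, hf.2] with y h1 h2
    have h3 := ψ.add h1 (T.P_neg h1)
    have h4 := ψ.add (T.P_zero y) (T.P_zero y)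
    simp only [add_neg_cancel, add_zero, left_eq_add] at h3 h4
    rwa [h2, h4, zero_add, eq_comm] at h3⟩
  P_pull {m n} θ {f z} hf := ⟨T.P_pull θ hf.1, by
    have ht := (X.map θ.op).hom.continuous.tendsto z
    filter_upwards [ht.eventually hf.2, ht.eventually (hT hf.1)] with y h1 h2
    exact (ψ.nat θ h2).trans (by rw [h1, map_zero])⟩

/-- The inclusion of the kernel. -/
def kernelHom (ψ : Hom T R) (hT : T.IsOpenCond) : Hom (kernelSheaf ψ hT) T where
  fn _ f := f
  congr h := h.eq_of_nhds
  P hf := hf.1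
  add _ _ := rfl
  nat _ _ _ _ := rfl

/-- A morphism that `ψ` takes to `0` factors through `kernelSheaf ψ`. -/
theorem exists_kernelHom_lift (ψ : Hom T R) (hT : T.IsOpenCond) {Q : AbSheaf X}
    (a : Q ⟶ T.toSheaf) (ha : a ≫ ψ.toSheafHom = 0) :
    ∃ b : Q ⟶ (kernelSheaf ψ hT).toSheaf, b ≫ (kernelHom ψ hT).toSheafHom = a := by
  have key : ∀ (A : (SOpen X)ᵒᵖ) (x : Q.obj.obj A),
      ((a.hom.app A).hom x : T.sec A.unop).1 ∈ (kernelSheaf ψ hT).sec A.unop := by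
    intro A x z hz
    refine ⟨((a.hom.app A).hom x : T.sec A.unop).2 z hz, ?_⟩
    have h1 := congrArg (fun b : Q ⟶ R.toSheaf => (b.hom.app A).hom x) ha
    have h2 := congrArg (Subtype.val (p := fun f => f ∈ R.sec A.unop)) h1
    filter_upwards [A.unop.carrier.2.mem_nhds hz] with y hy
    exact congrFun h2 ⟨y, hy⟩
  refine ⟨⟨{ app := fun A => AddCommGrpCat.ofHom
               (AddMonoidHom.mk' (fun x => ⟨_, key A x⟩) fun x y => ?_)
             naturality := ?_ }⟩, ?_⟩
  · refine Subtype.ext ?_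
    exact congrArg (Subtype.val (p := fun f => f ∈ T.sec A.unop)) (map_add (a.hom.app A).hom x y)
  · intro A B θ
    ext x
    refine Subtype.ext ?_
    exact congrArg (Subtype.val (p := fun f => f ∈ T.sec B.unop))
      (ConcreteCategory.congr_hom (a.hom.naturality θ) x)
  · apply Sheaf.hom_ext
    ext A x
    refine Subtype.ext (funext fun z => ?_)
    exact ext0_of_mem _ z.2

/-- A sequence that is exact on germs is an exact sequence of simplicial sheaves. -/
theorem Hom.exact (φ : Hom S T) (ψ : Hom T R) (hS : S.IsOpenCond) (hT : T.IsOpenCond)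
    (w : φ.toSheafHom ≫ ψ.toSheafHom = 0)
    (w' : ∀ {n : SimplexCategory} {f : X.obj (op n) → S.K} {z : X.obj (op n)},
      S.P n f z → ψ.fn n (φ.fn n f) z = 0)
    (h : ∀ {n : SimplexCategory} {f : X.obj (op n) → T.K} {z : X.obj (op n)}, T.P n f z →
      (ψ.fn n f =ᶠ[𝓝 z] fun _ => 0) → ∃ g, S.P n g z ∧ φ.fn n g =ᶠ[𝓝 z] f) :
    (ShortComplex.mk _ _ w).Exact := by
  let φ' : Hom S (kernelSheaf ψ hT) :=
    { fn := φ.fn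
      congr := φ.congr
      P := fun hf => ⟨φ.P hf, (hS hf).mono fun _ hy => w' hy⟩
      add := φ.add
      nat := φ.nat }
  -- exactness means that `φ` induces an epimorphism onto the kernel of `ψ`
  have hφ' : Epi φ'.toSheafHom := Hom.epi φ' hS fun hf => h hf.1 hf.2
  have hc : φ'.toSheafHom ≫ (kernelHom ψ hT).toSheafHom = φ.toSheafHom := by
    apply Sheaf.hom_ext
    ext A x
    refine Subtype.ext (funext fun z => ?_)
    exact ext0_of_mem _ z.2
  rw [ShortComplex.exact_iff_exact_up_to_refinements]
  intro Q a ha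
  obtain ⟨b, hb⟩ := exists_kernelHom_lift ψ hT a ha
  obtain ⟨Q', π, hπ, c, hbc⟩ := surjective_up_to_refinements_of_epi φ'.toSheafHom b
  have e : π ≫ b ≫ (kernelHom ψ hT).toSheafHom = c ≫ φ.toSheafHom := by
    rw [← Category.assoc, hbc, Category.assoc, hc]
  exact ⟨Q', π, hπ, c, (congrArg (π ≫ ·) hb.symm).trans e⟩

end FunSheaf

/-! ### Differentiation under the integral sign -/

section ParametricIntegral

open MeasureTheory

variable {E : Type u} [AddCommGroup E] [Module ℝ E] [TopologicalSpace E]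
  [IsTopologicalAddGroup E] [ContinuousSMul ℝ E] [LocallyConvexSpace ℝ E] [T2Space E]

/-- Scalar multiplication is of class `C^k`. The derivative at `(s, x)` along `(t, y)` is `s y + t
x`, a sum of scalar multiplications composed with continuous linear maps, hence the induction. -/
theorem ckOn_smul (k : ℕ) : CkOn k (fun p : ℝ × E => p.1 • p.2) univ := by
  induction k with
  | zero => exact (continuous_fst.smul continuous_snd).continuousOn
  | succ k ih =>
    have key : ∀ p v : ℝ × E, HasDirDeriv (fun p : ℝ × E => p.1 • p.2) p v
        (p.1 • v.2 + v.1 • p.2) := by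
      intro p v
      have hc : Continuous fun t : ℝ => p.1 • v.2 + v.1 • p.2 + t • v.1 • v.2 := by fun_prop
      have h0 := (hc.tendsto 0).mono_left (nhdsWithin_le_nhds (s := {0}ᶜ))
      simp only [zero_smul, add_zero] at h0
      refine h0.congr' ?_
      filter_upwards [self_mem_nhdsWithin] with t (ht : t ≠ 0)
      have e : (p + t • v).1 • (p + t • v).2 - p.1 • p.2 =
          t • (p.1 • v.2 + v.1 • p.2 + t • v.1 • v.2) := by
        simp only [Prod.fst_add, Prod.snd_add, Prod.smul_fst, Prod.smul_snd, smul_eq_mul]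
        module
      rw [e]
      exact (inv_smul_smul₀ ht _).symm
    refine ⟨(continuous_fst.smul continuous_snd).continuousOn, fun p _ v => ⟨_, key p v⟩, ?_⟩
    have hd : (fun p : (ℝ × E) × (ℝ × E) => dirDeriv (fun p : ℝ × E => p.1 • p.2) p.1 p.2) =
        fun p => p.1.1 • p.2.2 + p.2.1 • p.1.2 := funext fun p => (key p.1 p.2).eq
    rw [hd]
    let π₁ := ContinuousLinearMap.fst ℝ (ℝ × E) (ℝ × E)
    let π₂ := ContinuousLinearMap.snd ℝ (ℝ × E) (ℝ × E)
    let p₁ := ContinuousLinearMap.fst ℝ ℝ E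
    let p₂ := ContinuousLinearMap.snd ℝ ℝ E
    have h1 : CkOn k (fun p : (ℝ × E) × (ℝ × E) => p.1.1 • p.2.2) (univ ×ˢ univ) :=
      CkOn.comp_clm k ((p₁.comp π₁).prod (p₂.comp π₂)) ih (mapsTo_univ _ _)
    have h2 : CkOn k (fun p : (ℝ × E) × (ℝ × E) => p.2.1 • p.1.2) (univ ×ˢ univ) :=
      CkOn.comp_clm k ((p₁.comp π₂).prod (p₂.comp π₁)) ih (mapsTo_univ _ _)
    have o : IsOpen (univ ×ˢ univ : Set ((ℝ × E) × (ℝ × E))) := isOpen_univ.prod isOpen_univ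
    exact CkOn.comp k o isOpen_univ
      (CkOn.clm k (ContinuousLinearMap.fst ℝ E E + ContinuousLinearMap.snd ℝ E E) univ)
      (CkOn.prodMk k o h1 h2) (mapsTo_univ _ _)

theorem smoothOn_smul : SmoothOn (fun p : ℝ × E => p.1 • p.2) univ := fun k => ckOn_smul k

theorem tendsto_integral_of_uniform {ι : Type*} {l : Filter ι} {g : ι → ℝ → ℝ} {g₀ : ℝ → ℝ}
    (hg : ∀ᶠ i in l, ContinuousOn (g i) (Icc 0 1)) (hg₀ : ContinuousOn g₀ (Icc 0 1))
    (h : ∀ ε > 0, ∀ᶠ i in l, ∀ s ∈ Icc (0 : ℝ) 1, |g i s - g₀ s| < ε) :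
    Tendsto (fun i => ∫ s in (0 : ℝ)..1, g i s) l (𝓝 (∫ s in (0 : ℝ)..1, g₀ s)) := by
  rw [Metric.tendsto_nhds]
  intro ε hε
  filter_upwards [hg, h (ε / 2) (half_pos hε)] with i h1 h2
  have i1 : IntervalIntegrable (g i) volume 0 1 :=
    ContinuousOn.intervalIntegrable (by rwa [uIcc_of_le zero_le_one])
  have i2 : IntervalIntegrable g₀ volume 0 1 :=
    ContinuousOn.intervalIntegrable (by rwa [uIcc_of_le zero_le_one])
  rw [dist_eq_norm, ← intervalIntegral.integral_sub i1 i2]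
  refine lt_of_le_of_lt (intervalIntegral.norm_integral_le_of_norm_le_const (C := ε / 2)
    fun s hs => ?_) ?_
  · rw [uIoc_of_le zero_le_one] at hs
    exact (h2 s (Ioc_subset_Icc_self hs)).le
  · simp only [sub_zero, abs_one, mul_one]
    exact half_lt_self hε

theorem continuousOn_slice {P : Type*} [TopologicalSpace P] {F : ℝ × P → ℝ} {O : Set (ℝ × P)}
    (hF : ContinuousOn F O) {p : P} (hp : ∀ s ∈ Icc (0 : ℝ) 1, (s, p) ∈ O) :
    ContinuousOn (fun s => F (s, p)) (Icc 0 1) :=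
  hF.comp (by fun_prop) hp

/-- The integrals depend continuously on the parameter because `[0, 1]` is compact, which makes the
convergence of the integrands uniform. -/
theorem continuousOn_integral {P : Type*} [TopologicalSpace P] {F : ℝ × P → ℝ} {O : Set (ℝ × P)}
    (hO : IsOpen O) (hF : ContinuousOn F O) {V : Set P} (hV : IsOpen V)
    (hVO : ∀ s ∈ Icc (0 : ℝ) 1, ∀ p ∈ V, (s, p) ∈ O) :
    ContinuousOn (fun p => ∫ s in (0 : ℝ)..1, F (s, p)) V := by
  intro p hp
  refine ContinuousAt.continuousWithinAt ?_
  refine tendsto_integral_of_uniform ?_ (continuousOn_slice hF fun s hs => hVO s hs p hp) ?_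
  · filter_upwards [hV.mem_nhds hp] with p' hp'
    exact continuousOn_slice hF fun s hs => hVO s hs p' hp'
  · intro ε hε
    refine isCompact_Icc.eventually_forall_of_forall_eventually fun s hs => ?_
    have hc : ContinuousAt F (s, p) := hF.continuousAt (hO.mem_nhds (hVO s hs p hp))
    have h1 : Tendsto (fun z : P × ℝ => F (z.2, z.1)) (𝓝 (p, s)) (𝓝 (F (s, p))) :=
      hc.tendsto.comp (continuous_swap.tendsto (p, s))
    have h2 : Tendsto (fun z : P × ℝ => F (z.2, p)) (𝓝 (p, s)) (𝓝 (F (s, p))) :=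
      hc.tendsto.comp ((by fun_prop : Continuous fun z : P × ℝ => (z.2, p)).tendsto (p, s))
    have h3 := (h1.sub h2).abs
    simp only [sub_self, abs_zero] at h3
    exact h3.eventually (gt_mem_nhds hε)

/-- The difference quotients in the parameter converge to the directional derivative locally
uniformly in the variable of integration. -/
theorem tendsto_slope_slice {F : ℝ × E → ℝ} {O : Set (ℝ × E)} (hO : IsOpen O)
    (hF : CkOn 1 F O) {p : E} {s : ℝ} (hs : (s, p) ∈ O) (v : E) :
    Tendsto (fun z : ℝ × ℝ => z.1⁻¹ • (F (z.2, p + z.1 • v) - F (z.2, p))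
      - dirDeriv F (z.2, p) (0, v)) ((𝓝[≠] 0) ×ˢ 𝓝 s) (𝓝 0) := by
  have hO' : O ×ˢ (univ : Set (ℝ × E)) ∈ 𝓝 ((s, p), ((0 : ℝ), v)) :=
    (hO.prod isOpen_univ).mem_nhds ⟨hs, trivial⟩
  have hcd : ContinuousAt (fun z : (ℝ × E) × (ℝ × E) => dirDeriv F z.1 z.2)
      ((s, p), ((0 : ℝ), v)) := ContinuousOn.continuousAt hF.2.2 hO'
  have hc : Tendsto (fun r : ℝ => ((r, p), ((0 : ℝ), v))) (𝓝 s) (𝓝 ((s, p), ((0 : ℝ), v))) :=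
    Continuous.tendsto (by fun_prop) s
  have m0 : Tendsto (fun z : ℝ × ℝ => ((z.2, p), ((0 : ℝ), v))) ((𝓝[≠] 0) ×ˢ 𝓝 s)
      (𝓝 ((s, p), ((0 : ℝ), v))) := hc.comp tendsto_snd
  have m1 : Tendsto (fun z : ℝ × ℝ => (z.1, ((z.2, p), ((0 : ℝ), v))))
      ((𝓝[≠] 0) ×ˢ 𝓝 s) ((𝓝[≠] 0) ×ˢ 𝓝 ((s, p), ((0 : ℝ), v))) :=
    tendsto_fst.prodMk m0
  have hcd' : Tendsto (fun z : (ℝ × E) × (ℝ × E) => dirDeriv F z.1 z.2) (𝓝 ((s, p), ((0 : ℝ), v)))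
      (𝓝 (dirDeriv F (s, p) (0, v))) := hcd
  have h2 := hcd'.comp m0
  have h1 := (hF.strict hO hs (0, v)).comp m1
  have h3 := h1.sub h2
  rw [sub_self] at h3
  refine h3.congr fun z => ?_
  simp only [Function.comp, Prod.smul_mk, smul_zero, Prod.mk_add_mk, add_zero]

/-- Differentiation under the integral sign. The difference quotients converge uniformly on `[0, 1]`
because a `C¹` map is strictly differentiable. -/
theorem hasDirDeriv_integral {F : ℝ × E → ℝ} {O : Set (ℝ × E)} (hO : IsOpen O)
    (hF : CkOn 1 F O) {V : Set E} (hV : IsOpen V)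
    (hVO : ∀ s ∈ Icc (0 : ℝ) 1, ∀ p ∈ V, (s, p) ∈ O) {p : E} (hp : p ∈ V) (v : E) :
    HasDirDeriv (fun p => ∫ s in (0 : ℝ)..1, F (s, p)) p v
      (∫ s in (0 : ℝ)..1, dirDeriv F (s, p) (0, v)) := by
  have hpV : ∀ᶠ t : ℝ in 𝓝[≠] 0, p + t • v ∈ V := (tendsto_line p v).eventually (hV.mem_nhds hp)
  have hsl : ∀ p' ∈ V, ContinuousOn (fun s => F (s, p')) (Icc 0 1) := fun p' hp' =>
    continuousOn_slice hF.1 fun s hs => hVO s hs p' hp'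
  have hint : ∀ p' ∈ V, IntervalIntegrable (fun s => F (s, p')) volume 0 1 := fun p' hp' =>
    ContinuousOn.intervalIntegrable (by rw [uIcc_of_le zero_le_one]; exact hsl p' hp')
  have hd : ContinuousOn (fun s : ℝ => dirDeriv F (s, p) (0, v)) (Icc 0 1) :=
    ContinuousOn.comp (g := fun z : (ℝ × E) × (ℝ × E) => dirDeriv F z.1 z.2)
      (f := fun s : ℝ => ((s, p), (0, v))) hF.2.2 (by fun_prop)
      fun s hs => ⟨hVO s hs p hp, trivial⟩
  have key : Tendsto (fun t : ℝ => ∫ s in (0 : ℝ)..1, t⁻¹ * (F (s, p + t • v) - F (s, p)))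
      (𝓝[≠] 0) (𝓝 (∫ s in (0 : ℝ)..1, dirDeriv F (s, p) (0, v))) := by
    refine tendsto_integral_of_uniform ?_ hd ?_
    · filter_upwards [hpV] with t ht
      exact continuousOn_const.mul ((hsl _ ht).sub (hsl p hp))
    · intro ε hε
      have hev : ∀ᶠ t : ℝ in 𝓝 0, ∀ s ∈ Icc (0 : ℝ) 1, t ≠ 0 →
          |t⁻¹ * (F (s, p + t • v) - F (s, p)) - dirDeriv F (s, p) (0, v)| < ε := by
        refine isCompact_Icc.eventually_forall_of_forall_eventually fun s hs => ?_
        have h3 := (tendsto_slope_slice hO hF (hVO s hs p hp) v).abs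
        rw [abs_zero] at h3
        obtain ⟨A, hA, B, hB, hAB⟩ := mem_prod_iff.1 (h3.eventually (gt_mem_nhds hε))
        rw [nhds_prod_eq]
        filter_upwards [prod_mem_prod (mem_nhdsWithin_iff_eventually.1 hA) hB] with z hz hz0
        have := hAB (show z ∈ A ×ˢ B from ⟨hz.1 hz0, hz.2⟩)
        simpa using this
      filter_upwards [nhdsWithin_le_nhds hev, self_mem_nhdsWithin] with t h1 h2 s hs
      exact h1 s hs h2
  refine key.congr' ?_
  filter_upwards [hpV] with t ht
  rw [intervalIntegral.integral_const_mul, intervalIntegral.integral_sub (hint _ ht) (hint p hp)]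
  rfl

/-- The derivative of a parametric integral in `(p, v)` is again a parametric integral, now over the
parameter space `P × P`; the induction therefore runs over all parameter spaces. -/
theorem CkOn.integral (k : ℕ) : ∀ {P : Type u} [AddCommGroup P] [Module ℝ P] [TopologicalSpace P]
    [IsTopologicalAddGroup P] [ContinuousSMul ℝ P] [LocallyConvexSpace ℝ P] [T2Space P]
    {F : ℝ × P → ℝ} {O : Set (ℝ × P)} {V : Set P}, IsOpen O → IsOpen V → CkOn k F O →
    (∀ s ∈ Icc (0 : ℝ) 1, ∀ p ∈ V, (s, p) ∈ O) →
    CkOn k (fun p => ∫ s in (0 : ℝ)..1, F (s, p)) V := by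
  induction k with
  | zero =>
    intro P _ _ _ _ _ _ _ F O V hO hV hF hVO
    exact continuousOn_integral hO hF hV hVO
  | succ k ih =>
    intro P _ _ _ _ _ _ _ F O V hO hV hF hVO
    have key := fun p hp v => hasDirDeriv_integral hO (hF.of_le (by omega)) hV hVO (p := p) hp v
    refine ⟨continuousOn_integral hO hF.1 hV hVO, fun p hp v => ⟨_, key p hp v⟩, ?_⟩
    let L : (ℝ × (P × P)) →L[ℝ] (ℝ × P) × (ℝ × P) :=
      ((ContinuousLinearMap.fst ℝ ℝ (P × P)).prod ((ContinuousLinearMap.fst ℝ P P).comp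
        (ContinuousLinearMap.snd ℝ ℝ (P × P)))).prod
      ((0 : (ℝ × (P × P)) →L[ℝ] ℝ).prod ((ContinuousLinearMap.snd ℝ P P).comp
        (ContinuousLinearMap.snd ℝ ℝ (P × P))))
    have o : IsOpen (L ⁻¹' (O ×ˢ univ)) := (hO.prod isOpen_univ).preimage L.continuous
    have h1 : CkOn k (fun z : ℝ × (P × P) => dirDeriv F (z.1, z.2.1) (0, z.2.2))
        (L ⁻¹' (O ×ˢ univ)) := CkOn.comp_clm k L hF.2.2 fun z hz => hz
    have h2 := ih (P := P × P) o (hV.prod isOpen_univ) h1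
      fun s hs p hp => ⟨hVO s hs p.1 hp.1, trivial⟩
    exact h2.congr (hV.prod isOpen_univ) fun p hp => (key p.1 hp.1 p.2).eq.symm

theorem SmoothOn.integral {F : ℝ × E → ℝ} {O : Set (ℝ × E)} {V : Set E} (hO : IsOpen O)
    (hV : IsOpen V) (hF : SmoothOn F O) (hVO : ∀ s ∈ Icc (0 : ℝ) 1, ∀ p ∈ V, (s, p) ∈ O) :
    SmoothOn (fun p => ∫ s in (0 : ℝ)..1, F (s, p)) V :=
  fun k => CkOn.integral k hO hV (hF k) hVO

end ParametricIntegral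

/-! ### The Poincaré homotopy operator -/

section PoincareOperator

open MeasureTheory

variable {E : Type u} [AddCommGroup E] [Module ℝ E] {q : ℕ}

/-- Pointwise integrals of a family of alternating forms form an alternating form. -/
theorem exists_integral_alternating (A : ℝ → E [⋀^Fin q]→ₗ[ℝ] ℝ)
    (h : ∀ v, IntervalIntegrable (fun s => A s v) volume 0 1) :
    ∃ B : E [⋀^Fin q]→ₗ[ℝ] ℝ, ∀ v, B v = ∫ s in (0 : ℝ)..1, A s v :=
  ⟨{ toFun := fun v => ∫ s in (0 : ℝ)..1, A s v
     map_update_add' := by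
      intro _ m i a b
      simp only [AlternatingMap.map_update_add]
      exact intervalIntegral.integral_add (h _) (h _)
     map_update_smul' := by
      intro _ m i c a
      simp only [AlternatingMap.map_update_smul, smul_eq_mul]
      exact intervalIntegral.integral_const_mul _ _
     map_eq_zero_of_eq' := by
      intro m i j hm hij
      simp only [(A _).map_eq_zero_of_eq m hm hij]
      exact intervalIntegral.integral_zero }, fun _ => rfl⟩

open Classical in
/-- The Poincaré homotopy operator with centre `y₀`: the `q`-form
`(v₁, …, v_q) ↦ ∫₀¹ s^q W_{y₀ + s (y - y₀)}(y - y₀, v₁, …, v_q) ds`, and `0` at the points where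
these integrals do not define an alternating form. -/
noncomputable def radial (W : E → E [⋀^Fin (q + 1)]→ₗ[ℝ] ℝ) (y₀ y : E) : E [⋀^Fin q]→ₗ[ℝ] ℝ :=
  if h : ∃ B : E [⋀^Fin q]→ₗ[ℝ] ℝ, ∀ v, B v =
    ∫ s in (0 : ℝ)..1, s ^ q * W (y₀ + s • (y - y₀)) (Matrix.vecCons (y - y₀) v)
  then h.choose else 0

variable [TopologicalSpace E] [IsTopologicalAddGroup E] [ContinuousSMul ℝ E]

theorem radial_apply {W : E → E [⋀^Fin (q + 1)]→ₗ[ℝ] ℝ} {C : Set E} {y₀ y : E}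
    (hW : ∀ v, ContinuousOn (fun z => W z v) C)
    (hC : ∀ s ∈ Icc (0 : ℝ) 1, y₀ + s • (y - y₀) ∈ C) (v : Fin q → E) :
    radial W y₀ y v =
      ∫ s in (0 : ℝ)..1, s ^ q * W (y₀ + s • (y - y₀)) (Matrix.vecCons (y - y₀) v) := by
  have h : ∃ B : E [⋀^Fin q]→ₗ[ℝ] ℝ, ∀ v, B v =
      ∫ s in (0 : ℝ)..1, s ^ q * W (y₀ + s • (y - y₀)) (Matrix.vecCons (y - y₀) v) := by
    refine exists_integral_alternating
      (fun s => s ^ q • (W (y₀ + s • (y - y₀))).curryLeft (y - y₀)) fun v => ?_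
    refine ContinuousOn.intervalIntegrable ?_
    rw [uIcc_of_le zero_le_one]
    exact (continuousOn_pow q).mul ((hW (Matrix.vecCons (y - y₀) v)).comp (by fun_prop) hC)
  unfold radial
  rw [dif_pos h]
  exact h.choose_spec v

variable [LocallyConvexSpace ℝ E] [T2Space E]

/-- The integrand of the homotopy operator is smooth in the variable of integration, the parameter,
the point and the tangent vectors. -/
theorem smoothOn_radial_integrand {P : Type u} [AddCommGroup P] [Module ℝ P] [TopologicalSpace P]
    [IsTopologicalAddGroup P] [ContinuousSMul ℝ P] [LocallyConvexSpace ℝ P] [T2Space P]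
    {W : P → E → E [⋀^Fin (q + 1)]→ₗ[ℝ] ℝ} {O : Set (P × E)} (hO : IsOpen O)
    (hW : SmoothOn (fun p : (P × E) × (Fin (q + 1) → E) => W p.1.1 p.1.2 p.2) (O ×ˢ univ))
    (y₀ : E) :
    SmoothOn (fun z : ℝ × ((P × E) × (Fin q → E)) => z.1 ^ q *
      W z.2.1.1 (y₀ + z.1 • (z.2.1.2 - y₀)) (Matrix.vecCons (z.2.1.2 - y₀) z.2.2))
      {z | (z.2.1.1, y₀ + z.1 • (z.2.1.2 - y₀)) ∈ O} := by
  let Q := (P × E) × (Fin q → E)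
  let U : Set (ℝ × Q) := {z | (z.2.1.1, y₀ + z.1 • (z.2.1.2 - y₀)) ∈ O}
  have hU : IsOpen U := hO.preimage (by fun_prop :
    Continuous fun z : ℝ × ((P × E) × (Fin q → E)) => (z.2.1.1, y₀ + z.1 • (z.2.1.2 - y₀)))
  let π₂ := ContinuousLinearMap.snd ℝ ℝ Q
  let pE : (ℝ × Q) →L[ℝ] E := (ContinuousLinearMap.snd ℝ P E).comp
    ((ContinuousLinearMap.fst ℝ (P × E) (Fin q → E)).comp π₂)
  let pP : (ℝ × Q) →L[ℝ] P := (ContinuousLinearMap.fst ℝ P E).comp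
    ((ContinuousLinearMap.fst ℝ (P × E) (Fin q → E)).comp π₂)
  let pV : Fin q → (ℝ × Q) →L[ℝ] E := fun i =>
    (ContinuousLinearMap.proj (R := ℝ) (φ := fun _ : Fin q => E) i).comp
      ((ContinuousLinearMap.snd ℝ (P × E) (Fin q → E)).comp π₂)
  have hr : SmoothOn (fun z : ℝ × ((P × E) × (Fin q → E)) => z.2.1.2 - y₀) U :=
    (SmoothOn.add hU (SmoothOn.clm pE U) (SmoothOn.const (-y₀) U)).congr hU
      fun z _ => (sub_eq_add_neg _ _).symm
  have hs : SmoothOn (fun z : ℝ × ((P × E) × (Fin q → E)) => z.1) U :=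
    SmoothOn.clm (ContinuousLinearMap.fst ℝ ℝ Q) U
  have hc : SmoothOn (fun z : ℝ × ((P × E) × (Fin q → E)) => y₀ + z.1 • (z.2.1.2 - y₀)) U :=
    SmoothOn.add hU (SmoothOn.const y₀ U)
      (SmoothOn.comp hU isOpen_univ smoothOn_smul (hs.prodMk hU hr) (mapsTo_univ _ _))
  have hv : SmoothOn (fun z : ℝ × ((P × E) × (Fin q → E)) => fun i =>
      (Matrix.vecCons (z.2.1.2 - y₀) z.2.2 : Fin (q + 1) → E) i) U := by
    refine SmoothOn.pi (f := fun i (z : ℝ × Q) =>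
      (Matrix.vecCons (z.2.1.2 - y₀) z.2.2 : Fin (q + 1) → E) i) hU fun i => ?_
    refine Fin.cases ?_ (fun j => ?_) i
    · exact hr
    · exact SmoothOn.clm (pV j) U
  have hg := ((SmoothOn.clm pP U).prodMk hU hc).prodMk hU hv
  have hΩ := SmoothOn.comp hU (hO.prod isOpen_univ) hW hg fun z hz => ⟨hz, trivial⟩
  have hm : SmoothOn (fun p : ℝ × ℝ => p.1 ^ q * p.2) univ :=
    smoothOn_of_contDiff fun k => (contDiff_fst.pow q).mul contDiff_snd
  exact SmoothOn.comp hU isOpen_univ hm (hs.prodMk hU hΩ) (mapsTo_univ _ _)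

/-- The homotopy operator preserves smooth families of forms on sets that are star-shaped about `y₀`
in the second variable. -/
theorem smoothOn_radial {P : Type u} [AddCommGroup P] [Module ℝ P] [TopologicalSpace P]
    [IsTopologicalAddGroup P] [ContinuousSMul ℝ P] [LocallyConvexSpace ℝ P] [T2Space P]
    {W : P → E → E [⋀^Fin (q + 1)]→ₗ[ℝ] ℝ} {O : Set (P × E)} (hO : IsOpen O)
    (hW : SmoothOn (fun p : (P × E) × (Fin (q + 1) → E) => W p.1.1 p.1.2 p.2) (O ×ˢ univ))
    (y₀ : E) (hst : ∀ t y, (t, y) ∈ O → ∀ s ∈ Icc (0 : ℝ) 1, (t, y₀ + s • (y - y₀)) ∈ O) :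
    SmoothOn (fun p : (P × E) × (Fin q → E) => radial (W p.1.1) y₀ p.1.2 p.2) (O ×ˢ univ) := by
  have hU : IsOpen {z : ℝ × ((P × E) × (Fin q → E)) |
      (z.2.1.1, y₀ + z.1 • (z.2.1.2 - y₀)) ∈ O} := hO.preimage (by fun_prop)
  refine (SmoothOn.integral hU (hO.prod isOpen_univ) (smoothOn_radial_integrand hO hW y₀)
    fun s hs p hp => hst _ _ hp.1 s hs).congr (hO.prod isOpen_univ) ?_
  rintro ⟨⟨t, y⟩, v⟩ ⟨hp, -⟩
  refine (radial_apply (W := W t) (C := {z | (t, z) ∈ O}) (fun v => ?_) (hst t y hp) v).symm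
  exact (hW 0).continuousOn.comp (f := fun z => ((t, z), v)) (by fun_prop) fun z hz => ⟨hz, trivial⟩

theorem hasDerivAt_ray {f : E → ℝ} {y₀ r : E} {s a : ℝ} (h : HasDirDeriv f (y₀ + s • r) r a) :
    HasDerivAt (fun s : ℝ => f (y₀ + s • r)) a s := by
  rw [hasDerivAt_iff_tendsto_slope_zero]
  refine Tendsto.congr (fun t => ?_) h
  rw [add_smul, add_assoc]

/-- The directional derivative of the integrand of the homotopy operator. -/
theorem dirDeriv_radial_integrand {W : E → E [⋀^Fin (q + 1)]→ₗ[ℝ] ℝ} {C : Set E} (hC : IsOpen C)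
    (hW : CkOn 1 (fun p : E × (Fin (q + 1) → E) => W p.1 p.2) (C ×ˢ univ)) {y₀ y : E} {s : ℝ}
    (hs : y₀ + s • (y - y₀) ∈ C) (v : Fin q → E) (u : E) :
    dirDeriv (fun z : ℝ × E => z.1 ^ q * W (y₀ + z.1 • (z.2 - y₀)) (Matrix.vecCons (z.2 - y₀) v))
      (s, y) (0, u) = s ^ q * (s * dirDeriv (fun z => W z (Matrix.vecCons (y - y₀) v))
        (y₀ + s • (y - y₀)) u + W (y₀ + s • (y - y₀)) (Matrix.vecCons u v)) := by
  have hlin := (hW.form_apply hC (Matrix.vecCons (y - y₀) v)).isLinearMap hC hs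
  have h1 : HasDirDeriv (fun z : E => (y₀ + s • (z - y₀),
      (Matrix.vecCons (z - y₀) v : Fin (q + 1) → E))) y u (s • u, Matrix.vecCons u 0) := by
    refine HasDirDeriv.prodMk ?_ ?_
    · refine tendsto_const_nhds.congr' ?_
      filter_upwards [self_mem_nhdsWithin] with t (ht : t ≠ 0)
      rw [eq_inv_smul_iff₀ ht]
      module
    · refine tendsto_const_nhds.congr' ?_
      filter_upwards [self_mem_nhdsWithin] with t (ht : t ≠ 0)
      rw [eq_inv_smul_iff₀ ht]
      funext i
      refine Fin.cases ?_ (fun j => ?_) i <;> simp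
  have h2 := hasDirDeriv_comp (f := fun p : E × (Fin (q + 1) → E) => W p.1 p.2)
    (hC.prod isOpen_univ) hW h1 ⟨hs, trivial⟩
  rw [dirDeriv_form hC hW hs, Fin.sum_univ_succ] at h2
  have h3 : ∀ i : Fin q, W (y₀ + s • (y - y₀)) (Function.update
      (Matrix.vecCons (y - y₀) v : Fin (q + 1) → E) i.succ
      ((Matrix.vecCons u 0 : Fin (q + 1) → E) i.succ)) = 0 := fun i =>
    (W _).map_coord_zero i.succ (by simp)
  have h4 : Function.update (Matrix.vecCons (y - y₀) v : Fin (q + 1) → E) 0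
      ((Matrix.vecCons u 0 : Fin (q + 1) → E) 0) = Matrix.vecCons u v := by
    simp [Matrix.vecCons]
  simp only [h3, h4, Finset.sum_const_zero, add_zero] at h2
  rw [hlin.map_smul] at h2
  have h5 := h2.const_smul (s ^ q)
  refine HasDirDeriv.eq ?_
  unfold HasDirDeriv at h5 ⊢
  refine h5.congr fun t => ?_
  simp only [Prod.fst_add, Prod.snd_add, Prod.smul_fst, Prod.smul_snd, smul_eq_mul, mul_zero,
    add_zero]

/-- The homotopy operator is a right inverse of `d` on closed forms. The integrand of
`d (radial W y₀)` at `y` is the derivative of `s ↦ s^{q+1} W_{y₀ + s (y - y₀)}` by the closedness of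
`W`, so the integral is `W y`. -/
theorem extD_radial {W : E → E [⋀^Fin (q + 1)]→ₗ[ℝ] ℝ} {C : Set E} (hC : IsOpen C)
    (hW : SmoothOn (fun p : E × (Fin (q + 1) → E) => W p.1 p.2) (C ×ˢ univ)) {y₀ : E}
    (hst : ∀ y ∈ C, ∀ s ∈ Icc (0 : ℝ) 1, y₀ + s • (y - y₀) ∈ C)
    (hcl : ∀ y ∈ C, extD W y = 0) {y : E} (hy : y ∈ C) : extD (radial W y₀) y = W y := by
  have hWv : ∀ v, CkOn 1 (fun z => W z v) C := fun v => (hW 1).form_apply hC v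
  let U : Set (ℝ × E) := {z | y₀ + z.1 • (z.2 - y₀) ∈ C}
  have hU : IsOpen U := hC.preimage (by fun_prop : Continuous fun z : ℝ × E =>
    y₀ + z.1 • (z.2 - y₀))
  let F : (Fin q → E) → ℝ × E → ℝ := fun v z =>
    z.1 ^ q * W (y₀ + z.1 • (z.2 - y₀)) (Matrix.vecCons (z.2 - y₀) v)
  -- the parametrised statements, used for a one-point space of parameters
  let P := PUnit.{u + 1}
  have hO : IsOpen (univ ×ˢ C : Set (P × E)) := isOpen_univ.prod hC
  have hWP : SmoothOn (fun p : (P × E) × (Fin (q + 1) → E) => W p.1.2 p.2)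
      ((univ ×ˢ C) ×ˢ univ) :=
    hW.comp_clm ((ContinuousLinearMap.snd ℝ P E).prodMap (ContinuousLinearMap.id ℝ _))
      fun p hp => ⟨hp.1.2, trivial⟩
  have hF : ∀ v, CkOn 1 (F v) U := by
    intro v
    have h1 : SmoothOn (fun z : ℝ × E => (z.1, (((0 : P), z.2), v))) U :=
      SmoothOn.prodMk hU (SmoothOn.clm (ContinuousLinearMap.fst ℝ ℝ E) U)
        (SmoothOn.prodMk hU (SmoothOn.prodMk hU (SmoothOn.const _ U)
          (SmoothOn.clm (ContinuousLinearMap.snd ℝ ℝ E) U)) (SmoothOn.const v U))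
    have hU' : IsOpen {z : ℝ × ((P × E) × (Fin q → E)) |
      (z.2.1.1, y₀ + z.1 • (z.2.1.2 - y₀)) ∈ (univ ×ˢ C : Set (P × E))} :=
      hO.preimage (by fun_prop)
    exact SmoothOn.comp hU hU' (smoothOn_radial_integrand (W := fun _ : P => W) hO hWP y₀) h1
      (fun z hz => ⟨trivial, hz⟩) 1
  have hR : ∀ v, CkOn 1 (fun z => radial W y₀ z v) C := by
    intro v
    have h1 : SmoothOn (fun z : E => (((0 : P), z), v)) C :=
      SmoothOn.prodMk hC (SmoothOn.prodMk hC (SmoothOn.const _ C)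
        (SmoothOn.clm (ContinuousLinearMap.id ℝ E) C)) (SmoothOn.const v C)
    exact SmoothOn.comp hC (hO.prod isOpen_univ) (smoothOn_radial (W := fun _ : P => W) hO hWP y₀
      fun t y h s hs => ⟨trivial, hst y h.2 s hs⟩) h1 (fun z hz => ⟨⟨trivial, hz⟩, trivial⟩) 1
  have hRd : ∀ v u, dirDeriv (fun z => radial W y₀ z v) y u =
      ∫ s in (0 : ℝ)..1, dirDeriv (F v) (s, y) (0, u) := by
    intro v u
    have h1 := hasDirDeriv_integral hU (hF v) hC (fun s hs p hp => hst p hp s hs) hy u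
    refine Eq.trans (dirDeriv_congr ?_ u) h1.eq
    filter_upwards [hC.mem_nhds hy] with z hz
    exact radial_apply (fun v => (hWv v).continuousOn) (hst z hz) v
  have hFc : ∀ v u, ContinuousOn (fun s : ℝ => dirDeriv (F v) (s, y) (0, u)) (Icc 0 1) :=
    fun v u => ContinuousOn.comp (g := fun z : (ℝ × E) × (ℝ × E) => dirDeriv (F v) z.1 z.2)
      (f := fun s : ℝ => ((s, y), (0, u))) (hF v).2.2 (by fun_prop)
      fun s hs => ⟨hst y hy s hs, trivial⟩
  ext v
  rw [extD_apply hC hR hy]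
  simp only [hRd]
  have hsum : ∀ i : Fin (q + 1), ContinuousOn (fun s : ℝ => (-1 : ℝ) ^ (i : ℕ) *
      dirDeriv (F (i.removeNth v)) (s, y) (0, v i)) (Icc 0 1) := fun i =>
    continuousOn_const.mul (hFc _ _)
  have hII : ∀ {g : ℝ → ℝ}, ContinuousOn g (Icc 0 1) → IntervalIntegrable g volume 0 1 :=
    fun hg => ContinuousOn.intervalIntegrable (by rwa [uIcc_of_le zero_le_one])
  -- the differential of the integral is the integral of the differential
  have e1 : ∑ i : Fin (q + 1), (-1) ^ (i : ℕ) • ∫ s in (0 : ℝ)..1,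
      dirDeriv (F (i.removeNth v)) (s, y) (0, v i) =
      ∫ s in (0 : ℝ)..1, ∑ i : Fin (q + 1), (-1 : ℝ) ^ (i : ℕ) *
        dirDeriv (F (i.removeNth v)) (s, y) (0, v i) := by
    rw [intervalIntegral.integral_finsetSum fun i _ => hII (hsum i)]
    refine Finset.sum_congr rfl fun i _ => ?_
    rw [intervalIntegral.integral_const_mul]
    rcases Nat.even_or_odd (i : ℕ) with h | h <;> simp [h.neg_one_pow]
  rw [e1]
  have hder : ∀ s ∈ uIcc (0 : ℝ) 1, HasDerivAt
      (fun s : ℝ => s ^ (q + 1) * W (y₀ + s • (y - y₀)) v)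
      (∑ i : Fin (q + 1), (-1 : ℝ) ^ (i : ℕ) * dirDeriv (F (i.removeNth v)) (s, y) (0, v i)) s := by
    intro s hs
    rw [uIcc_of_le zero_le_one] at hs
    have hcs := hst y hy s hs
    have d1 : HasDerivAt (fun s : ℝ => W (y₀ + s • (y - y₀)) v)
        (dirDeriv (fun z => W z v) (y₀ + s • (y - y₀)) (y - y₀)) s :=
      hasDerivAt_ray (f := fun z => W z v)
        (hasDirDeriv_of_exists ((hWv v).2.1 _ hcs (y - y₀)))
    have d2 := (hasDerivAt_pow (q + 1) s).mul d1
    refine d2.congr_deriv ?_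
    -- closedness, evaluated on the radial vector and `v`
    have hc0 := congrArg (fun A : E [⋀^Fin (q + 1 + 1)]→ₗ[ℝ] ℝ => A (Matrix.vecCons (y - y₀) v))
      (hcl _ hcs)
    simp only [AlternatingMap.zero_apply] at hc0
    rw [extD_apply hC hWv hcs, Fin.sum_univ_succ] at hc0
    have r0 : Fin.removeNth 0 (Matrix.vecCons (y - y₀) v : Fin (q + 2) → E) = v := by
      funext j; simp [Fin.removeNth]
    have r1 : ∀ i : Fin (q + 1), Fin.removeNth i.succ
        (Matrix.vecCons (y - y₀) v : Fin (q + 2) → E) =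
        Matrix.vecCons (y - y₀) (i.removeNth v) := by
      intro i; funext j
      refine Fin.cases ?_ (fun j => ?_) j <;> simp [Fin.removeNth]
    simp only [r0, r1, Matrix.cons_val_zero, Matrix.cons_val_succ, Fin.val_zero, pow_zero, one_smul,
      Fin.val_succ] at hc0
    have e2 : ∀ i : Fin (q + 1), (-1 : ℝ) ^ (i : ℕ) *
        W (y₀ + s • (y - y₀)) (Matrix.vecCons (v i) (i.removeNth v)) =
        W (y₀ + s • (y - y₀)) v := by
      intro i
      have := (W (y₀ + s • (y - y₀))).map_insertNth i (v i) (i.removeNth v)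
      rw [Fin.insertNth_self_removeNth] at this
      rw [this]
      rcases Nat.even_or_odd (i : ℕ) with h | h <;> simp [h.neg_one_pow]
    have e3 : ∀ i : Fin (q + 1), (-1 : ℝ) ^ (i : ℕ) *
        dirDeriv (F (i.removeNth v)) (s, y) (0, v i) =
        s ^ (q + 1) * ((-1 : ℝ) ^ (i : ℕ) * dirDeriv
          (fun z => W z (Matrix.vecCons (y - y₀) (i.removeNth v))) (y₀ + s • (y - y₀)) (v i)) +
        s ^ q * W (y₀ + s • (y - y₀)) v := by
      intro i
      rw [dirDeriv_radial_integrand hC (hW 1) hcs, ← e2 i]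
      ring
    have e4 : dirDeriv (fun z => W z v) (y₀ + s • (y - y₀)) (y - y₀) =
        ∑ i : Fin (q + 1), (-1 : ℝ) ^ (i : ℕ) * dirDeriv
          (fun z => W z (Matrix.vecCons (y - y₀) (i.removeNth v))) (y₀ + s • (y - y₀)) (v i) := by
      rw [eq_comm, ← sub_eq_zero, ← neg_eq_zero, neg_sub, sub_eq_add_neg, ← Finset.sum_neg_distrib,
        ← hc0]
      congr 1
      refine Finset.sum_congr rfl fun i _ => ?_
      rcases Nat.even_or_odd (i : ℕ) with h | h <;> simp [pow_succ, h.neg_one_pow]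
    simp only [e3, Finset.sum_add_distrib, ← Finset.mul_sum, ← e4, Finset.sum_const,
      Finset.card_univ, Fintype.card_fin, nsmul_eq_mul]
    push_cast
    ring
  rw [intervalIntegral.integral_eq_sub_of_hasDerivAt hder
    (hII (continuousOn_finsetSum _ fun i _ => hsum i))]
  simp

end PoincareOperator

/-! ### The Poincaré lemma for relative forms -/

section RelativeForms

variable {D : Type u} [AddCommGroup D] [Module ℝ D] [TopologicalSpace D]
  [IsTopologicalAddGroup D] [ContinuousSMul ℝ D] [LocallyConvexSpace ℝ D] [T2Space D]
  {B : Type u} [TopologicalSpace B] [ChartedSpace D B] [LCManifold D B]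
  {E : Type u} [AddCommGroup E] [Module ℝ E] [TopologicalSpace E]
  [IsTopologicalAddGroup E] [ContinuousSMul ℝ E] [LocallyConvexSpace ℝ E] [T2Space E]
  {X : Type u} [TopologicalSpace X] [ChartedSpace E X] [LCManifold E X] {q : ℕ}

theorem exists_isOpen_convex_subset {x : E} {U : Set E} (hU : U ∈ 𝓝 x) :
    ∃ C, IsOpen C ∧ Convex ℝ C ∧ x ∈ C ∧ C ⊆ U := by
  obtain ⟨K, ⟨hK, hKc⟩, hKU⟩ := (LocallyConvexSpace.convex_basis (𝕜 := ℝ) x).mem_iff.1 hU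
  exact ⟨interior K, isOpen_interior, hKc.interior, mem_interior_iff_mem_nhds.2 hK,
    interior_subset.trans hKU⟩

theorem ray_mem {C : Set E} (hC : Convex ℝ C) {y₀ y : E} (h₀ : y₀ ∈ C) (hy : y ∈ C) {s : ℝ}
    (hs : s ∈ Icc (0 : ℝ) 1) : y₀ + s • (y - y₀) ∈ C :=
  hC.add_smul_sub_mem h₀ hy hs

/-- The coordinate expression of a form in any chart at `x` determines its value at `x`. -/
theorem eq_of_chartForm_eq {η η' : X → E [⋀^Fin q]→ₗ[ℝ] ℝ} {e : OpenPartialHomeomorph X E}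
    (he : e ∈ atlas E X) {x : X} (hx : x ∈ e.source)
    (h : chartForm η e (e x) = chartForm η' e (e x)) : η x = η' x := by
  have key : ∀ η : X → E [⋀^Fin q]→ₗ[ℝ] ℝ, η x = (chartForm η e (e x)).compLinearMap
      (derivLM (fun z => e ((chartAt E x).symm z)) (chartAt E x x)) := by
    intro η
    have hc := (chartAt E x).left_inv (mem_chart_source E x)
    have h1 := chartForm_change η (chart_mem_atlas E x) he (mem_chart_target E x)
      (by rwa [hc])
    rw [hc] at h1
    rw [← h1]
    have h2 : derivLM (fun z => chartAt E x ((chartAt E x).symm z)) (chartAt E x x) =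
        LinearMap.id := mderiv_id x
    have h3 : ∀ x', x' = x → η x = (η x').compLinearMap
        (derivLM (fun z => chartAt E x' ((chartAt E x).symm z)) (chartAt E x x)) := by
      rintro _ rfl
      rw [h2]
      rfl
    exact h3 _ hc
  rw [key η, key η', h]

theorem chartForm_eq_zero {η : X → E [⋀^Fin q]→ₗ[ℝ] ℝ} {e : OpenPartialHomeomorph X E} {y : E}
    (h : η (e.symm y) = 0) : chartForm η e y = 0 := by
  unfold chartForm
  rw [h]
  rfl

/-- The relative form on `B × X` with coordinate expression `R` in the charts `a` and `e`. Outside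
the product of their domains its values carry no meaning. -/
noncomputable def ofChart (a : OpenPartialHomeomorph B D) (e : OpenPartialHomeomorph X E)
    (R : D → E → E [⋀^Fin q]→ₗ[ℝ] ℝ) (z : B × X) : E [⋀^Fin q]→ₗ[ℝ] ℝ :=
  (R (a z.1) (e z.2)).compLinearMap
    (derivLM (fun y => e ((chartAt E z.2).symm y)) (chartAt E z.2 z.2))

/-- In the chart `e` the form `ofChart a e R` is given by `R`. -/
theorem chartForm_ofChart (a : OpenPartialHomeomorph B D) {e : OpenPartialHomeomorph X E}
    (he : e ∈ atlas E X) (R : D → E → E [⋀^Fin q]→ₗ[ℝ] ℝ) (b : B) {y : E} (hy : y ∈ e.target) :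
    chartForm (fun x => ofChart a e R (b, x)) e y = R (a b) y := by
  have h1 := derivLM_chart_comp (mSmooth_id (E := E) (X := X)) (mSmooth_id (E := E) (X := X)) he
    (chart_mem_atlas E (e.symm y)) he hy (mem_chart_source _ _) (e.map_target hy)
  have h2 : derivLM (fun z => e (e.symm z)) y = LinearMap.id := by
    rw [← derivLM_id y]
    refine derivLM_congr ?_
    filter_upwards [e.open_target.mem_nhds hy] with z hz
    exact e.right_inv hz
  rw [h2] at h1
  change ((R (a b) (e (e.symm y))).compLinearMap _).compLinearMap _ = _
  rw [e.right_inv hy]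
  ext v
  simp only [AlternatingMap.compLinearMap_apply]
  congr 1
  funext i
  exact (LinearMap.congr_fun h1 (v i)).symm

/-- Smoothness of a relative form can be checked in one chart. -/
theorem smoothVFormOn_of_chart {ω : B × X → E [⋀^Fin q]→ₗ[ℝ] ℝ} {O : Set (B × X)} (hO : IsOpen O)
    {a : OpenPartialHomeomorph B D} (ha : a ∈ atlas D B) {e : OpenPartialHomeomorph X E}
    (he : e ∈ atlas E X) (hOs : O ⊆ (a.prod e).source)
    (h : SmoothOn (fun p : (D × E) × (Fin q → E) =>
      chartForm (fun x => ω (a.symm p.1.1, x)) e p.1.2 p.2)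
      (((a.prod e).target ∩ (a.prod e).symm ⁻¹' O) ×ˢ univ)) : SmoothVFormOn D ω O := by
  intro a₁ ha₁ e₁ he₁
  let V : Set (D × E) := (a₁.prod e₁).target ∩ (a₁.prod e₁).symm ⁻¹' O
  have oV : IsOpen V := (a₁.prod e₁).isOpen_inter_preimage_symm hO
  have oVq : IsOpen (V ×ˢ (univ : Set (Fin q → E))) := oV.prod isOpen_univ
  have hVa : ∀ p ∈ V, a₁.symm p.1 ∈ a.source := fun p hp => (hOs hp.2).1
  have hVe : ∀ p ∈ V, e₁.symm p.2 ∈ e.source := fun p hp => (hOs hp.2).2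
  let βt : D × E → D := fun p => a (a₁.symm p.1)
  let φt : D × E → E := fun p => e (e₁.symm p.2)
  have hβt : SmoothOn βt V :=
    (LCManifold.smooth_transition a₁ ha₁ a ha).comp_clm (ContinuousLinearMap.fst ℝ D E)
      fun p hp => ⟨hp.1.1, hVa p hp⟩
  have hφt : SmoothOn φt V :=
    (LCManifold.smooth_transition e₁ he₁ e he).comp_clm (ContinuousLinearMap.snd ℝ D E)
      fun p hp => ⟨hp.1.2, hVe p hp⟩
  have hfst : SmoothOn (fun p : (D × E) × (Fin q → E) => p.1) (V ×ˢ univ) :=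
    SmoothOn.clm (ContinuousLinearMap.fst ℝ (D × E) (Fin q → E)) (V ×ˢ univ)
  have hφd : ∀ i : Fin q, SmoothOn (fun p : (D × E) × (Fin q → E) =>
      dirDeriv φt p.1 (0, p.2 i)) (V ×ˢ univ) := by
    intro i
    let L : ((D × E) × (Fin q → E)) →L[ℝ] (D × E) × (D × E) :=
      (ContinuousLinearMap.fst ℝ _ _).prod ((0 : _ →L[ℝ] D).prod
        ((ContinuousLinearMap.proj (R := ℝ) (φ := fun _ : Fin q => E)
          i).comp (ContinuousLinearMap.snd ℝ _ _)))
    exact hφt.deriv.comp_clm L fun p hp => ⟨hp.1, trivial⟩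
  have hg : SmoothOn (fun p : (D × E) × (Fin q → E) =>
      ((βt p.1, φt p.1), fun i => dirDeriv φt p.1 (0, p.2 i))) (V ×ˢ univ) :=
    SmoothOn.prodMk oVq (SmoothOn.prodMk oVq (hβt.comp oVq oV hfst fun p hp => hp.1)
      (hφt.comp oVq oV hfst fun p hp => hp.1)) (SmoothOn.pi oVq hφd)
  refine (SmoothOn.comp oVq (isOpen_vdom (q := q) a e hO) h hg ?_).congr oVq ?_
  · rintro p ⟨hp, -⟩
    refine ⟨⟨⟨a.map_source (hVa _ hp), e.map_source (hVe _ hp)⟩, ?_⟩, trivial⟩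
    change (a.symm (a (a₁.symm p.1.1)), e.symm (e (e₁.symm p.1.2))) ∈ O
    rw [a.left_inv (hVa _ hp), e.left_inv (hVe _ hp)]
    exact hp.2
  · rintro ⟨⟨t, y⟩, v⟩ ⟨hp, -⟩
    have e1 := chartForm_change (fun x => ω (a₁.symm t, x)) he₁ he hp.1.2 (hVe _ hp)
    change chartForm (fun x => ω (a.symm (a (a₁.symm t)), x)) e _ _ =
      chartForm (fun x => ω (a₁.symm t, x)) e₁ y v
    rw [e1, a.left_inv (hVa _ hp), AlternatingMap.compLinearMap_apply]
    congr 1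
    funext i
    have o2 : IsOpen (e₁.target ∩ e₁.symm ⁻¹' e.source) :=
      e₁.isOpen_inter_preimage_symm e.open_source
    rw [derivLM_apply o2 (LCManifold.smooth_transition e₁ he₁ e he 1) ⟨hp.1.2, hVe _ hp⟩]
    refine dirDeriv_eq_of_eq ?_
    ext c
    simp [HasDirDeriv, φt]

/-- A neighbourhood of a point of `B × X` contains a product of the domain of a chart of `B` and the
domain of a chart of `X` with convex image. -/
theorem exists_convex_box {z : B × X} {O : Set (B × X)} (hO : O ∈ 𝓝 z) :
    ∃ (A : Set D) (C : Set E), IsOpen A ∧ IsOpen C ∧ Convex ℝ C ∧ chartAt D z.1 z.1 ∈ A ∧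
      chartAt E z.2 z.2 ∈ C ∧ A ×ˢ C ⊆ ((chartAt D z.1).prod (chartAt E z.2)).target ∩
        ((chartAt D z.1).prod (chartAt E z.2)).symm ⁻¹' O := by
  obtain ⟨O', hO'O, hO', hz⟩ := mem_nhds_iff.1 hO
  let c := (chartAt D z.1).prod (chartAt E z.2)
  have hm : c z ∈ c.target ∩ c.symm ⁻¹' O' :=
    ⟨⟨mem_chart_target D z.1, mem_chart_target E z.2⟩, by
      change c.symm (c z) ∈ O'
      rwa [c.left_inv ⟨mem_chart_source D z.1, mem_chart_source E z.2⟩]⟩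
  have hn : c.target ∩ c.symm ⁻¹' O' ∈ 𝓝 (chartAt D z.1 z.1, chartAt E z.2 z.2) :=
    (c.isOpen_inter_preimage_symm hO').mem_nhds hm
  obtain ⟨A, C₁, hA, hzA, hC₁, hzC₁, hAC⟩ := mem_nhds_prod_iff'.1 hn
  obtain ⟨C, hC, hCc, hzC, hCC⟩ := exists_isOpen_convex_subset (hC₁.mem_nhds hzC₁)
  exact ⟨A, C, hA, hC, hCc, hzA, hzC, ((prod_mono subset_rfl hCC).trans hAC).trans
    (inter_subset_inter_right _ (preimage_mono hO'O))⟩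

/-- The Poincaré lemma along the fibres of `B × X → B`. -/
theorem exists_vd_eq {f : B × X → E [⋀^Fin (q + 1)]→ₗ[ℝ] ℝ} {z : B × X} (hf : VGerm D f z)
    (hcl : vd f =ᶠ[𝓝 z] fun _ => 0) :
    ∃ g : B × X → E [⋀^Fin q]→ₗ[ℝ] ℝ, VGerm D g z ∧ vd g =ᶠ[𝓝 z] f := by
  obtain ⟨O, hO, hz, hs⟩ := hf
  obtain ⟨O', hO'n, hO', hz'⟩ := eventually_nhds_iff.1 hcl
  have hs' := hs.mono (inter_subset_left : O ∩ O' ⊆ O)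
  have hOO : IsOpen (O ∩ O') := hO.inter hO'
  obtain ⟨A, C, hA, hC, hCc, hzA, hzC, hAC⟩ := exists_convex_box (D := D) (E := E)
    (hOO.mem_nhds ⟨hz, hz'⟩)
  let a := chartAt D z.1
  let e := chartAt E z.2
  have ha : a ∈ atlas D B := chart_mem_atlas _ _
  have he : e ∈ atlas E X := chart_mem_atlas _ _
  let y₀ := e z.2
  let W : D → E → E [⋀^Fin (q + 1)]→ₗ[ℝ] ℝ := fun t => chartForm (fun x => f (a.symm t, x)) e
  have hWs : SmoothOn (fun p : (D × E) × (Fin (q + 1) → E) => W p.1.1 p.1.2 p.2)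
      ((A ×ˢ C) ×ˢ univ) := (hs' a ha e he).mono (prod_mono hAC subset_rfl)
  let R : D → E → E [⋀^Fin q]→ₗ[ℝ] ℝ := fun t => radial (W t) y₀
  have hRs : SmoothOn (fun p : (D × E) × (Fin q → E) => R p.1.1 p.1.2 p.2)
      ((A ×ˢ C) ×ˢ univ) := smoothOn_radial (hA.prod hC) hWs y₀
    fun t y h s hs => ⟨h.1, ray_mem hCc hzC h.2 hs⟩
  let Oz : Set (B × X) := (a.prod e).source ∩ (a.prod e) ⁻¹' (A ×ˢ C)
  have oOz : IsOpen Oz := (a.prod e).isOpen_inter_preimage (hA.prod hC)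
  have hgs : SmoothVFormOn D (ofChart a e R) Oz := by
    refine smoothVFormOn_of_chart oOz ha he inter_subset_left ?_
    refine (hRs.mono (prod_mono ?_ subset_rfl)).congr (isOpen_vdom a e oOz) ?_
    · rintro p ⟨hp, hp'⟩
      have h1 : (a.prod e) ((a.prod e).symm p) ∈ A ×ˢ C := hp'.2
      rwa [(a.prod e).right_inv hp] at h1
    · rintro ⟨⟨t, y⟩, v⟩ ⟨⟨hp, -⟩, -⟩
      change R t y v = chartForm (fun x => ofChart a e R (a.symm t, x)) e y v
      rw [chartForm_ofChart a he R _ hp.2, a.right_inv hp.1]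
  have hzO : z ∈ Oz := ⟨⟨mem_chart_source D z.1, mem_chart_source E z.2⟩, hzA, hzC⟩
  refine ⟨ofChart a e R, ⟨Oz, oOz, hzO, hgs⟩, ?_⟩
  filter_upwards [oOz.mem_nhds hzO]
  rintro ⟨b, x⟩ ⟨⟨hb, hx⟩, hbA, hxC⟩
  replace hb : b ∈ a.source := hb
  replace hx : x ∈ e.source := hx
  replace hbA : a b ∈ A := hbA
  replace hxC : e x ∈ C := hxC
  have hWb : W (a b) = chartForm (fun x => f (b, x)) e := by
    change chartForm (fun x => f (a.symm (a b), x)) e = _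
    rw [a.left_inv hb]
  have hCt : ∀ y ∈ C, y ∈ e.target ∧ (b, e.symm y) ∈ O ∩ O' := by
    intro y hy
    have h1 := hAC (show (a b, y) ∈ A ×ˢ C from ⟨hbA, hy⟩)
    have h2 : (a.symm (a b), e.symm y) ∈ O ∩ O' := h1.2
    rw [a.left_inv hb] at h2
    exact ⟨h1.1.2, h2⟩
  have hsl := hs'.slice hOO b
  have oSl : IsOpen {x | (b, x) ∈ O ∩ O'} := hOO.preimage (by fun_prop)
  refine eq_of_chartForm_eq (η := extDM fun x => ofChart a e R (b, x)) (η' := fun x => f (b, x))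
    he hx ?_
  have oSg : IsOpen {x | (b, x) ∈ Oz} := oOz.preimage (by fun_prop)
  rw [chartForm_extDM oSg (hgs.slice oOz b) he (e.map_source hx)
    (by rw [e.left_inv hx]; exact ⟨⟨hb, hx⟩, hbA, hxC⟩)]
  have h1 : chartForm (fun x => ofChart a e R (b, x)) e =ᶠ[𝓝 (e x)]
      radial (chartForm (fun x => f (b, x)) e) y₀ := by
    filter_upwards [e.open_target.mem_nhds (e.map_source hx)] with y hy
    rw [chartForm_ofChart a he R b hy]
    change radial (W (a b)) y₀ y = _
    rw [hWb]
  rw [extD_congr h1]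
  refine extD_radial hC ((hsl e he).mono (prod_mono (fun y hy => hCt y hy) subset_rfl))
    (fun y hy s hs => ray_mem hCc hzC hy hs) (fun y hy => ?_) hxC
  rw [← chartForm_extDM oSl hsl he (hCt y hy).1 (hCt y hy).2]
  exact chartForm_eq_zero (hO'n (b, e.symm y) (hCt y hy).2.2)

end RelativeForms

/-! ### Functions with values in the circle group -/

section CircleFunctions

variable {D : Type u} [AddCommGroup D] [Module ℝ D] [TopologicalSpace D]
  [IsTopologicalAddGroup D] [ContinuousSMul ℝ D] [LocallyConvexSpace ℝ D] [T2Space D]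
  {B : Type u} [TopologicalSpace B] [ChartedSpace D B] [LCManifold D B]
  {E : Type u} [AddCommGroup E] [Module ℝ E] [TopologicalSpace E]
  [IsTopologicalAddGroup E] [ContinuousSMul ℝ E] [LocallyConvexSpace ℝ E] [T2Space E]
  {X : Type u} [TopologicalSpace X] [ChartedSpace E X] [LCManifold E X]

/-- The element `exp (2πi r)` of `𝕋`. -/
noncomputable def TVal.exp (r : ℝ) : TVal.{u} :=
  ULift.up (Additive.ofMul (Circle.exp (2 * Real.pi * r)))

theorem TVal.toC_exp (r : ℝ) :
    (TVal.exp.{u} r).toC = Complex.exp ((2 * Real.pi * r : ℝ) * Complex.I) :=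
  Circle.coe_exp _

theorem TVal.toC_injective : Function.Injective TVal.toC.{u} := fun _ _ h =>
  ULift.down_injective (Additive.toMul.injective (Circle.coe_injective h))

theorem hasDerivAt_toC_exp {φ : ℝ → ℝ} {t a : ℝ} (h : HasDerivAt φ a t) :
    HasDerivAt (fun t => (TVal.exp.{u} (φ t)).toC)
      ((TVal.exp.{u} (φ t)).toC * ((2 * Real.pi * a : ℝ) * Complex.I)) t := by
  simp only [TVal.toC_exp]
  exact (((h.const_mul (2 * Real.pi)).ofReal_comp).mul_const Complex.I).cexp

/-- `(1 / 2πi) d log exp (2πi φ) = d φ`. -/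
theorem dlogL_toC_exp {φ : E → ℝ} {U : Set E} (hU : IsOpen U) (hφ : CkOn 1 φ U) {y : E}
    (hy : y ∈ U) (v : Fin 1 → E) :
    dlogL (fun z => (TVal.exp.{u} (φ z)).toC) y v = dirDeriv φ y (v 0) := by
  have hs : CkOn 1 (fun r : ℝ => (TVal.exp.{u} r).toC) univ := by
    simp only [TVal.toC_exp]
    refine ckOn_of_contDiffOn 1 isOpen_univ (ContDiff.contDiffOn ?_)
    exact ((Complex.ofRealCLM.contDiff.comp (contDiff_const.mul contDiff_id)).mul
      contDiff_const).cexp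
  have hc : CkOn 1 (fun z => (TVal.exp.{u} (φ z)).toC) U :=
    CkOn.comp 1 (f := fun r : ℝ => (TVal.exp.{u} r).toC) hU isOpen_univ hs hφ (mapsTo_univ _ _)
  rw [dlogL_apply hU hc hy]
  have h1 : HasDerivAt (fun t : ℝ => φ (y + t • v 0)) (dirDeriv φ y (v 0)) 0 :=
    hasDirDeriv_iff_hasDerivAt.1 (hasDirDeriv_of_exists (hφ.2.1 y hy (v 0)))
  have h2 := hasDerivAt_toC_exp.{u} h1
  simp only [zero_smul, add_zero] at h2
  have h3 : HasDirDeriv (fun z => (TVal.exp.{u} (φ z)).toC) y (v 0) _ :=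
    hasDirDeriv_iff_hasDerivAt.2 h2
  have e1 : starRingEnd ℂ (TVal.exp.{u} (φ y)).toC * (TVal.exp.{u} (φ y)).toC = 1 := by
    rw [mul_comm, Complex.mul_conj, TVal.normSq_toC]; simp
  rw [h3.eq, ← mul_assoc, e1, one_mul]
  have : (2 * Real.pi) ≠ 0 := by positivity
  simp only [Complex.mul_im, Complex.ofReal_re, Complex.ofReal_im, Complex.I_re, Complex.I_im,
    mul_one, mul_zero, add_zero]
  rw [inv_mul_cancel_left₀ this]

/-- The Poincaré lemma in degree one, with the potential in `𝕋`. -/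
theorem exists_vdlog_eq {f : B × X → E [⋀^Fin 1]→ₗ[ℝ] ℝ} {z : B × X} (hf : VGerm D f z)
    (hcl : vd f =ᶠ[𝓝 z] fun _ => 0) :
    ∃ g : B × X → TVal.{u}, TGerm (D × E) g z ∧ vdlog g =ᶠ[𝓝 z] f := by
  -- a potential `F` is a `0`-form; the function that is wanted is `exp (2πi F)`
  obtain ⟨F, ⟨O, hO, hz, hF⟩, hFf⟩ := exists_vd_eq hf hcl
  have hcf : ∀ (b : B) (e : OpenPartialHomeomorph X E) (y : E) (v : Fin 0 → E),
      chartForm (fun x => F (b, x)) e y v = F (b, e.symm y) 0 := fun b e y v =>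
    congrArg (F (b, e.symm y)) (Subsingleton.elim _ _)
  refine ⟨fun y => TVal.exp (F y 0), ⟨O, hO, hz, ?_⟩, ?_⟩
  · rintro _ ⟨a, ha, e, he, rfl⟩
    have o : IsOpen ((a.prod e).target ∩ (a.prod e).symm ⁻¹' O) :=
      (a.prod e).isOpen_inter_preimage_symm hO
    have h1 : SmoothOn (fun p : D × E => (p, (0 : Fin 0 → E)))
        ((a.prod e).target ∩ (a.prod e).symm ⁻¹' O) :=
      SmoothOn.prodMk o (SmoothOn.clm (ContinuousLinearMap.id ℝ (D × E)) _) (SmoothOn.const _ _)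
    have h2 : SmoothOn (fun p : D × E => F (a.symm p.1, e.symm p.2) 0)
        ((a.prod e).target ∩ (a.prod e).symm ⁻¹' O) :=
      (SmoothOn.comp o (isOpen_vdom a e hO) (hF a ha e he) h1 fun p hp => ⟨hp, trivial⟩).congr o
        fun p _ => hcf _ _ _ _
    have h3 : SmoothOn (fun r : ℝ => (TVal.exp.{u} r).toC) univ := by
      simp only [TVal.toC_exp]
      exact smoothOn_of_contDiff fun k => ((Complex.ofRealCLM.contDiff.comp
        (contDiff_const.mul contDiff_id)).mul contDiff_const).cexp
    exact SmoothOn.comp (f := fun r : ℝ => (TVal.exp.{u} r).toC) o isOpen_univ h3 h2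
      (mapsTo_univ _ _)
  · filter_upwards [hFf, hO.mem_nhds hz]
    rintro ⟨b, x⟩ h1 hx
    rw [← h1]
    have oS : IsOpen {x | (b, x) ∈ O} := hO.preimage (by fun_prop)
    let e := chartAt E x
    have hs := hF.slice hO b e (chart_mem_atlas E x)
    have o := e.isOpen_inter_preimage_symm oS
    have hm : e x ∈ e.target ∩ e.symm ⁻¹' {x | (b, x) ∈ O} :=
      ⟨mem_chart_target E x, by
        change (b, e.symm (e x)) ∈ O
        rwa [e.left_inv (mem_chart_source E x)]⟩
    have hc : ∀ v, CkOn 1 (fun y => chartForm (fun x => F (b, x)) e y v)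
      (e.target ∩ e.symm ⁻¹' {x | (b, x) ∈ O}) := fun v => (hs 1).form_apply o v
    have hc0 : CkOn 1 (fun y => F (b, e.symm y) 0) (e.target ∩ e.symm ⁻¹' {x | (b, x) ∈ O}) :=
      (hc 0).congr o fun y _ => hcf _ _ _ _
    ext v
    have h2 := dlogL_toC_exp.{u} o hc0 hm v
    have h3 := extD_apply o hc hm v
    simp only [hcf, Fin.sum_univ_one, Fin.val_zero, pow_zero, one_smul, Nat.reduceAdd] at h3
    exact h2.trans h3.symm

theorem HasDirDeriv.ray {F : Type v} [AddCommGroup F] [Module ℝ F] [TopologicalSpace F] {g : E → F}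
    {y₀ r : E} {s : ℝ} {a : F} (h : HasDirDeriv g (y₀ + s • r) r a) :
    HasDirDeriv (fun s : ℝ => g (y₀ + s • r)) s 1 a := by
  refine Tendsto.congr (fun t => ?_) h
  simp only [smul_eq_mul, mul_one, add_smul, add_assoc]

/-- For a function `f` of modulus one the real part of `conj f · df` vanishes, so `d log f = 0`
forces `df = 0`. -/
theorem dirDeriv_eq_zero_of_dlogL_eq_zero {f : E → ℂ} {U : Set E} (hU : IsOpen U) (hf : CkOn 1 f U)
    (h1 : ∀ z ∈ U, Complex.normSq (f z) = 1) {y : E} (hy : y ∈ U) (h : dlogL f y = 0) (u : E) :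
    dirDeriv f y u = 0 := by
  have hre := dirDeriv_unitary hU hf h1 hy u
  have him := dlogL_apply hU hf hy (fun _ => u)
  rw [h, AlternatingMap.zero_apply, eq_comm] at him
  have him' := (mul_eq_zero.1 him).resolve_left (by positivity)
  have h2 : starRingEnd ℂ (f y) * dirDeriv f y u = 0 := Complex.ext hre him'
  refine (mul_eq_zero.1 h2).resolve_left fun h3 => ?_
  have h4 := h1 y hy
  rw [(map_eq_zero _).1 h3] at h4
  simp at h4

/-- A smooth `𝕋`-valued function with vanishing relative `d log` is locally the pullback of a smooth
function on the base. -/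
theorem exists_eq_comp_fst {f : B × X → TVal.{u}} {z : B × X} (hf : TGerm (D × E) f z)
    (hcl : vdlog f =ᶠ[𝓝 z] fun _ => (0 : E [⋀^Fin 1]→ₗ[ℝ] ℝ)) :
    ∃ h : B → TVal.{u}, TGerm D h z.1 ∧ f =ᶠ[𝓝 z] fun y => h y.1 := by
  refine ⟨fun b => f (b, z.2), TGerm.comp (φ := fun b : B => (b, z.2))
    (MSmooth.prodMk mSmooth_id (mSmooth_const z.2)) hf, ?_⟩
  obtain ⟨O, hO, hz, hs⟩ := hf
  obtain ⟨O', hO'n, hO', hz'⟩ := eventually_nhds_iff.1 hcl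
  have hs' := smoothFunOn_mono hs (inter_subset_left : O ∩ O' ⊆ O)
  have hOO : IsOpen (O ∩ O') := hO.inter hO'
  obtain ⟨A, C, hA, hC, hCc, hzA, hzC, hAC⟩ := exists_convex_box (D := D) (E := E)
    (hOO.mem_nhds ⟨hz, hz'⟩)
  let a := chartAt D z.1
  let e := chartAt E z.2
  have he : e ∈ atlas E X := chart_mem_atlas _ _
  have hOz : (a.prod e).source ∩ (a.prod e) ⁻¹' (A ×ˢ C) ∈ 𝓝 z :=
    ((a.prod e).isOpen_inter_preimage (hA.prod hC)).mem_nhds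
      ⟨⟨mem_chart_source D z.1, mem_chart_source E z.2⟩, hzA, hzC⟩
  filter_upwards [hOz]
  rintro ⟨b, x⟩ ⟨⟨hb, hx⟩, hbA, hxC⟩
  replace hb : b ∈ a.source := hb
  replace hx : x ∈ e.source := hx
  replace hbA : a b ∈ A := hbA
  replace hxC : e x ∈ C := hxC
  have hCt : ∀ y ∈ C, y ∈ e.target ∧ (b, e.symm y) ∈ O ∩ O' := by
    intro y hy
    have h1 := hAC (show (a b, y) ∈ A ×ˢ C from ⟨hbA, hy⟩)
    have h2 : (a.symm (a b), e.symm y) ∈ O ∩ O' := h1.2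
    rw [a.left_inv hb] at h2
    exact ⟨h1.1.2, h2⟩
  have hsl := hs'.slice hOO b
  have oSl : IsOpen {x | (b, x) ∈ O ∩ O'} := hOO.preimage (by fun_prop)
  let φ : E → ℂ := fun y => (f (b, e.symm y)).toC
  have hφ : CkOn 1 φ C := (hsl e he 1).mono fun y hy => hCt y hy
  have hd : ∀ y ∈ C, ∀ u, dirDeriv φ y u = 0 := by
    intro y hy u
    refine dirDeriv_eq_zero_of_dlogL_eq_zero hC hφ (fun _ _ => TVal.normSq_toC _) hy ?_ u
    have h1 := chartForm_dlogM oSl hsl he (hCt y hy).1 (hCt y hy).2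
    exact h1.symm.trans (chartForm_eq_zero (hO'n (b, e.symm y) (hCt y hy).2.2))
  -- `f (b, ·)` has derivative zero on the segment from the centre of the chart to `x`
  have hmv := mean_value (c := fun s : ℝ => φ (e z.2 + s • (e x - e z.2)))
    (c' := fun _ => 0) (convex_singleton (0 : ℂ)) isClosed_singleton
    (fun s hs => by
      have hm : e z.2 + s • (e x - e z.2) ∈ C := ray_mem hCc hzC hxC hs
      have h2 := hasDirDeriv_of_exists (hφ.2.1 _ hm (e x - e z.2))
      rw [hd _ hm] at h2
      exact h2.ray)
    (fun _ _ => rfl)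
  simp only [one_smul, zero_smul, add_zero, add_sub_cancel, mem_singleton_iff, sub_eq_zero] at hmv
  refine TVal.toC_injective ?_
  have h5 : φ (e x) = (f (b, x)).toC := by
    change (f (b, e.symm (e x))).toC = _
    rw [e.left_inv hx]
  have h6 : φ (e z.2) = (f (b, z.2)).toC := by
    change (f (b, e.symm (e z.2))).toC = _
    rw [e.left_inv (mem_chart_source E z.2)]
  exact h5.symm.trans (hmv.trans h6)

end CircleFunctions

/-! ### The resolution of `π⁻¹𝕋` -/

section Resolution

/-- Exactness transported along equalities of both morphisms, with any proof that the composition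
vanishes. -/
theorem exact_of_eq {C : Type*} [Category* C] [Limits.HasZeroMorphisms C] {X Y Z : C}
    {f f' : X ⟶ Y} {g g' : Y ⟶ Z} (hf : f = f') (hg : g = g') (w : f ≫ g = 0) (w' : f' ≫ g' = 0)
    (h : (ShortComplex.mk f' g' w').Exact) : (ShortComplex.mk f g w).Exact := by
  subst hf hg
  exact h

theorem exact_iso_hom_comp {C : Type*} [Category* C] [Limits.HasZeroMorphisms C] {W X Y Z : C}
    (e : W ≅ X) {f : X ⟶ Y} {g : Y ⟶ Z} (w : (e.hom ≫ f) ≫ g = 0) (w' : f ≫ g = 0)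
    (h : (ShortComplex.mk f g w').Exact) : (ShortComplex.mk (e.hom ≫ f) g w).Exact :=
  ShortComplex.exact_of_iso (S₁ := ShortComplex.mk f g w')
    (ShortComplex.isoMk e.symm (Iso.refl _) (Iso.refl _) (by simp) (by simp)) h

theorem exact_comp_iso_inv {C : Type*} [Category* C] [Limits.HasZeroMorphisms C] {W X Y Z : C}
    (e : W ≅ Z) {f : X ⟶ Y} {g : Y ⟶ Z} (w : f ≫ g ≫ e.inv = 0) (w' : f ≫ g = 0)
    (h : (ShortComplex.mk f g w').Exact) : (ShortComplex.mk f (g ≫ e.inv) w).Exact :=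
  ShortComplex.exact_of_iso (S₁ := ShortComplex.mk f g w')
    (ShortComplex.isoMk (Iso.refl _) (Iso.refl _) e.symm (by simp) (by simp)) h

variable (D : Type u) [AddCommGroup D] [Module ℝ D] [TopologicalSpace D]
  [IsTopologicalAddGroup D] [ContinuousSMul ℝ D] [LocallyConvexSpace ℝ D] [T2Space D]
  (G : Type u) [TopologicalSpace G] [ChartedSpace D G] [Group G] [LCLieGroup D G]
  (E : Type u) [AddCommGroup E] [Module ℝ E] [TopologicalSpace E]
  [IsTopologicalAddGroup E] [ContinuousSMul ℝ E] [LocallyConvexSpace ℝ E] [T2Space E]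
  (M : Type u) [TopologicalSpace M] [ChartedSpace E M] [LCManifold E M]
  [MulAction G M] [LCSmoothAction D G E M]

theorem isOpenCond_shT : (shT D G E M).IsOpenCond := fun n _ _ hf =>
  TGerm.eventually (E := (Fin n.len → D) × E) (X := (Fin n.len → G) × M) hf

/-- Being locally pulled back from the base is an open condition. -/
theorem isOpenCond_shPiT : (shPiT D G E M).IsOpenCond := by
  rintro n f z ⟨h, hh, hf⟩
  have h1 : ∀ᶠ y : (Fin n.len → G) × M in 𝓝 z, TGerm (Fin n.len → D) h y.1 :=
    (continuous_fst.tendsto z).eventually hh.eventually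
  have h2 := hf.eventuallyEq_nhds
  filter_upwards [h1, h2] with y k1 k2 using ⟨h, k1, k2⟩

theorem isOpenCond_shA (q : ℕ) (R : Prop) : (shA D G E M q R).IsOpenCond := by
  rintro n f z ⟨h1, h2⟩
  refine (VGerm.eventually h1).and ?_
  rcases h2 with h2 | h2
  · exact Eventually.of_forall fun _ => Or.inl h2
  · exact h2.eventuallyEq_nhds.mono fun _ h => Or.inr h

theorem isOpenCond_delX (N k : ℕ) : (delX D G E M N k).IsOpenCond := by
  cases k with
  | zero => exact isOpenCond_shT D G E M
  | succ k => exact isOpenCond_shA D G E M _ _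

theorem mono_homPi : Mono (homPi D G E M).toSheafHom :=
  FunSheaf.Hom.mono _ fun _ h => h

/-- Exactness at `𝕋`. -/
theorem homPi_exact {N : ℕ} (hN : 1 ≤ N)
    (w : (homPi D G E M).toSheafHom ≫ (delD D G E M N 0).toSheafHom = 0) :
    (ShortComplex.mk _ _ w).Exact := by
  refine FunSheaf.Hom.exact _ _ (isOpenCond_shPiT D G E M) (isOpenCond_delX D G E M N 0) w ?_ ?_
  · rintro n f z ⟨h, hh, hf⟩
    rw [delD_zero D G E M hN]
    exact (vdlog_congr hf).trans (vdlog_pi E M)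
  · intro n f z hf hcl
    rw [delD_zero D G E M hN] at hcl
    obtain ⟨h, hh, hfh⟩ := exists_eq_comp_fst (D := Fin n.len → D) (B := Fin n.len → G) (E := E)
      (X := M) (f := f) (z := z) hf hcl
    exact ⟨f, ⟨h, hh, hfh⟩, EventuallyEq.rfl⟩

/-- Closed relative forms lie in the image of the differential of `F̄(N)` on germs, in form degree
one as well as in the higher degrees. -/
theorem exists_delD_eq {N k : ℕ} (hk : k + 1 ≤ N) {n : SimplexCategory}
    {f : (Fin n.len → G) × M → E [⋀^Fin (k + 1)]→ₗ[ℝ] ℝ} {z : (Fin n.len → G) × M}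
    (hf : VGerm (Fin n.len → D) f z) (hcl : vd f =ᶠ[𝓝 z] fun _ => 0) :
    ∃ g, (delX D G E M N k).P n g z ∧ (delD D G E M N k).fn n g =ᶠ[𝓝 z] f := by
  cases k with
  | zero =>
    obtain ⟨g, hg, hgf⟩ := exists_vdlog_eq hf hcl
    rw [delD_zero D G E M hk]
    exact ⟨g, hg, hgf⟩
  | succ k =>
    obtain ⟨g, hg, hgf⟩ := exists_vd_eq hf hcl
    rw [delD_succ D G E M hk]
    exact ⟨g, ⟨hg, Or.inl (by omega)⟩, hgf⟩

theorem vd_delD {N k : ℕ} (hk : k + 1 ≤ N) {n : SimplexCategory}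
    {f : (simpSpace D G E M).obj (op n) → (delX D G E M N k).K} {z : (Fin n.len → G) × M}
    (hf : (delX D G E M N k).P n f z) :
    vd (B := Fin n.len → G) (X := M) (q := k + 1) ((delD D G E M N k).fn n f) z = 0 := by
  cases k with
  | zero =>
    rw [delD_zero D G E M hk]
    exact vd_vdlog hf
  | succ k =>
    rw [delD_succ D G E M hk]
    exact vd_vd hf.1

/-- Exactness at `A^{k+1}_rel` for `k + 1 < N`. -/
theorem delD_exact {N k : ℕ} (hk : k + 1 < N)
    (w : (delD D G E M N k).toSheafHom ≫ (delD D G E M N (k + 1)).toSheafHom = 0) :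
    (ShortComplex.mk _ _ w).Exact := by
  refine FunSheaf.Hom.exact _ _ (isOpenCond_delX D G E M N k) (isOpenCond_delX D G E M N (k + 1))
    w ?_ ?_
  · intro n f z hf
    rw [delD_succ D G E M hk]
    exact vd_delD D G E M hk.le hf
  · intro n f z hf hcl
    rw [delD_succ D G E M hk] at hcl
    exact exists_delD_eq D G E M hk.le hf.1 hcl

/-- Exactness at `A^N_rel`, where `N = k + 1`. -/
theorem curvHom_exact (k : ℕ)
    (w : (delD D G E M (k + 1) k).toSheafHom ≫ (curvHom D G E M (k + 1)).toSheafHom = 0) :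
    (ShortComplex.mk _ _ w).Exact := by
  refine FunSheaf.Hom.exact _ _ (isOpenCond_delX D G E M (k + 1) k)
    (isOpenCond_delX D G E M (k + 1) (k + 1)) w ?_ ?_
  · intro n f z hf
    exact vd_delD D G E M le_rfl hf
  · intro n f z hf hcl
    exact exists_delD_eq D G E M le_rfl hf.1 hcl

theorem epi_curvHom (k : ℕ) : Epi (curvHom D G E M (k + 1)).toSheafHom := by
  refine FunSheaf.Hom.epi _ (isOpenCond_delX D G E M (k + 1) (k + 1)) ?_
  intro n f z hf
  obtain ⟨g, hg, hgf⟩ := exists_vd_eq (D := Fin n.len → D) (B := Fin n.len → G) (X := M) hf.1 hf.2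
  exact ⟨g, ⟨hg, Or.inl le_rfl⟩, hgf⟩

/-- The sheaves of forms above the truncation degree are zero. -/
theorem isZero_shA (q : ℕ) {R : Prop} (hR : ¬R) : Limits.IsZero (shA D G E M q R).toSheaf := by
  rw [Limits.IsZero.iff_id_eq_zero]
  apply Sheaf.hom_ext
  ext A f
  let t : (shA D G E M q R).sec A.unop := f
  refine Subtype.ext (funext fun z => ?_)
  have h1 := ((t.2 z.1 z.2).2.resolve_left hR).eq_of_nhds
  rwa [ext0_of_mem _ z.2] at h1

/-- The sheaf `π⁻¹𝕋`, the complex `F̄(N)` and the sheaf of closed relative forms fit into a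
distinguished triangle. -/
theorem exists_distinguished_piToDel {N : ℕ} (hN : 1 ≤ N) :
    ∃ b : (toDerived _).obj (aclComplex D G E M N) ⟶
        ((toDerived _).obj (piTComplex D G E M))⟦(1 : ℤ)⟧,
      Pretriangulated.Triangle.mk ((toDerived _).map (piToDel D G E M N))
        ((toDerived _).map (delToAcl D G E M N)) b ∈ Pretriangulated.distinguishedTriangles := by
  obtain ⟨N, rfl⟩ : ∃ k, N = k + 1 := ⟨N - 1, by omega⟩
  have hf : (piToDel D G E M (N + 1)).f 0 =
      (HomologicalComplex.singleObjXSelf (ComplexShape.up ℕ) 0 _).hom ≫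
        (homPi D G E M).toSheafHom := HomologicalComplex.mkHomFromSingle_f _ _
  have hg : (delToAcl D G E M (N + 1)).f (N + 1) = (curvHom D G E M (N + 1)).toSheafHom ≫
      (HomologicalComplex.singleObjXSelf (ComplexShape.up ℕ) (N + 1) _).inv :=
    HomologicalComplex.mkHomToSingle_f _ _
  have hd := delComplex_d D G E M (N + 1)
  have w0 : (piToDel D G E M (N + 1)).f 0 ≫ (delComplex D G E M (N + 1)).d 0 1 = 0 := by
    rw [hf, hd 0]
    exact (Category.assoc _ _ _).trans
      ((congrArg _ (homPi_comp D G E M (N + 1))).trans Limits.comp_zero)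
  refine exists_distinguished_of_resolution (Nat.succ_ne_zero N) (piToDel D G E M (N + 1))
    (delToAcl D G E M (N + 1)) w0 ?_ ?_ ?_ ?_ ?_ ?_
  · have := mono_homPi D G E M
    rw [hf]
    exact @mono_comp _ _ _ _ _ _ inferInstance _ this
  · refine exact_of_eq hf (hd 0) _ ?_ ?_
    · rw [← hf, ← hd 0]; exact w0
    · exact exact_iso_hom_comp _ _ (homPi_comp D G E M (N + 1))
        (homPi_exact D G E M (Nat.succ_le_succ (Nat.zero_le N)) _)
  · intro k hk
    exact exact_of_eq (hd k) (hd (k + 1)) _ (delD_comp D G E M (N + 1) k)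
      (delD_exact D G E M hk _)
  · intro k hk w
    obtain rfl : k = N := by omega
    refine exact_of_eq (hd k) hg _ ?_ ?_
    · rw [← hg, ← hd k]; exact w
    · exact exact_comp_iso_inv _ _ (delD_curv D G E M k) (curvHom_exact D G E M k _)
  · intro k hk
    obtain ⟨k, rfl⟩ : ∃ j, k = j + 1 := ⟨k - 1, by omega⟩
    exact isZero_shA D G E M (k + 1) (by omega)
  · have := epi_curvHom D G E M N
    rw [hg]
    exact @epi_comp _ _ _ _ _ _ this _ inferInstance

end Resolution

/-! ### Global sections and invariant forms -/

section GlobalSections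

/-- Hypercohomology of `F[-N]` in degree `N` consists of the global sections of `F`. -/
theorem singleHom_bijective {X : SimplicialObject TopCat.{u}} (F : AbSheaf X) (N : ℕ) :
    Function.Bijective (singleHom F N) := by
  let S := DerivedCategory.singleFunctor (AbSheaf X) 0
  let i : ((toDerived X).obj
      ((HomologicalComplex.single (AbSheaf X) (ComplexShape.up ℕ) N).obj F))⟦(N : ℤ)⟧ ≅ S.obj F :=
    (shiftFunctor _ (N : ℤ)).mapIso (DerivedCategory.Q.mapIso
      (HomologicalComplex.extendSingleIso ComplexShape.embeddingUpNat F N (N : ℤ) rfl)) ≪≫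
      ((DerivedCategory.singleFunctors (AbSheaf X)).shiftIso (N : ℤ) 0 (N : ℤ)
        (add_zero _)).app F
  have hS : ∀ c, S.map (singleHom F N c) = c ≫ i.hom := fun c => S.map_preimage _
  refine ⟨fun c c' h => ?_, fun s => ⟨S.map s ≫ i.inv, S.map_injective ?_⟩⟩
  · have h1 : c ≫ i.hom = c' ≫ i.hom := by rw [← hS, ← hS, h]
    exact (cancel_mono i.hom).1 h1
  · refine (hS _).trans ?_
    rw [Category.assoc, i.inv_hom_id, Category.comp_id]

/-- A global section is determined by its values on all open sets. -/
theorem hom_ext_of_evalZ {X : SimplicialObject TopCat.{u}} {F : AbSheaf X} {s s' : constZ X ⟶ F}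
    (h : ∀ A, evalZ s A = evalZ s' A) : s = s' := by
  apply ((sheafificationAdjunction (SOpen.topology X) AddCommGrpCat.{u}).homEquiv _ _).injective
  ext A m
  obtain ⟨m⟩ := m
  have key : ∀ φ : ULift.{u} ℤ →+ F.obj.obj A, φ ⟨m⟩ = m • φ ⟨1⟩ := by
    intro φ
    rw [← map_zsmul]
    congr 1
    ext
    simp
  exact (key _).trans ((congrArg (m • ·) (h A.unop)).trans (key _).symm)

/-- A compatible family of sections is a global section. -/
theorem exists_evalZ_eq {X : SimplicialObject TopCat.{u}} {F : AbSheaf X}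
    (t : ∀ A : SOpen X, F.obj.obj (op A))
    (ht : ∀ {A B : SOpen X} (f : A ⟶ B), F.obj.map f.op (t B) = t A) :
    ∃ s : constZ X ⟶ F, ∀ A, evalZ s A = t A := by
  let φ : ∀ A : (SOpen X)ᵒᵖ, ULift.{u} ℤ →+ F.obj.obj A := fun A =>
    ((zmultiplesHom _) (t A.unop)).comp AddEquiv.ulift.toAddMonoidHom
  let τ : (Functor.const (SOpen X)ᵒᵖ).obj (AddCommGrpCat.of (ULift.{u} ℤ)) ⟶ F.obj :=
    { app := fun A => AddCommGrpCat.ofHom (φ A)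
      naturality := fun A B f => by
        ext m
        change m.down • t B.unop = F.obj.map f (m.down • t A.unop)
        rw [map_zsmul]
        exact congrArg _ (ht f.unop).symm }
  refine ⟨((sheafificationAdjunction (SOpen.topology X) AddCommGrpCat.{u}).homEquiv _ _).symm τ,
    fun A => ?_⟩
  unfold evalZ
  rw [Equiv.apply_symm_apply]
  exact one_zsmul (t A)

variable {D : Type u} [AddCommGroup D] [Module ℝ D] [TopologicalSpace D]
  [IsTopologicalAddGroup D] [ContinuousSMul ℝ D] [LocallyConvexSpace ℝ D] [T2Space D]
  {G : Type u} [TopologicalSpace G] [ChartedSpace D G] [Group G] [LCLieGroup D G]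
  {E : Type u} [AddCommGroup E] [Module ℝ E] [TopologicalSpace E]
  [IsTopologicalAddGroup E] [ContinuousSMul ℝ E] [LocallyConvexSpace ℝ E] [T2Space E]
  {M : Type u} [TopologicalSpace M] [ChartedSpace E M] [LCManifold E M]
  [MulAction G M] [LCSmoothAction D G E M]

/-- A global section is determined by its values on level zero, because each `[n]` has a vertex. -/
theorem sectionForm_injective {q : ℕ} : Function.Injective
    (sectionForm : (constZ (simpSpace D G E M) ⟶ (shAcl D G E M q).toSheaf) → _) := by
  intro s s' h
  refine hom_ext_of_evalZ fun A => ?_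
  obtain ⟨n, U⟩ := A
  let θ : SimplexCategory.mk 0 ⟶ n := SimplexCategory.const _ n 0
  let f : (⟨n, U⟩ : SOpen (simpSpace D G E M)) ⟶ ⟨SimplexCategory.mk 0, ⊤⟩ :=
    ⟨θ, fun _ _ => trivial⟩
  have h0 : ∀ (w : (Fin (SimplexCategory.mk 0).len → G) × M),
      (evalZ s ⟨.mk 0, ⊤⟩ : (shAcl D G E M q).sec ⟨.mk 0, ⊤⟩).1 ⟨w, trivial⟩ =
        (evalZ s' ⟨.mk 0, ⊤⟩ : (shAcl D G E M q).sec ⟨.mk 0, ⊤⟩).1 ⟨w, trivial⟩ := by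
    rintro ⟨g, x⟩
    obtain rfl : g = (pt0 G x).1 := funext fun i => Fin.elim0 i
    exact congrFun h x
  refine (evalZ_map s f).symm.trans (Eq.trans ?_ (evalZ_map s' f))
  refine Subtype.ext (funext fun z => ?_)
  exact congrArg ((shAcl D G E M q).τ θ z.1) (h0 _)

/-- The pullback of a smooth form to a product is a smooth relative form. -/
theorem SmoothFormOn.vGerm {B : Type u} [TopologicalSpace B] [ChartedSpace D B] {q : ℕ}
    {η : M → E [⋀^Fin q]→ₗ[ℝ] ℝ} (h : SmoothFormOn η univ) (z : B × M) :
    VGerm D (fun y : B × M => η y.2) z := by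
  refine ⟨univ, isOpen_univ, trivial, fun a ha e he => ?_⟩
  exact (h e he).comp_clm ((ContinuousLinearMap.snd ℝ D E).prodMap (ContinuousLinearMap.id ℝ _))
    fun p hp => ⟨⟨hp.1.1.2, trivial⟩, trivial⟩

/-- An invariant closed form on `M` defines the global section `(g, x) ↦ η x`. -/
theorem exists_sectionForm_eq {q : ℕ} {η : M → E [⋀^Fin q]→ₗ[ℝ] ℝ}
    (hη : η ∈ invClosedForms G E M q) :
    ∃ s : constZ (simpSpace D G E M) ⟶ (shAcl D G E M q).toSheaf, sectionForm s = η := by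
  obtain ⟨hs, hcl, hinv⟩ := hη
  let t : ∀ A : SOpen (simpSpace D G E M), (shAcl D G E M q).sec A := fun A =>
    ⟨fun z => η (z.1 : (Fin A.level.len → G) × M).2, fun z hz => by
      refine (shAcl D G E M q).P_congr (f := fun y : (Fin A.level.len → G) × M => η y.2) ?_
        ⟨hs.vGerm z, Eventually.of_forall fun y => hcl (y : (Fin A.level.len → G) × M).2⟩
      filter_upwards [A.carrier.2.mem_nhds hz] with y hy
      exact (ext0_of_mem (fun z : A.carrier => η (z.1 : (Fin A.level.len → G) × M).2) hy).symm⟩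
  obtain ⟨s, hst⟩ := exists_evalZ_eq (F := (shAcl D G E M q).toSheaf) t fun {A B} f =>
    Subtype.ext (funext fun z => hinv _ _)
  refine ⟨s, funext fun x => ?_⟩
  exact congrArg (fun k : (shAcl D G E M q).sec ⟨.mk 0, ⊤⟩ => k.1 ⟨pt0 G x, trivial⟩)
    (hst ⟨.mk 0, ⊤⟩)

variable (D G E M) in
/-- The canonical homomorphism to `A^{N+1}(M)^G_cl` is an isomorphism. -/
theorem evalAcl_bijective (N : ℕ) : Function.Bijective (evalAcl D G E M N) := by
  have hb := singleHom_bijective (shAcl D G E M (N + 1)).toSheaf N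
  refine ⟨fun c c' h => hb.1 (sectionForm_injective (congrArg Subtype.val h)), fun η => ?_⟩
  obtain ⟨s, hs⟩ := exists_sectionForm_eq (D := D) η.2
  obtain ⟨c, hc⟩ := hb.2 s
  refine ⟨c, Subtype.ext ?_⟩
  change sectionForm (singleHom _ N c) = η.1
  rw [hc, hs]

end GlobalSections

end EqDeligne

theorem mainTheorem5
    (D : Type u) [AddCommGroup D] [Module ℝ D] [TopologicalSpace D]
    [IsTopologicalAddGroup D] [ContinuousSMul ℝ D] [LocallyConvexSpace ℝ D] [T2Space D]
    (G : Type u) [TopologicalSpace G] [ChartedSpace D G] [Group G] [LCLieGroup D G]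
    (E : Type u) [AddCommGroup E] [Module ℝ E] [TopologicalSpace E]
    [IsTopologicalAddGroup E] [ContinuousSMul ℝ E] [LocallyConvexSpace ℝ E] [T2Space E]
    (M : Type u) [TopologicalSpace M] [ChartedSpace E M] [LCManifold E M]
    [MulAction G M] [LCSmoothAction D G E M] (N : ℕ) (hN : 1 ≤ N) :
    (∀ m : ℕ, m < N → Function.Bijective (HypCoh.map (piToDel D G E M N) m)) ∧
    Function.Injective (HypCoh.map (piToDel D G E M N) N) ∧
    Function.Exact (HypCoh.map (piToDel D G E M N) N) (curvature D G E M N) ∧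
    ∃ (b : (toDerived _).obj (aclComplex D G E M N) ⟶
          ((toDerived _).obj (piTComplex D G E M))⟦(1 : ℤ)⟧)
      (δ : invClosedForms G E M (N + 1) →+ HypCoh (piTComplex D G E M) (N + 1)),
      Pretriangulated.Triangle.mk ((toDerived _).map (piToDel D G E M N))
          ((toDerived _).map (delToAcl D G E M N)) b ∈
        Pretriangulated.distinguishedTriangles ∧
      (∀ c : HypCoh (aclComplex D G E M N) N,
        δ (evalAcl D G E M N c) = ShiftedHom.comp c b (by push_cast; ring)) ∧
      Function.Exact (curvature D G E M N) δ := by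
  obtain ⟨b, hT⟩ := exists_distinguished_piToDel D G E M hN
  let Z := (DerivedCategory.singleFunctor (AbSheaf (simpSpace D G E M)) 0).obj (constZ _)
  have hev := evalAcl_bijective D G E M N
  have e12 := exact_comp_mor₁_comp_mor₂ _ hT Z
  have e23 := exact_comp_mor₂_comp_mor₃ _ hT Z
  have e31 := exact_comp_mor₃_comp_mor₁ _ hT Z
  have hvan : ∀ (m : ℤ) (_ : m < N) (c : ShiftedHom Z ((toDerived _).obj (aclComplex D G E M N)) m),
      c = 0 := fun m hm c => shiftedHom_single_eq_zero (constZ _) _ hm c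
  have hinj : ∀ m : ℕ, m ≤ N → Function.Injective (HypCoh.map (piToDel D G E M N) m) := by
    intro m hm
    rw [injective_iff_map_eq_zero]
    intro c hc
    -- the kernel is the image of the third group in degree `m - 1 < N`, which vanishes; degrees
    -- are integers, so `m = 0` is no exception
    obtain ⟨c', hc'⟩ := (e31 ((m : ℤ) - 1) m (by ring) c).1 hc
    have h0 := hvan _ (by omega) c'
    subst h0
    rw [← hc']
    exact ShiftedHom.zero_comp Z _ b _
  have hex : Function.Exact (HypCoh.map (piToDel D G E M N) N) (curvature D G E M N) := by
    intro c
    refine Iff.trans ?_ (e12 N c)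
    exact (map_eq_zero_iff (evalAcl D G E M N) hev.1)
  refine ⟨fun m hm => ⟨hinj m hm.le, fun c => (e12 m c).1 (hvan _ (by omega) _)⟩, hinj N le_rfl,
    hex, b, ?_⟩
  -- `δ` is `b_*` composed with the inverse of the evaluation of global sections
  let ev := AddEquiv.ofBijective (evalAcl D G E M N) hev
  let β : HypCoh (aclComplex D G E M N) N →+ HypCoh (piTComplex D G E M) (N + 1) :=
    AddMonoidHom.mk' (fun c => ShiftedHom.comp c b (by push_cast; ring))
      fun c c' => ShiftedHom.add_comp _ _ _ _
  have hβ : ∀ c, (β.comp ev.symm.toAddMonoidHom) (evalAcl D G E M N c) = β c := fun c =>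
    congrArg β (ev.symm_apply_apply c)
  refine ⟨β.comp ev.symm.toAddMonoidHom, hT, hβ, fun η => ?_⟩
  obtain ⟨c, rfl⟩ := hev.2 η
  rw [hβ c]
  refine (e23 N ((N + 1 : ℕ) : ℤ) (by push_cast; ring) c).trans ?_
  constructor
  · rintro ⟨c', rfl⟩
    exact ⟨c', rfl⟩
  · rintro ⟨c', hc'⟩
    exact ⟨c', hev.1 hc'⟩
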